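/- Let $X$ and $U$ be complex separable Hilbert spaces, $\tau>0$, $\kappa\in\mathbb R$, and assume: * $(A_1)$ $A:D(A)\subset X\to X$ generates an immediately compact $C_0$-semigroup $S(\cdot)$ on $X$ (that is, $S(t)$ is compact for every $t>0$). * $(A_2)$ $B\in\mathcal L(U;X_{-1})$, where $X_{-1}$ is the completion of $X$ for the norm $\|f\|_{-1}=\|(\rho_0I-A)^{-1}f\|_X$ and $\rho_0\in\rho(A)\cap\mathbb R$ is fixed. * $(A_3)$ There are $T>0$ and $C>0$ with $\int_0^T\|B^*S^*(t)\psi\|_U^2\,dt\le C\|\psi\|_X^2$ for all $\psi\in D(A^*)$. Here $B^*:D(A^*)\to U$ is the adjoint of $B$ for the duality between $X_{-1}$ and $D(A^*)$ with pivot space $X$, i.e. $B^*\psi=\big((\rho_0I-\widetilde A)^{-1}B\big)^*(\rho_0I-A^*)\psi$, where $(\rho_0I-\widetilde A)^{-1}:X_{-1}\to X$ is the continuous extension of $(\rho_0I-A)^{-1}$. Let $\widetilde S(t)$ be the continuous extension of $S(t)$ to $X_{-1}$. For $y_0\in X$, $\varphi\in L^2(-\tau,0;X)$ and $u\in L^2_{loc}(\mathbb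 R^+;U)$ (that is, $u\in L^2(0,T;U)$ for all $T>0$), a solution of the delayed control system $$y_t(t)=Ay(t)+\kappa y(t-\tau)+Bu(t)\ (t>0),\qquad y(0)=y_0,\qquad y(t)=\varphi(t)\ (-\tau<t<0)\tag{1}$$ is a function $y:(-\tau,\infty)\to X$, continuous on $[0,\infty)$, with $y=\varphi$ a.e. on $(-\tau,0)$, $y(0)=y_0$ and $$y(t)=S(t)y_0+\int_0^tS(t-s)\,\kappa y(s-\tau)\,ds+\int_0^t\widetilde S(t-s)Bu(s)\,ds\quad(t\ge0),$$ where the last integral is taken in $X_{-1}$ (the identity is one in $X_{-1}\supset X$). On the Hilbert space $\mathcal X=X\times L^2(-\tau,0;X)$ let $\mathcal A(f_1,f_2)=(Af_1+\kappa f_2(-\tau),\partial_\theta f_2)$ with domain $D(\mathcal A)=\{(f_1,f_2):f_1\in D(A),\ f_2\in H^1(-\tau,0;X),\ f_2(0)=f_1\}$. Then $\mathcal A$ generates a $C_0$-semigroup $\mathcal S(\cdot)$ on $\mathcal X$, and there is $\gamma>0$ with $(\gamma,\infty)\subset\rho(\mathcal A)$. For every $\rho_1\in\rho(\mathcal A)\cap\mathbb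 R$, let $\mathcal X_{-1}$ be the completion of $\mathcal X$ for the norm $\|(\rho_1I-\mathcal A)^{-1}f\|_{\mathcal X}$ and $\widetilde{\mathcal S}(t)$ the continuous extension of $\mathcal S(t)$ to $\mathcal X_{-1}$; the map $x\mapsto(x,0)$, $X\to\mathcal X$, extends to a bounded linear map $X_{-1}\to\mathcal X_{-1}$, so that $\mathcal B:=(B,0)^\top\in\mathcal L(U;\mathcal X_{-1})$. A mild solution of $$Y_t(t)=\mathcal AY(t)+\mathcal Bu(t)\ (t>0),\qquad Y(0)=Y_0\tag{2}$$ is a function $Y\in C([0,\infty);\mathcal X)$ with $Y(t)=\mathcal S(t)Y_0+\int_0^t\widetilde{\mathcal S}(t-s)\mathcal Bu(s)\,ds$ for all $t\ge0$, the integral being taken in $\mathcal X_{-1}$. Then for all $(y_0,\varphi,u)\in X\times L^2(-\tau,0;X)\times L^2_{loc}(\mathbb R^+;U)$: (i) If $y$ is a solution of (1), then $Y(t):=(y(t),y(t+\cdot)|_{(-\tau,0)})$, $t\ge0$, takes values in $\mathcal X$ and is the unique mild solution of (2) with $Y_0=(y_0,\varphi)$. (ii) If $Y=(y_1,y_2)$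 is a mild solution of (2) with $Y_0=(y_0,\varphi)$, then the function $y$ defined by $y(t)=y_1(t)$ for $t\ge0$ and $y(t)=\varphi(t)$ for $t\in(-\tau,0)$ is the unique solution of (1). Moreover, for every $t\ge0$, $[y_2(t)](\theta)=y(t+\theta)$ for a.e. $\theta\in(-\tau,0)$. -/

import Mathlib

open Set Filter Topology MeasureTheory
open scoped ENNReal ContDiff

noncomputable section

namespace DelaySystem

/-! ### Strongly continuous semigroups, generators, resolvents -/

/-- A `C₀`-semigroup of bounded operators on `E`. Only the values at times `t ≥ 0` matter. -/
structure C0Semigroup (E : Type*) [NormedAddCommGroup E] [NormedSpace ℂ E] where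
  /-- the operator at time `t` -/
  op : ℝ → E →L[ℂ] E
  op_zero : op 0 = ContinuousLinearMap.id ℂ E
  op_add : ∀ s t : ℝ, 0 ≤ s → 0 ≤ t → op (s + t) = (op s).comp (op t)
  strongly_continuous : ∀ x : E, ContinuousOn (fun t => op t x) (Ici 0)

section Abstract

variable {E : Type*} [NormedAddCommGroup E] [NormedSpace ℂ E]

/-- `A` is the generator of `T`: `x ∈ D(A)` and `A x = y` if and only if
`(T(h) x - x) / h → y` as `h → 0⁺`. -/
def C0Semigroup.IsGenerator (T : C0Semigroup E) (A : E →ₗ.[ℂ] E) : Prop :=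
  ∀ x y : E, (x, y) ∈ A.graph ↔
    Tendsto (fun h : ℝ => ((h⁻¹ : ℝ) : ℂ) • (T.op h x - x)) (𝓝[>] 0) (𝓝 y)

/-- The semigroup is immediately compact: `T(t)` is a compact operator for every `t > 0`. -/
def C0Semigroup.ImmediatelyCompact (T : C0Semigroup E) : Prop :=
  ∀ t : ℝ, 0 < t → IsCompactOperator (T.op t)

/-- `z` belongs to the resolvent set of `A`, and `R = (z I - A)⁻¹` (a bounded operator). -/
def IsResolvent (A : E →ₗ.[ℂ] E) (z : ℂ) (R : E →L[ℂ] E) : Prop :=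
  (∀ x : A.domain, R (z • (x : E) - A x) = x) ∧
    ∀ f : E, ∃ h : R f ∈ A.domain, z • R f - A ⟨R f, h⟩ = f

/-- Any semigroup commutes with the resolvents of its generator. -/
theorem C0Semigroup.IsGenerator.commute {T : C0Semigroup E} {A : E →ₗ.[ℂ] E}
    (hT : T.IsGenerator A) {z : ℂ} {R : E →L[ℂ] E} (hR : IsResolvent A z R)
    {t : ℝ} (ht : 0 ≤ t) (x : E) : R (T.op t x) = T.op t (R x) := by
  obtain ⟨h, hx⟩ := hR.2 x
  have hg : (R x, A ⟨R x, h⟩) ∈ A.graph := A.mem_graph ⟨R x, h⟩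
  have hl := (hT _ _).1 hg
  have hl2 : (T.op t (R x), T.op t (A ⟨R x, h⟩)) ∈ A.graph := by
    refine (hT _ _).2 ?_
    have hc := ((T.op t).continuous.tendsto (A ⟨R x, h⟩)).comp hl
    refine hc.congr' ?_
    filter_upwards [self_mem_nhdsWithin] with s hs
    have hs' : (0 : ℝ) ≤ s := le_of_lt hs
    have e : (T.op t) (T.op s (R x)) = (T.op s) (T.op t (R x)) := by
      have h1 := T.op_add t s ht hs'
      have h2 := T.op_add s t hs' ht
      rw [add_comm] at h1
      have := h1.symm.trans h2
      exact congrArg (fun L : E →L[ℂ] E => L (R x)) this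
    simp only [Function.comp_apply, map_smul, map_sub, e]
  rw [LinearPMap.mem_graph_iff] at hl2
  obtain ⟨y, hy1, hy2⟩ := hl2
  have := hR.1 y
  rw [hy2, hy1, ← map_smul, ← map_sub, hx] at this
  exact this

/-! ### The extrapolation space `E₋₁` -/

/-- A copy of `E`, to be normed by `‖f‖₋₁ = ‖R f‖`. -/
def PreExtrap (_R : E →L[ℂ] E) : Type _ := E

instance (R : E →L[ℂ] E) : AddCommGroup (PreExtrap R) := inferInstanceAs (AddCommGroup E)

instance (R : E →L[ℂ] E) : Module ℂ (PreExtrap R) := inferInstanceAs (Module ℂ E)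

/-- The resolvent as a linear map on the copy of `E`. -/
def preLin (R : E →L[ℂ] E) : PreExtrap R →ₗ[ℂ] E := R.toLinearMap

instance (R : E →L[ℂ] E) : SeminormedAddCommGroup (PreExtrap R) :=
  SeminormedAddCommGroup.induced (PreExtrap R) E (preLin R)

instance (R : E →L[ℂ] E) : NormedSpace ℂ (PreExtrap R) :=
  NormedSpace.induced ℂ (PreExtrap R) E (preLin R)

/-- The space `E₋₁`: the completion of `E` with respect to the norm `‖f‖₋₁ = ‖R f‖`, where
`R = (z I - A)⁻¹` in all uses. -/
abbrev Extrap (R : E →L[ℂ] E) : Type _ := UniformSpace.Completion (PreExtrap R)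

/-- The canonical embedding `E → E₋₁`. -/
def toExtrap (R : E →L[ℂ] E) : E →L[ℂ] Extrap R :=
  LinearMap.mkContinuous
    { toFun := fun x => ((show PreExtrap R from x : PreExtrap R) : Extrap R)
      map_add' := fun x y => UniformSpace.Completion.coe_add
        (show PreExtrap R from x) (show PreExtrap R from y)
      map_smul' := fun c x => UniformSpace.Completion.coe_smul c (show PreExtrap R from x) }
    ‖R‖
    (fun x => by
      change ‖((show PreExtrap R from x : PreExtrap R) : Extrap R)‖ ≤ ‖R‖ * ‖x‖
      rw [UniformSpace.Completion.norm_coe]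
      exact R.le_opNorm x)

theorem norm_toExtrap (R : E →L[ℂ] E) (x : E) : ‖toExtrap R x‖ = ‖R x‖ :=
  UniformSpace.Completion.norm_coe (show PreExtrap R from x)

theorem denseRange_toExtrap (R : E →L[ℂ] E) : DenseRange (toExtrap R) :=
  UniformSpace.Completion.denseRange_coe (α := PreExtrap R)

/-- The extension by continuity of `R = (z I - A)⁻¹` to a bounded operator `E₋₁ → E`, that is
`(z I - Ã)⁻¹`. -/
def resolventExt [CompleteSpace E] (R : E →L[ℂ] E) : Extrap R →L[ℂ] E :=
  ContinuousLinearMap.fromCompletion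
    (LinearMap.mkContinuous (preLin R) 1 (fun x => by rw [one_mul]; exact le_of_eq rfl))

theorem resolventExt_toExtrap [CompleteSpace E] (R : E →L[ℂ] E) (x : E) :
    resolventExt R (toExtrap R x) = R x :=
  ContinuousLinearMap.fromCompletion_apply_coe _ (show PreExtrap R from x)

/-- The extension by continuity to `E₋₁` of an operator `L` of `E`. It is used for operators that
commute with `R`, for which it is a bounded linear operator, see below. -/
def extrapMap (R L : E →L[ℂ] E) : Extrap R → Extrap R :=
  UniformSpace.Completion.map (fun x : PreExtrap R => (show PreExtrap R from L x))

/-- `extrapMap R L` is a bounded linear operator extending `L`, if `L` commutes with `R`. -/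
theorem exists_extrapMap_eq (R L : E →L[ℂ] E) (h : ∀ x, R (L x) = L (R x)) :
    ∃ M : Extrap R →L[ℂ] Extrap R, (∀ w, extrapMap R L w = M w) ∧
      ∀ x, M (toExtrap R x) = toExtrap R (L x) := by
  let L' : PreExtrap R →ₗ[ℂ] PreExtrap R := L.toLinearMap
  have hb : ∀ x : PreExtrap R, ‖L' x‖ ≤ ‖L‖ * ‖x‖ := fun x => by
    have hx : ∀ z : E, ‖R (L z)‖ ≤ ‖L‖ * ‖R z‖ := fun z => by
      rw [h]
      exact L.le_opNorm _
    exact hx x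
  refine ⟨(L'.mkContinuous ‖L‖ hb).completion, fun w => ?_, fun x => ?_⟩
  · rw [ContinuousLinearMap.coe_completion]
    rfl
  · exact ContinuousLinearMap.completion_apply_coe _ (show PreExtrap R from x)

variable {U : Type*} [NormedAddCommGroup U]

/-- `u ∈ L²_loc(ℝ⁺; U)`, that is `u ∈ L²(0,T;U)` for every `T > 0`. -/
def L2Loc (u : ℝ → U) : Prop :=
  ∀ T : ℝ, 0 < T → MemLp u 2 (volume.restrict (Ioo 0 T))

/-- `Y` (restricted to `[0,∞)`) is the mild solution of `Y' = A Y + B u`, `Y(0) = Y₀`, where `A`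
generates `T` and `B` takes values in `E₋₁`: `Y ∈ C([0,∞);E)` and
`Y(t) = T(t) Y₀ + ∫₀ᵗ T̃(t-s) B u(s) ds` for `t ≥ 0`, the integral being taken in `E₋₁`. -/
structure IsMildSolution [NormedSpace ℂ U] (T : C0Semigroup E) (R : E →L[ℂ] E)
    (B : U →L[ℂ] Extrap R) (Y₀ : E) (u : ℝ → U) (Y : ℝ → E) : Prop where
  continuousOn : ContinuousOn Y (Ici 0)
  duhamel : ∀ t : ℝ, 0 ≤ t → toExtrap R (Y t) =
    toExtrap R (T.op t Y₀) + ∫ s in (0 : ℝ)..t, extrapMap R (T.op (t - s)) (B (u s))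

end Abstract

/-! ### Admissibility of the control operator -/

section Control

variable {X : Type*} [NormedAddCommGroup X] [InnerProductSpace ℂ X] [CompleteSpace X]
  {U : Type*} [NormedAddCommGroup U] [InnerProductSpace ℂ U] [CompleteSpace U]

open Classical in
/-- The operator `B* : D(A*) → U`, which satisfies
`⟨B v, ψ⟩ = ⟨(ρ₀ I - Ã)⁻¹ B v, (ρ₀ I - A*) ψ⟩_X = ⟨v, B* ψ⟩_U` with the duality pairing of `X₋₁` and
`D(A*)`, so that `B* ψ = ((ρ₀ I - Ã)⁻¹ B)* (ρ₀ I - A*) ψ`; it is set to `0` outside of `D(A*)` (which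
`S*(t)`, `t ≥ 0`, leaves invariant). -/
def controlAdjoint (A : X →ₗ.[ℂ] X) (ρ₀ : ℝ) (R₀ : X →L[ℂ] X) (B : U →L[ℂ] Extrap R₀) (ψ : X) :
    U :=
  if h : ψ ∈ A.adjoint.domain then
    ContinuousLinearMap.adjoint ((resolventExt R₀).comp B)
      ((ρ₀ : ℂ) • ψ - A.adjoint ⟨ψ, h⟩)
  else 0

/-- There are `T > 0` and `C > 0` with `∫₀ᵀ ‖B* S*(t) ψ‖² dt ≤ C ‖ψ‖²` for all `ψ ∈ D(A*)`. -/
def IsAdmissible (S : C0Semigroup X) (A : X →ₗ.[ℂ] X) (ρ₀ : ℝ) (R₀ : X →L[ℂ] X)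
    (B : U →L[ℂ] Extrap R₀) : Prop :=
  ∃ T C : ℝ, 0 < T ∧ 0 < C ∧ ∀ ψ ∈ A.adjoint.domain,
    ∫⁻ t in Ioo 0 T, ‖controlAdjoint A ρ₀ R₀ B (ContinuousLinearMap.adjoint (S.op t) ψ)‖ₑ ^ 2 ≤
      ENNReal.ofReal (C * ‖ψ‖ ^ 2)

end Control

/-! ### The delay system and its state space -/

section Delay

variable {X : Type*} [NormedAddCommGroup X] [InnerProductSpace ℂ X]

/-- Lebesgue measure on `(-τ, 0)`. -/
abbrev histMeasure (τ : ℝ) : Measure ℝ := volume.restrict (Ioo (-τ) 0)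

/-- The history space `L²(-τ, 0; X)`. -/
abbrev Hist (X : Type*) [NormedAddCommGroup X] [InnerProductSpace ℂ X] (τ : ℝ) : Type _ :=
  Lp X 2 (histMeasure τ)

/-- The Hilbert space `X × L²(-τ, 0; X)`. -/
abbrev StateSpace (X : Type*) [NormedAddCommGroup X] [InnerProductSpace ℂ X] (τ : ℝ) : Type _ :=
  WithLp 2 (X × Hist X τ)

/-- `g` is the weak derivative of `f` on `(-τ, 0)`. -/
def IsWeakDeriv (τ : ℝ) (f g : ℝ → X) : Prop :=
  ∀ η : ℝ → ℝ, ContDiff ℝ ∞ η → HasCompactSupport η → tsupport η ⊆ Ioo (-τ) 0 →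
    ∫ θ, deriv η θ • f θ ∂(histMeasure τ) = - ∫ θ, η θ • g θ ∂(histMeasure τ)

/-- `F` is the continuous representative on `[-τ, 0]` of `f`; the boundary values `f(-τ)` and `f(0)`
are `F (-τ)` and `F 0`. -/
def IsContRep (τ : ℝ) (f F : ℝ → X) : Prop :=
  ContinuousOn F (Icc (-τ) 0) ∧ f =ᵐ[histMeasure τ] F

theorem integrable_smul_hist {τ : ℝ} (f : Hist X τ) {η : ℝ → ℝ} (h : Continuous η)
    (hc : HasCompactSupport η) : Integrable (fun θ => η θ • f θ) (histMeasure τ) := by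
  obtain ⟨C, hC⟩ := hc.exists_bound_of_continuous h
  exact Integrable.bdd_smul (𝕜 := ℝ) (φ := η) (f := f) ((Lp.memLp f).integrable (by norm_num))
    C h.aestronglyMeasurable (Eventually.of_forall hC)

/-- The pairs `(f, (A f₁ + κ f₂(-τ), f₂'))` with `f₁ ∈ D(A)`, `f₂ ∈ H¹(-τ,0;X)` and
`f₂(0) = f₁`. -/
def delayGraph (A : X →ₗ.[ℂ] X) (κ τ : ℝ) : Submodule ℂ (StateSpace X τ × StateSpace X τ) where
  carrier := {p | ∃ (h : p.1.fst ∈ A.domain) (F : ℝ → X),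
    IsWeakDeriv τ p.1.snd p.2.snd ∧ IsContRep τ p.1.snd F ∧ F 0 = p.1.fst ∧
      p.2.fst = A ⟨p.1.fst, h⟩ + (κ : ℂ) • F (-τ)}
  zero_mem' := by
    have e : ((0 : Hist X τ) : ℝ → X) =ᵐ[histMeasure τ] fun _ => (0 : X) := Lp.coeFn_zero _ _ _
    refine ⟨A.domain.zero_mem, fun _ => 0, ?_, ⟨continuousOn_const, e⟩, rfl, ?_⟩
    · intro η _ _ _
      have h1 : ∫ θ, deriv η θ • ((0 : Hist X τ) : ℝ → X) θ ∂(histMeasure τ) = 0 :=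
        integral_eq_zero_of_ae (by filter_upwards [e] with θ hθ; exact (congrArg _ hθ).trans (smul_zero _))
      have h2 : ∫ θ, η θ • ((0 : Hist X τ) : ℝ → X) θ ∂(histMeasure τ) = 0 :=
        integral_eq_zero_of_ae (by filter_upwards [e] with θ hθ; exact (congrArg _ hθ).trans (smul_zero _))
      exact h1.trans (by rw [← neg_zero, ← h2]; rfl)
    · have : A ⟨0, A.domain.zero_mem⟩ = 0 := A.map_zero
      change (0 : X) = A ⟨0, A.domain.zero_mem⟩ + (κ : ℂ) • (0 : X)
      rw [this, smul_zero, add_zero]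
  add_mem' := by
    rintro p q ⟨hp, F, hw, hF, h0, hA⟩ ⟨hq, G, hw', hG, h0', hA'⟩
    have e : ((p.1.snd + q.1.snd : Hist X τ) : ℝ → X) =ᵐ[histMeasure τ]
        fun θ => p.1.snd θ + q.1.snd θ := Lp.coeFn_add _ _
    have e' : ((p.2.snd + q.2.snd : Hist X τ) : ℝ → X) =ᵐ[histMeasure τ]
        fun θ => p.2.snd θ + q.2.snd θ := Lp.coeFn_add _ _
    refine ⟨A.domain.add_mem hp hq, fun θ => F θ + G θ, ?_, ⟨hF.1.add hG.1, ?_⟩, ?_, ?_⟩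
    · intro η h1 h2 h3
      have d1 := h1.continuous_deriv (by simp)
      have hs : ∫ θ, deriv η θ • ((p.1.snd + q.1.snd : Hist X τ) : ℝ → X) θ ∂(histMeasure τ) =
          ∫ θ, (deriv η θ • p.1.snd θ + deriv η θ • q.1.snd θ) ∂(histMeasure τ) :=
        integral_congr_ae (by filter_upwards [e] with θ hθ; rw [hθ, smul_add])
      have hs' : ∫ θ, η θ • ((p.2.snd + q.2.snd : Hist X τ) : ℝ → X) θ ∂(histMeasure τ) =
          ∫ θ, (η θ • p.2.snd θ + η θ • q.2.snd θ) ∂(histMeasure τ) :=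
        integral_congr_ae (by filter_upwards [e'] with θ hθ; rw [hθ, smul_add])
      refine hs.trans (Eq.trans ?_ (congrArg Neg.neg hs').symm)
      rw [integral_add (integrable_smul_hist _ d1 h2.deriv) (integrable_smul_hist _ d1 h2.deriv),
        integral_add (integrable_smul_hist _ h1.continuous h2)
          (integrable_smul_hist _ h1.continuous h2), hw η h1 h2 h3, hw' η h1 h2 h3, neg_add]
    · refine e.trans ?_
      filter_upwards [hF.2, hG.2] with θ h1 h2
      rw [h1, h2]
    · change F 0 + G 0 = p.1.fst + q.1.fst
      rw [h0, h0']
    · have : A ⟨p.1.fst + q.1.fst, A.domain.add_mem hp hq⟩ = A ⟨p.1.fst, hp⟩ + A ⟨q.1.fst, hq⟩ :=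
        A.map_add ⟨p.1.fst, hp⟩ ⟨q.1.fst, hq⟩
      change p.2.fst + q.2.fst =
        A ⟨p.1.fst + q.1.fst, A.domain.add_mem hp hq⟩ + (κ : ℂ) • (F (-τ) + G (-τ))
      rw [this, hA, hA', smul_add]
      abel
  smul_mem' := by
    rintro c p ⟨hp, F, hw, hF, h0, hA⟩
    have e : ((c • p.1.snd : Hist X τ) : ℝ → X) =ᵐ[histMeasure τ]
        fun θ => c • p.1.snd θ := Lp.coeFn_smul _ _
    have e' : ((c • p.2.snd : Hist X τ) : ℝ → X) =ᵐ[histMeasure τ]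
        fun θ => c • p.2.snd θ := Lp.coeFn_smul _ _
    refine ⟨A.domain.smul_mem c hp, fun θ => c • F θ, ?_, ⟨hF.1.const_smul c, ?_⟩, ?_, ?_⟩
    · intro η h1 h2 h3
      have hs : ∫ θ, deriv η θ • ((c • p.1.snd : Hist X τ) : ℝ → X) θ ∂(histMeasure τ) =
          ∫ θ, c • (deriv η θ • p.1.snd θ) ∂(histMeasure τ) :=
        integral_congr_ae (by filter_upwards [e] with θ hθ; rw [hθ, smul_comm])
      have hs' : ∫ θ, η θ • ((c • p.2.snd : Hist X τ) : ℝ → X) θ ∂(histMeasure τ) =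
          ∫ θ, c • (η θ • p.2.snd θ) ∂(histMeasure τ) :=
        integral_congr_ae (by filter_upwards [e'] with θ hθ; rw [hθ, smul_comm])
      refine hs.trans (Eq.trans ?_ (congrArg Neg.neg hs').symm)
      rw [integral_smul, integral_smul, hw η h1 h2 h3, smul_neg]
    · refine e.trans ?_
      filter_upwards [hF.2] with θ h1
      rw [h1]
    · change c • F 0 = c • p.1.fst
      rw [h0]
    · have : A ⟨c • p.1.fst, A.domain.smul_mem c hp⟩ = c • A ⟨p.1.fst, hp⟩ :=
        A.map_smul c ⟨p.1.fst, hp⟩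
      change c • p.2.fst = A ⟨c • p.1.fst, A.domain.smul_mem c hp⟩ + (κ : ℂ) • (c • F (-τ))
      rw [this, hA, smul_add, smul_comm (κ : ℂ) c]

/-- The operator `𝒜 (f₁, f₂) = (A f₁ + κ f₂(-τ), f₂')` on `X × L²(-τ,0;X)` with domain
`{(f₁, f₂) : f₁ ∈ D(A), f₂ ∈ H¹(-τ,0;X), f₂(0) = f₁}`. -/
def delayOperator (A : X →ₗ.[ℂ] X) (κ τ : ℝ) : StateSpace X τ →ₗ.[ℂ] StateSpace X τ :=
  (delayGraph A κ τ).toLinearPMap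

/-- The defining pairs are indeed the graph of `delayOperator`. -/
theorem delayOperator_graph [CompleteSpace X] (A : X →ₗ.[ℂ] X) (κ : ℝ) {τ : ℝ} (hτ : 0 < τ) :
    (delayOperator A κ τ).graph = delayGraph A κ τ := by
  refine Submodule.toLinearPMap_graph_eq _ ?_
  rintro ⟨f, g⟩ ⟨h, F, hw, hF, h0, hA⟩ hf
  dsimp only at h hw hF h0 hA hf
  subst hf
  have e : ((0 : Hist X τ) : ℝ → X) =ᵐ[histMeasure τ] fun _ => (0 : X) := Lp.coeFn_zero _ _ _
  have hF0 : EqOn F (fun _ => 0) (Icc (-τ) 0) := by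
    have h1 : F =ᵐ[volume.restrict (Icc (-τ) 0)] fun _ => (0 : X) := by
      have : F =ᵐ[histMeasure τ] fun _ => (0 : X) := hF.2.symm.trans e
      rwa [histMeasure, restrict_Ioo_eq_restrict_Icc] at this
    exact Measure.eqOn_Icc_of_ae_eq _ (by linarith [hτ]) h1 hF.1 continuousOn_const
  have hg : g.snd = 0 := by
    have hl : LocallyIntegrableOn (g.snd : ℝ → X) (Ioo (-τ) 0) volume :=
      IntegrableOn.locallyIntegrableOn ((Lp.memLp g.snd).integrable (by norm_num))
    have := isOpen_Ioo.ae_eq_zero_of_integral_contDiff_smul_eq_zero hl (fun η h1 h2 h3 => by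
      have hz : ∫ θ, deriv η θ • ((0 : Hist X τ) : ℝ → X) θ ∂(histMeasure τ) = 0 :=
        integral_eq_zero_of_ae (by filter_upwards [e] with θ hθ; exact (congrArg _ hθ).trans (smul_zero _))
      have hwe : ∫ θ, η θ • g.snd θ ∂(histMeasure τ) = 0 :=
        neg_eq_zero.1 ((hw η h1 h2 h3).symm.trans hz)
      rw [← hwe]
      refine (setIntegral_eq_integral_of_forall_compl_eq_zero fun θ hθ => ?_).symm
      rw [image_eq_zero_of_notMem_tsupport (fun hh => hθ (h3 hh)), zero_smul])
    refine Lp.ext ?_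
    refine Filter.EventuallyEq.trans ?_ e.symm
    exact (ae_restrict_iff' measurableSet_Ioo).2 this
  have hg1 : g.fst = 0 := by
    rw [hA, hF0 ⟨le_rfl, by linarith⟩, smul_zero, add_zero]
    exact A.map_zero
  exact (WithLp.ofLp_injective 2) (Prod.ext hg1 hg)

variable [CompleteSpace X] {U : Type*} [NormedAddCommGroup U] [InnerProductSpace ℂ U]

/-- `y` (restricted to `(-τ,∞)`) is the solution in `C([0,∞);X)` of
`y'(t) = A y(t) + κ y(t-τ) + B u(t)` for `t > 0`, `y(0) = y₀`, `y = φ` on `(-τ,0)`, that is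
`y(t) = S(t) y₀ + ∫₀ᵗ S(t-s) κ y(s-τ) ds + ∫₀ᵗ S̃(t-s) B u(s) ds` for `t ≥ 0`,
the last integral being taken in `X₋₁`. -/
structure IsDelaySolution (S : C0Semigroup X) (R₀ : X →L[ℂ] X) (B : U →L[ℂ] Extrap R₀)
    (κ τ : ℝ) (y₀ : X) (φ : Hist X τ) (u : ℝ → U) (y : ℝ → X) : Prop where
  history : y =ᵐ[histMeasure τ] φ
  initial : y 0 = y₀
  continuousOn : ContinuousOn y (Ici 0)
  duhamel : ∀ t : ℝ, 0 ≤ t → toExtrap R₀ (y t) =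
    toExtrap R₀ (S.op t y₀ + ∫ s in (0 : ℝ)..t, S.op (t - s) ((κ : ℂ) • y (s - τ))) +
      ∫ s in (0 : ℝ)..t, extrapMap R₀ (S.op (t - s)) (B (u s))

end Delay

end DelaySystem

end

/-! Both formulations live in extrapolation spaces, and the resolvents bring them down to the same
equation: a delay equation in X with the locally integrable X-valued forcing v = R̃₀ B u, where R̃₀
is the extension of R₀ to X₋₁.

For (1): R̃₀ is an isometry of X₋₁ into X that commutes with the semigroup and with Bochner
integrals. So y solves (1) exactly when, besides having the right data and continuity, R₀ y is a
mild solution of the delay equation with forcing v (`isDelaySolution_iff`).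

For (2): let `stateMap τ R₀` apply R₀ to both components. It commutes with 𝒮, hence with R₁. There
is a bounded L : X → 𝒳 with L (R₀ x) = R₁ (x, 0) (`liftResolvent_apply_resolvent`). It makes x ↦ (x,
0) extend to J : X₋₁ → 𝒳₋₁ with R̃₁ J = L R̃₀. Applying first R̃₁ and then `stateMap τ R₀` to the
Duhamel formula produces L R₀ v = R₁ (v, 0) under the integral, and the injective R₁ can be
cancelled (`mild_iff_stateMap`). What remains is stateMap R₀ Y(t) = 𝒮(t) stateMap R₀ Y₀ + ∫₀ᵗ 𝒮(t-s)
(v(s), 0) ds, an identity in 𝒳.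

The two sides meet in `stateOf_eq_duhamel`: the state (z(t), z_t) of a solution z of the forced
delay equation is given by this variation of constants formula. Injectivity of R₀ then takes R₀ y
back to y. Uniqueness for (2) is immediate, since its right-hand side does not contain Y; for (1) it
is the method of steps.

The semigroup 𝒮 is constructed explicitly. The fundamental solution of the delay equation is the
locally finite sum of κᵏ (t-kτ)₊ᵏ/k! S(t-kτ), and convolution with it solves the forced equation.
Translation of solutions and uniqueness give the semigroup law. That its generator is 𝒜 follows from
the inclusion of the generator in 𝒜, together with surjectivity of ρ minus the generator and
injectivity of ρ - 𝒜 for one large ρ. -/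

noncomputable section

namespace DelaySystem

/-! ### Strongly continuous families of bounded operators -/

section StronglyContinuous

variable {E : Type*} [NormedAddCommGroup E] [NormedSpace ℂ E]
  {F : Type*} [NormedAddCommGroup F] [NormedSpace ℂ F]

/-- A strongly continuous family of bounded operators is bounded on compact intervals. -/
theorem exists_norm_le_of_stronglyContinuous [CompleteSpace E] {K : ℝ → E →L[ℂ] F}
    (hK : ∀ x, Continuous fun t => K t x) (a b : ℝ) :
    ∃ M : ℝ, 0 ≤ M ∧ ∀ t ∈ Icc a b, ‖K t‖ ≤ M := by
  obtain ⟨M, hM⟩ := banach_steinhaus (g := fun t : Icc a b => K t) (fun x => by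
    obtain ⟨C, hC⟩ := (isCompact_Icc (a := a) (b := b)).exists_bound_of_continuousOn
      (hK x).continuousOn
    exact ⟨C, fun i => hC i i.2⟩)
  exact ⟨max M 0, le_max_right _ _, fun t ht => (hM ⟨t, ht⟩).trans (le_max_left _ _)⟩

/-- Strong continuity becomes joint continuity because the family is locally uniformly bounded
(Banach–Steinhaus): split K(t)x - K(t₀)x₀ into K(t)(x - x₀) and (K(t) - K(t₀))x₀. -/
theorem continuous_uncurry_of_stronglyContinuous [CompleteSpace E] {K : ℝ → E →L[ℂ] F}
    (hK : ∀ x, Continuous fun t => K t x) : Continuous fun p : ℝ × E => K p.1 p.2 := by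
  rw [continuous_iff_continuousAt]
  rintro ⟨t₀, x₀⟩
  obtain ⟨M, hM0, hM⟩ := exists_norm_le_of_stronglyContinuous hK (t₀ - 1) (t₀ + 1)
  rw [ContinuousAt, tendsto_iff_norm_sub_tendsto_zero]
  have h1 : Tendsto (fun p : ℝ × E => M * ‖p.2 - x₀‖ + ‖K p.1 x₀ - K t₀ x₀‖) (𝓝 (t₀, x₀))
      (𝓝 0) := by
    have : Continuous fun p : ℝ × E => M * ‖p.2 - x₀‖ + ‖K p.1 x₀ - K t₀ x₀‖ := by
      have := (hK x₀).comp (continuous_fst (X := ℝ) (Y := E))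
      simp only [Function.comp_def] at this
      fun_prop
    simpa using this.tendsto (t₀, x₀)
  refine squeeze_zero' (Eventually.of_forall fun _ => norm_nonneg _) ?_ h1
  have h2 : ∀ᶠ p : ℝ × E in 𝓝 (t₀, x₀), p.1 ∈ Icc (t₀ - 1) (t₀ + 1) :=
    continuous_fst.continuousAt.eventually (Icc_mem_nhds (by simp) (by simp))
  filter_upwards [h2] with p hp
  calc ‖K p.1 p.2 - K t₀ x₀‖ = ‖K p.1 (p.2 - x₀) + (K p.1 x₀ - K t₀ x₀)‖ := by
        rw [map_sub]; congr 1; abel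
    _ ≤ ‖K p.1 (p.2 - x₀)‖ + ‖K p.1 x₀ - K t₀ x₀‖ := norm_add_le _ _
    _ ≤ _ := by gcongr; exact (K p.1).le_of_opNorm_le (hM _ hp) _

/-- The strong integral `x ↦ ∫ₐᵇ K(t) x dt`. -/
def strongIntegral [CompleteSpace E] (K : ℝ → E →L[ℂ] F)
    (hK : ∀ x, Continuous fun t => K t x) (a b : ℝ) : E →L[ℂ] F :=
  LinearMap.mkContinuousOfExistsBound
    { toFun := fun x => ∫ t in a..b, K t x
      map_add' := fun x y => by
        simp only [map_add]
        exact intervalIntegral.integral_add ((hK x).intervalIntegrable _ _)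
          ((hK y).intervalIntegrable _ _)
      map_smul' := fun c x => by
        simp only [map_smul, RingHom.id_apply]
        exact intervalIntegral.integral_smul _ _ } (by
    obtain ⟨M, hM0, hM⟩ := exists_norm_le_of_stronglyContinuous hK (min a b) (max a b)
    refine ⟨M * |b - a|, fun x => ?_⟩
    have := intervalIntegral.norm_integral_le_of_norm_le_const (a := a) (b := b)
      (f := fun t => K t x) (C := M * ‖x‖) (fun t ht => (K t).le_of_opNorm_le
        (hM t ⟨ht.1.le, ht.2⟩) x)
    calc _ ≤ _ := this
      _ = _ := by ring)

theorem strongIntegral_apply [CompleteSpace E] {K : ℝ → E →L[ℂ] F}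
    (hK : ∀ x, Continuous fun t => K t x) (a b : ℝ) (x : E) :
    strongIntegral K hK a b x = ∫ t in a..b, K t x := rfl

end StronglyContinuous

/-! ### Semigroups, generators and resolvents -/

section Semigroup

variable {E : Type*} [NormedAddCommGroup E] [NormedSpace ℂ E]

theorem C0Semigroup.op_add_apply (T : C0Semigroup E) {s t : ℝ} (hs : 0 ≤ s) (ht : 0 ≤ t) (x : E) :
    T.op (s + t) x = T.op s (T.op t x) := by
  rw [T.op_add s t hs ht]; rfl

theorem C0Semigroup.op_zero_apply (T : C0Semigroup E) (x : E) : T.op 0 x = x := by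
  rw [T.op_zero]; rfl

theorem C0Semigroup.op_comm (T : C0Semigroup E) {s t : ℝ} (hs : 0 ≤ s) (ht : 0 ≤ t) (x : E) :
    T.op s (T.op t x) = T.op t (T.op s x) := by
  rw [← T.op_add_apply hs ht, add_comm, T.op_add_apply ht hs]

/-- The semigroup, extended to negative times by the identity. -/
def C0Semigroup.ext (T : C0Semigroup E) (t : ℝ) : E →L[ℂ] E := T.op (max t 0)

theorem C0Semigroup.ext_of_nonneg (T : C0Semigroup E) {t : ℝ} (ht : 0 ≤ t) : T.ext t = T.op t := by
  rw [C0Semigroup.ext, max_eq_left ht]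

theorem C0Semigroup.continuous_ext (T : C0Semigroup E) (x : E) : Continuous fun t => T.ext t x :=
  (T.strongly_continuous x).comp_continuous (f := fun t : ℝ => max t 0) (by fun_prop)
    (fun t => Set.mem_Ici.2 (le_max_right _ _))

/-- `y` is the value at `x` of the generator of `T`. -/
def C0Semigroup.GenRel (T : C0Semigroup E) (x y : E) : Prop :=
  Tendsto (fun h : ℝ => ((h⁻¹ : ℝ) : ℂ) • (T.op h x - x)) (𝓝[>] 0) (𝓝 y)

theorem C0Semigroup.GenRel.map {T : C0Semigroup E} {x y : E} (h : T.GenRel x y) (C : E →L[ℂ] E)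
    (hC : ∀ t, 0 ≤ t → ∀ x, C (T.op t x) = T.op t (C x)) : T.GenRel (C x) (C y) := by
  refine ((C.continuous.tendsto y).comp h).congr' ?_
  filter_upwards [self_mem_nhdsWithin] with s hs
  simp only [Function.comp_apply, map_smul, map_sub, hC s (le_of_lt hs)]

theorem C0Semigroup.GenRel.unique {T : C0Semigroup E} {x y z : E} (h : T.GenRel x y)
    (h' : T.GenRel x z) : y = z := tendsto_nhds_unique h h'

/-- Lets the one-sided difference quotient of an orbit be computed by ordinary calculus, from a
formula g that makes sense on both sides of 0. -/
theorem C0Semigroup.genRel_of_hasDerivAt {T : C0Semigroup E} {x y : E} {g : ℝ → E}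
    (hg : HasDerivAt g y 0) (h : ∀ t, 0 ≤ t → T.op t x = g t) : T.GenRel x y := by
  have h0 := h 0 le_rfl
  rw [T.op_zero_apply] at h0
  refine ((hasDerivAt_iff_tendsto_slope_zero.1 hg).mono_left
    (nhdsWithin_mono _ fun t (ht : 0 < t) => ne_of_gt ht)).congr' ?_
  filter_upwards [self_mem_nhdsWithin] with s hs
  rw [h s (le_of_lt hs), h0, zero_add, Complex.coe_smul]

/-- Every large real number is in the resolvent set of the generator of a `C₀`-semigroup. -/
theorem C0Semigroup.exists_resolvent [CompleteSpace E] (T : C0Semigroup E) :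
    ∃ γ : ℝ, 0 < γ ∧ ∀ ρ : ℝ, γ < ρ → ∃ R : E →L[ℂ] E,
      (∀ f, T.GenRel (R f) ((ρ : ℂ) • R f - f)) ∧
      ∀ x y, T.GenRel x y → R ((ρ : ℂ) • x - y) = x := by
  -- Since exp ρ ≥ ρ + 1 > ‖T(1)‖, the operator N = 1 - e^{-ρ} T(1) is invertible by a Neumann
  -- series. The resolvent is the Laplace transform, cut into unit intervals: ∫₀¹ e^{-ρt} T(t) dt
  -- composed with N⁻¹. No exponential growth bound of T is needed.
  refine ⟨‖T.op 1‖ + 1, by positivity, fun ρ hρ => ?_⟩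
  set g : ℝ → E →L[ℂ] E := fun t => ((Real.exp (-ρ * t) : ℝ) : ℂ) • T.ext t with hgdef
  have hg : ∀ x, Continuous fun t => g t x := fun x => by
    have := T.continuous_ext x
    simp only [hgdef, smul_apply]
    fun_prop
  set I := strongIntegral g hg 0 1 with hI
  have hcomm : ∀ t, 0 ≤ t → ∀ x, I (T.op t x) = T.op t (I x) := fun t ht x => by
    rw [hI, strongIntegral_apply, strongIntegral_apply,
      ← (T.op t).intervalIntegral_comp_comm ((hg x).intervalIntegrable _ _)]
    congr 1
    ext s
    simp only [hgdef, smul_apply, map_smul]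
    rw [C0Semigroup.ext, T.op_comm (le_max_right _ _) ht]
  set N : E →L[ℂ] E := 1 - ((Real.exp (-ρ) : ℝ) : ℂ) • T.op 1 with hN
  have hlt : ‖((Real.exp (-ρ) : ℝ) : ℂ) • T.op 1‖ < 1 := by
    rw [norm_smul, Complex.norm_real, Real.norm_eq_abs, abs_of_pos (Real.exp_pos _), Real.exp_neg,
      inv_mul_lt_iff₀ (Real.exp_pos _), mul_one]
    linarith [Real.add_one_le_exp ρ, norm_nonneg (T.op 1)]
  obtain ⟨u, hu⟩ := isUnit_one_sub_of_norm_lt_one hlt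
  rw [← hN] at hu
  -- With Γ(t) = ∫₀ᵗ e^{-ρs} T(s)x ds one has T(t) I x = e^{ρt} (Γ(1+t) - Γ(t)); its derivative at 0
  -- is ρ I x + g(1)x - g(0)x = ρ I x - N x.
  have hGI : ∀ x, T.GenRel (I x) ((ρ : ℂ) • I x - N x) := fun x => by
    set Γ : ℝ → E := fun t => ∫ s in (0 : ℝ)..t, g s x with hΓ
    have hd : ∀ t, HasDerivAt Γ (g t x) t := fun t => by
      exact intervalIntegral.integral_hasDerivAt_right ((hg x).intervalIntegrable _ _)
        ((hg x).stronglyMeasurableAtFilter _ _) (hg x).continuousAt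
    have hd1 : HasDerivAt (fun h : ℝ => Γ (1 + h) - Γ h) (g 1 x - g 0 x) 0 := by
      refine HasDerivAt.sub ?_ (hd 0)
      have := HasDerivAt.comp_const_add (1 : ℝ) (0 : ℝ) (f := Γ) (f' := g 1 x)
        (by simpa using hd 1)
      exact this
    have he : HasDerivAt (fun h : ℝ => Real.exp (ρ * h)) ρ 0 := by
      have := ((hasDerivAt_id (0 : ℝ)).const_mul ρ).exp
      simpa using this
    have hd2 := he.smul hd1
    have hI1 : I x = Γ 1 := rfl
    have hval : Real.exp (ρ * 0) • (g 1 x - g 0 x) + ρ • (Γ (1 + 0) - Γ 0) =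
        (ρ : ℂ) • I x - N x := by
      have e0 : Γ 0 = 0 := intervalIntegral.integral_same
      have e1 : g 0 x = x := by simp [hgdef, C0Semigroup.ext, T.op_zero]
      have e2 : g 1 x = ((Real.exp (-ρ) : ℝ) : ℂ) • T.op 1 x := by
        simp [hgdef, C0Semigroup.ext]
      rw [e0, e1, e2, hI1, hN, Complex.coe_smul]
      simp only [mul_zero, Real.exp_zero, one_smul, add_zero, sub_zero, sub_apply,
        one_apply_eq_self, smul_apply, Complex.coe_smul]
      abel
    rw [hval] at hd2
    refine T.genRel_of_hasDerivAt hd2 fun t ht => ?_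
    rw [hI1, hΓ, ← (T.op t).intervalIntegral_comp_comm ((hg x).intervalIntegrable _ _)]
    have e1 : ∀ s ∈ uIcc (0 : ℝ) 1, T.op t (g s x) = Real.exp (ρ * t) • g (s + t) x := by
      intro s hs
      rw [uIcc_of_le zero_le_one] at hs
      simp only [hgdef, smul_apply, Complex.coe_smul, ContinuousLinearMap.map_smul_of_tower]
      rw [T.ext_of_nonneg hs.1, T.ext_of_nonneg (add_nonneg hs.1 ht), add_comm s t,
        T.op_add_apply ht hs.1, smul_smul, ← Real.exp_add]
      congr 2; ring
    rw [intervalIntegral.integral_congr e1, intervalIntegral.integral_smul]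
    congr 1
    rw [intervalIntegral.integral_comp_add_right (fun s => g s x), zero_add]
    exact (intervalIntegral.integral_interval_sub_left ((hg x).intervalIntegrable _ _)
      ((hg x).intervalIntegrable _ _)).symm
  set V : E →L[ℂ] E := ((u⁻¹ : (E →L[ℂ] E)ˣ) : E →L[ℂ] E) with hV
  have hNV : ∀ x, N (V x) = x := fun x => by
    have : (u : E →L[ℂ] E) * V = 1 := u.mul_inv
    rw [← hu]
    exact congrArg (fun L : E →L[ℂ] E => L x) this
  have hVcomm : ∀ t, 0 ≤ t → ∀ x, V (T.op t x) = T.op t (V x) := fun t ht x => by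
    have : Commute (T.op t) (u : E →L[ℂ] E) := by
      rw [hu, hN]
      ext y
      simp only [mul_apply_eq_comp, sub_apply,
        one_apply_eq_self, smul_apply, map_sub, map_smul]
      rw [T.op_comm ht zero_le_one]
    have := this.units_inv_right
    exact (congrArg (fun L : E →L[ℂ] E => L x) this.eq).symm
  have hG : ∀ f, T.GenRel ((I.comp V) f) ((ρ : ℂ) • (I.comp V) f - f) := fun f => by
    have := hGI (V f)
    rwa [hNV] at this
  refine ⟨I.comp V, hG, fun x y hxy => ?_⟩
  -- The candidate resolvent commutes with T, so it sends the pair (x, y) to a pair of the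
  -- generator; uniqueness of limits against `hG x` makes the right inverse also a left inverse.
  have h1 := hxy.map (I.comp V) (fun t ht z => by
    simp only [ContinuousLinearMap.comp_apply]
    rw [hVcomm t ht, hcomm t ht])
  rw [map_sub, map_smul, h1.unique (hG x)]
  abel

theorem IsResolvent.apply_of_graph {A : E →ₗ.[ℂ] E} {z : ℂ} {R : E →L[ℂ] E}
    (hR : IsResolvent A z R) {x y : E} (h : (x, y) ∈ A.graph) : R (z • x - y) = x := by
  rw [LinearPMap.mem_graph_iff] at h
  obtain ⟨w, rfl, rfl⟩ := h
  exact hR.1 w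

theorem IsResolvent.mem_graph {A : E →ₗ.[ℂ] E} {z : ℂ} {R : E →L[ℂ] E}
    (hR : IsResolvent A z R) (f : E) : (R f, z • R f - f) ∈ A.graph := by
  obtain ⟨h, hf⟩ := hR.2 f
  have := A.mem_graph ⟨R f, h⟩
  convert this using 2
  nth_rewrite 2 [← hf]
  abel

theorem IsResolvent.injective {A : E →ₗ.[ℂ] E} {z : ℂ} {R : E →L[ℂ] E}
    (hR : IsResolvent A z R) : Function.Injective R := by
  rw [injective_iff_map_eq_zero]
  intro f hf
  obtain ⟨h, hf'⟩ := hR.2 f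
  have h0 : A ⟨R f, h⟩ = 0 := by
    have : (⟨R f, h⟩ : A.domain) = 0 := Subtype.ext hf
    rw [this, LinearPMap.map_zero]
  rw [← hf', h0, hf, smul_zero, sub_zero]

theorem isResolvent_of_graph {A : E →ₗ.[ℂ] E} {z : ℂ} {R : E →L[ℂ] E}
    (h1 : ∀ f, (R f, z • R f - f) ∈ A.graph)
    (h2 : ∀ x y, (x, y) ∈ A.graph → R (z • x - y) = x) : IsResolvent A z R := by
  refine ⟨fun x => h2 _ _ (A.mem_graph x), fun f => ?_⟩
  have := h1 f
  rw [LinearPMap.mem_graph_iff] at this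
  obtain ⟨w, hw1, hw2⟩ := this
  dsimp only at hw1 hw2
  have hd : R f ∈ A.domain := hw1 ▸ w.2
  refine ⟨hd, ?_⟩
  have : (⟨R f, hd⟩ : A.domain) = w := Subtype.ext hw1.symm
  rw [this, hw2]
  abel

/-- A bounded operator commuting with a semigroup commutes with the resolvents of its generator. -/
theorem C0Semigroup.IsGenerator.resolvent_comm {T : C0Semigroup E} {A : E →ₗ.[ℂ] E}
    (hA : T.IsGenerator A) {z : ℂ} {R : E →L[ℂ] E} (hR : IsResolvent A z R) (C : E →L[ℂ] E)
    (hC : ∀ t, 0 ≤ t → ∀ x, C (T.op t x) = T.op t (C x)) (x : E) : R (C x) = C (R x) := by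
  have h := C0Semigroup.GenRel.map ((hA _ _).1 (hR.mem_graph x)) C hC
  have := hR.apply_of_graph ((hA _ _).2 h)
  rw [map_sub C, map_smul, sub_sub_cancel] at this
  exact this

end Semigroup

/-! ### Convolution of an operator family with a locally integrable function -/

section Convolution

variable {E : Type*} [NormedAddCommGroup E] [NormedSpace ℂ E]
  {F : Type*} [NormedAddCommGroup F] [NormedSpace ℂ F]

theorem norm_conv_le {K : ℝ → E →L[ℂ] F} {g : ℝ → E} {t M : ℝ} (ht : 0 ≤ t)
    (hM : ∀ r ∈ Icc 0 t, ‖K r‖ ≤ M) (hg : IntervalIntegrable g volume 0 t) :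
    ‖∫ s in (0 : ℝ)..t, K (t - s) (g s)‖ ≤ M * ∫ s in (0 : ℝ)..t, ‖g s‖ := by
  rw [← intervalIntegral.integral_const_mul]
  refine intervalIntegral.norm_integral_le_of_norm_le ht ?_ (hg.norm.const_mul M)
  refine Eventually.of_forall fun s hs => ?_
  exact (K (t - s)).le_of_opNorm_le (hM _ ⟨by linarith [hs.2], by linarith [hs.1]⟩) _

variable [CompleteSpace E]

theorem aestronglyMeasurable_apply_of_stronglyContinuous {K : ℝ → E →L[ℂ] F}
    (hK : ∀ x, Continuous fun t => K t x) {α : Type*} [MeasurableSpace α] {μ : Measure α}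
    {a : α → ℝ} {g : α → E} (ha : AEStronglyMeasurable a μ) (hg : AEStronglyMeasurable g μ) :
    AEStronglyMeasurable (fun s => K (a s) (g s)) μ :=
  (continuous_uncurry_of_stronglyContinuous hK).comp_aestronglyMeasurable (ha.prodMk hg)

theorem intervalIntegrable_conv {K : ℝ → E →L[ℂ] F} (hK : ∀ x, Continuous fun t => K t x)
    {g : ℝ → E} {a b : ℝ} (hg : IntervalIntegrable g volume a b) (t : ℝ) :
    IntervalIntegrable (fun s => K (t - s) (g s)) volume a b := by
  obtain ⟨M, hM0, hM⟩ := exists_norm_le_of_stronglyContinuous hK (t - max a b) (t - min a b)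
  rw [intervalIntegrable_iff] at hg ⊢
  refine Integrable.mono' (hg.norm.const_mul M)
    (aestronglyMeasurable_apply_of_stronglyContinuous hK (by fun_prop) hg.aestronglyMeasurable) ?_
  filter_upwards [ae_restrict_mem measurableSet_uIoc] with s hs
  exact (K (t - s)).le_of_opNorm_le (hM _ ⟨by linarith [hs.2], by linarith [hs.1]⟩) _

/-- Dominated convergence: the integral is written over the fixed interval [0, t₀ + 1] with the
cut-off s ≤ t in the integrand, which for every s ≠ t₀ is continuous in t at t₀. The bound for K is
taken on negative times too, because t - s may be negative once the cut-off is dropped from the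
estimate. -/
theorem continuousOn_conv [CompleteSpace F] {K : ℝ → E →L[ℂ] F}
    (hK : ∀ x, Continuous fun t => K t x)
    {g : ℝ → E} (hg : ∀ t, 0 ≤ t → IntervalIntegrable g volume 0 t) :
    ContinuousOn (fun t => ∫ s in (0 : ℝ)..t, K (t - s) (g s)) (Ici 0) := by
  intro t₀ (ht₀ : 0 ≤ t₀)
  set T := t₀ + 1 with hT
  have hT0 : 0 ≤ T := by linarith
  obtain ⟨M, hM0, hM⟩ := exists_norm_le_of_stronglyContinuous hK (-T) T
  have hev : ∀ᶠ t in 𝓝[Ici 0] t₀, t ∈ Icc 0 T := by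
    filter_upwards [self_mem_nhdsWithin, mem_nhdsWithin_of_mem_nhds
      (Iic_mem_nhds (show t₀ < T by linarith))] with t h1 h2 using ⟨h1, h2⟩
  have hgT := hg T hT0
  have key : ContinuousWithinAt (fun t => ∫ s in (0 : ℝ)..T,
      {s | s ≤ t}.indicator (fun s => K (t - s) (g s)) s) (Ici 0) t₀ := by
    refine intervalIntegral.continuousWithinAt_of_dominated_interval
      (bound := fun s => M * ‖g s‖) ?_ ?_ (hgT.norm.const_mul M) ?_
    · refine Eventually.of_forall fun t => ?_
      exact AEStronglyMeasurable.indicator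
        (intervalIntegrable_iff.1 (intervalIntegrable_conv hK hgT t)).aestronglyMeasurable
        measurableSet_Iic
    · filter_upwards [hev] with t ht
      refine Eventually.of_forall fun s hs => ?_
      rw [uIoc_of_le hT0] at hs
      refine (norm_indicator_le_norm_self _ _).trans ?_
      exact (K (t - s)).le_of_opNorm_le
        (hM _ ⟨by linarith [hs.2, ht.1], by linarith [hs.1, ht.2]⟩) _
    · have hne : ∀ᵐ s : ℝ, s ≠ t₀ := by
        simp [ae_iff]
      filter_upwards [hne] with s hs _
      refine ContinuousAt.continuousWithinAt ?_
      have hc : Continuous fun t => K (t - s) (g s) := (hK (g s)).comp (by fun_prop)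
      rcases lt_or_gt_of_ne hs with h | h
      · refine hc.continuousAt.congr ?_
        filter_upwards [Ioi_mem_nhds h] with t ht
        rw [indicator_of_mem]
        exact le_of_lt (mem_Ioi.1 ht)
      · refine (continuousAt_const (y := (0 : F))).congr ?_
        filter_upwards [Iio_mem_nhds h] with t ht
        rw [indicator_of_notMem]
        exact not_le.2 (mem_Iio.1 ht)
  refine key.congr_of_eventuallyEq ?_ ?_
  · filter_upwards [hev] with t ht
    exact (intervalIntegral.integral_indicator ht).symm
  · exact (intervalIntegral.integral_indicator ⟨ht₀, by linarith⟩).symm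

end Convolution

/-! ### Transport between the extrapolation space and the original space -/

section Extrapolation

variable {E : Type*} [NormedAddCommGroup E] [NormedSpace ℂ E] [CompleteSpace E]

/-- The norm of E₋₁ is by definition ‖R ·‖ on the dense image of E, so the extended resolvent is
isometric. Injectivity and commutation with integrals both come from this. -/
theorem norm_resolventExt (R : E →L[ℂ] E) (w : Extrap R) : ‖resolventExt R w‖ = ‖w‖ := by
  refine (denseRange_toExtrap R).induction_on (p := fun w => ‖resolventExt R w‖ = ‖w‖) w
    (isClosed_eq (by fun_prop) (by fun_prop)) fun x => ?_
  rw [resolventExt_toExtrap, norm_toExtrap]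

/-- The resolvent is an isometry of `E₋₁` into `E`. -/
def resolventIsometry (R : E →L[ℂ] E) : Extrap R →ₗᵢ[ℂ] E :=
  ⟨(resolventExt R).toLinearMap, norm_resolventExt R⟩

theorem resolventExt_injective (R : E →L[ℂ] E) : Function.Injective (resolventExt R) :=
  (resolventIsometry R).injective

theorem toExtrap_injective {R : E →L[ℂ] E} (hR : Function.Injective R) :
    Function.Injective (toExtrap R) := fun x y h => by
  have := congrArg (resolventExt R) h
  rw [resolventExt_toExtrap, resolventExt_toExtrap] at this
  exact hR this

theorem resolventExt_extrapMap {R L : E →L[ℂ] E} (h : ∀ x, R (L x) = L (R x)) (w : Extrap R) :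
    resolventExt R (extrapMap R L w) = L (resolventExt R w) := by
  obtain ⟨M, hM, hM'⟩ := exists_extrapMap_eq R L h
  rw [hM]
  refine (denseRange_toExtrap R).induction_on
    (p := fun w => resolventExt R (M w) = L (resolventExt R w)) w
    (isClosed_eq (by fun_prop) (by fun_prop)) fun x => ?_
  rw [hM', resolventExt_toExtrap, resolventExt_toExtrap, h]

/-- No integrability is required: a linear isometry commutes with the Bochner integral also when the
integrand is not integrable. -/
theorem resolventExt_intervalIntegral (R : E →L[ℂ] E) (f : ℝ → Extrap R) (a b : ℝ) :
    resolventExt R (∫ s in a..b, f s) = ∫ s in a..b, resolventExt R (f s) := by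
  have h : ∀ c d, resolventExt R (∫ s in Ioc c d, f s) = ∫ s in Ioc c d, resolventExt R (f s) :=
    fun c d => ((resolventIsometry R).integral_comp_comm _).symm
  simp only [intervalIntegral, map_sub, h]

/-- The mild formulation in `E₋₁`, transported to `E` by the resolvent. -/
theorem toExtrap_eq_add_integral_iff {T : C0Semigroup E} {A : E →ₗ.[ℂ] E} (hA : T.IsGenerator A)
    {z : ℂ} {R : E →L[ℂ] E} (hR : IsResolvent A z R) (x y : E) (w : ℝ → Extrap R) {t : ℝ}
    (ht : 0 ≤ t) :
    toExtrap R x = toExtrap R y + ∫ s in (0 : ℝ)..t, extrapMap R (T.op (t - s)) (w s) ↔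
      R x = R y + ∫ s in (0 : ℝ)..t, T.op (t - s) (resolventExt R (w s)) := by
  rw [← (resolventExt_injective R).eq_iff, map_add, resolventExt_toExtrap, resolventExt_toExtrap,
    resolventExt_intervalIntegral]
  have : ∫ s in (0 : ℝ)..t, resolventExt R (extrapMap R (T.op (t - s)) (w s)) =
      ∫ s in (0 : ℝ)..t, T.op (t - s) (resolventExt R (w s)) := by
    refine intervalIntegral.integral_congr fun s hs => ?_
    rw [uIcc_of_le ht] at hs
    exact resolventExt_extrapMap (hA.commute hR (by linarith [hs.2])) _
  rw [this]

/-- A bounded map `R x ↦ R' (j x)` extends to the extrapolation spaces. -/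
theorem exists_extrap_map {E' : Type*} [NormedAddCommGroup E'] [NormedSpace ℂ E']
    [CompleteSpace E'] {R : E →L[ℂ] E} {R' : E' →L[ℂ] E'} (j : E →L[ℂ] E') (L : E →L[ℂ] E')
    (h : ∀ x, L (R x) = R' (j x)) :
    ∃ J : Extrap R →L[ℂ] Extrap R', (∀ x, J (toExtrap R x) = toExtrap R' (j x)) ∧
      ∀ w, resolventExt R' (J w) = L (resolventExt R w) := by
  let j' : PreExtrap R →ₗ[ℂ] Extrap R' := ((toExtrap R').comp j).toLinearMap
  -- The factorisation through R gives ‖j x‖₋₁ = ‖R' (j x)‖ = ‖L (R x)‖ ≤ ‖L‖ ‖x‖₋₁, the bound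
  -- needed to extend j to the completion.
  have hb' : ∀ x : E, ‖toExtrap R' (j x)‖ ≤ ‖L‖ * ‖R x‖ := fun x => by
    rw [norm_toExtrap, ← h]
    exact L.le_opNorm _
  have hb : ∀ x : PreExtrap R, ‖j' x‖ ≤ ‖L‖ * ‖x‖ := fun x => hb' x
  let J : Extrap R →L[ℂ] Extrap R' := ContinuousLinearMap.fromCompletion (j'.mkContinuous ‖L‖ hb)
  have hJ : ∀ x, J (toExtrap R x) = toExtrap R' (j x) := fun x =>
    ContinuousLinearMap.fromCompletion_apply_coe _ (show PreExtrap R from x)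
  refine ⟨J, hJ, fun w => ?_⟩
  refine (denseRange_toExtrap R).induction_on
    (p := fun w => resolventExt R' (J w) = L (resolventExt R w)) w
    (isClosed_eq (by fun_prop) (by fun_prop)) fun x => ?_
  rw [hJ, resolventExt_toExtrap, resolventExt_toExtrap, h]

end Extrapolation

/-! ### The fundamental solution of the delay equation -/

section Kernel

variable {X : Type*} [NormedAddCommGroup X] [NormedSpace ℂ X]

theorem C0Semigroup.ext_sub_apply (S : C0Semigroup X) {a b c : ℝ} (hab : b ≤ a) (hbc : c ≤ b)
    (x : X) : S.ext (a - b) (S.ext (b - c) x) = S.ext (a - c) x := by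
  rw [S.ext_of_nonneg (by linarith), S.ext_of_nonneg (by linarith), S.ext_of_nonneg (by linarith),
    ← S.op_add_apply (by linarith) (by linarith)]
  congr 2; ring

/-- The `k`-th term `κᵏ (t - kτ)₊ᵏ / k! S((t - kτ)₊)` of the fundamental solution. -/
def delayTerm (S : C0Semigroup X) (κ τ : ℝ) (k : ℕ) (t : ℝ) : X →L[ℂ] X :=
  ((κ ^ k * max (t - k * τ) 0 ^ k / k.factorial : ℝ) : ℂ) • S.ext (t - k * τ)

/-- The fundamental solution of `y'(t) = A y(t) + κ y(t - τ)`, extended to negative times by the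
identity. -/
def delayKernel (S : C0Semigroup X) (κ τ : ℝ) (t : ℝ) : X →L[ℂ] X :=
  ∑ k ∈ Finset.range (⌈t / τ⌉₊ + 1), delayTerm S κ τ k t

/-- The fundamental solution, extended to negative times by zero. -/
def causalKernel (S : C0Semigroup X) (κ τ : ℝ) (t : ℝ) : X →L[ℂ] X :=
  (Ici (0 : ℝ)).indicator (delayKernel S κ τ) t

variable (S : C0Semigroup X) (κ : ℝ) {τ : ℝ}

theorem causalKernel_of_nonneg {t : ℝ} (ht : 0 ≤ t) :
    causalKernel S κ τ t = delayKernel S κ τ t := indicator_of_mem (mem_Ici.2 ht) _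

theorem causalKernel_of_neg {t : ℝ} (ht : t < 0) : causalKernel S κ τ t = 0 :=
  indicator_of_notMem (by simpa using ht) _

theorem continuous_delayTerm (k : ℕ) (x : X) : Continuous fun t => delayTerm S κ τ k t x := by
  have := (S.continuous_ext x).comp (f := fun t : ℝ => t - k * τ) (by fun_prop)
  simp only [Function.comp_def] at this
  simp only [delayTerm, smul_apply]
  fun_prop

/-- The index 0 is excluded because 0⁰ = 1: the term of index 0 is S extended by the identity to
negative times, which does not vanish. -/
theorem delayTerm_eq_zero {k : ℕ} (hk : k ≠ 0) {t : ℝ} (ht : t ≤ k * τ) :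
    delayTerm S κ τ k t = 0 := by
  rw [delayTerm, max_eq_right (by linarith), zero_pow hk]
  simp

/-- Terms of positive index k with kτ ≥ t vanish, so the upper limit depending on t may be replaced
by any larger one. A limit that is fixed near a given point yields continuity of the kernel. -/
theorem delayKernel_eq_sum (hτ : 0 < τ) {t : ℝ} {N : ℕ} (h : t ≤ N * τ) :
    delayKernel S κ τ t = ∑ k ∈ Finset.range (N + 1), delayTerm S κ τ k t := by
  have hN : ⌈t / τ⌉₊ ≤ N := Nat.ceil_le.2 ((div_le_iff₀ hτ).2 h)
  refine Finset.sum_subset (Finset.range_mono (by omega)) fun k _ hk => ?_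
  have hk' : ⌈t / τ⌉₊ < k := by simpa using hk
  have h1 : t ≤ ⌈t / τ⌉₊ * τ := (div_le_iff₀ hτ).1 (Nat.le_ceil _)
  refine delayTerm_eq_zero S κ (by omega) (h1.trans ?_)
  gcongr

theorem continuous_delayKernel (hτ : 0 < τ) (x : X) :
    Continuous fun t => delayKernel S κ τ t x := by
  rw [continuous_iff_continuousAt]
  intro t₀
  obtain ⟨N, hN⟩ := exists_nat_gt (t₀ / τ)
  rw [div_lt_iff₀ hτ] at hN
  have : Continuous fun t => ∑ k ∈ Finset.range (N + 1), delayTerm S κ τ k t x :=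
    continuous_finsetSum _ fun k _ => continuous_delayTerm S κ k x
  refine this.continuousAt.congr ?_
  filter_upwards [Iio_mem_nhds hN] with t ht
  rw [delayKernel_eq_sum S κ hτ (le_of_lt (mem_Iio.1 ht)), sum_apply]

/-- An indicator rather than a positive part keeps the case k = 0 correct, where the integrand jumps
at a; that single point is discarded as a null set. -/
theorem integral_indicator_Ici_pow (k : ℕ) {a t : ℝ} (ha : 0 ≤ a) (ht : 0 ≤ t) :
    ∫ r in (0 : ℝ)..t, (Ici a).indicator (fun r => (r - a) ^ k / k.factorial) r =
      max (t - a) 0 ^ (k + 1) / (k + 1).factorial := by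
  have hz : ∀ b, 0 ≤ b → b ≤ a →
      ∫ r in (0 : ℝ)..b, (Ici a).indicator (fun r => (r - a) ^ k / k.factorial) r = 0 := by
    intro b hb hba
    refine intervalIntegral.integral_zero_ae ?_
    have hne : ∀ᵐ s : ℝ, s ≠ a := by simp [ae_iff]
    filter_upwards [hne] with r hr hr'
    rw [uIoc_of_le hb] at hr'
    exact indicator_of_notMem (by
      rw [mem_Ici, not_le]
      exact lt_of_le_of_ne (hr'.2.trans hba) hr) _
  rcases le_total t a with h | h
  · rw [hz t ht h, max_eq_right (by linarith)]
    simp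
  · have hi : ∀ c d, IntervalIntegrable
        ((Ici a).indicator (fun r : ℝ => (r - a) ^ k / k.factorial)) volume c d := fun c d => by
      have : Continuous fun r : ℝ => (r - a) ^ k / k.factorial := by fun_prop
      rw [intervalIntegrable_iff]
      exact (intervalIntegrable_iff.1 (this.intervalIntegrable c d)).indicator measurableSet_Ici
    rw [← intervalIntegral.integral_add_adjacent_intervals (hi 0 a) (hi a t), hz a ha le_rfl,
      zero_add, max_eq_left (by linarith)]
    have : ∫ r in a..t, (Ici a).indicator (fun r => (r - a) ^ k / k.factorial) r =
        ∫ r in a..t, (r - a) ^ k / k.factorial :=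
      intervalIntegral.integral_congr fun r hr => by
        rw [uIcc_of_le h] at hr
        exact indicator_of_mem (mem_Ici.2 hr.1) _
    rw [this, intervalIntegral.integral_div,
      intervalIntegral.integral_comp_sub_right (fun r => r ^ k), integral_pow]
    rw [Nat.factorial_succ]
    push_cast
    field_simp
    simp

/-- By the semigroup law S(t-r) S(r-(k+1)τ) = S(t-(k+1)τ) does not depend on r, so only the scalar
integral of (r-(k+1)τ)₊ᵏ/k! is left. Thus one convolution with a delay moves each term of the series
to the next. -/
theorem integral_delayTerm [CompleteSpace X] (hτ : 0 < τ) (k : ℕ) (x : X) {t : ℝ} (ht : 0 ≤ t) :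
    (κ : ℂ) • ∫ r in (0 : ℝ)..t, S.ext (t - r)
      ((Ici (0 : ℝ)).indicator (fun a => delayTerm S κ τ k a x) (r - τ)) =
    delayTerm S κ τ (k + 1) t x := by
  have h1 : ∀ r ∈ uIcc 0 t, S.ext (t - r)
      ((Ici (0 : ℝ)).indicator (fun a => delayTerm S κ τ k a x) (r - τ)) =
      ((Ici ((k + 1) * τ)).indicator (fun r => (r - (k + 1) * τ) ^ k / k.factorial) r) •
        (((κ ^ k : ℝ) : ℂ) • S.ext (t - (k + 1) * τ) x) := by
    intro r hr
    rw [uIcc_of_le ht] at hr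
    by_cases hr1 : (k + 1) * τ ≤ r
    · have hkτ : 0 ≤ k * τ := by positivity
      rw [indicator_of_mem (mem_Ici.2 (by linarith)), indicator_of_mem (mem_Ici.2 hr1)]
      simp only [delayTerm, smul_apply, map_smul]
      have e : r - τ - k * τ = r - (k + 1) * τ := by ring
      rw [e, S.ext_sub_apply hr.2 hr1, max_eq_left (by linarith), ← Complex.coe_smul, smul_smul]
      congr 1
      push_cast
      ring
    · rw [indicator_of_notMem (s := Ici ((k + 1) * τ)) (by simpa using hr1), zero_smul]
      by_cases hr2 : (0 : ℝ) ≤ r - τ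
      · rw [indicator_of_mem (mem_Ici.2 hr2)]
        rcases Nat.eq_zero_or_pos k with rfl | hk
        · exfalso
          simp at hr1
          linarith
        · rw [delayTerm_eq_zero S κ hk.ne' (by linarith)]
          simp
      · rw [indicator_of_notMem (by simpa using hr2), map_zero]
  rw [intervalIntegral.integral_congr h1, intervalIntegral.integral_smul_const,
    integral_indicator_Ici_pow k (by positivity) ht, delayTerm]
  simp only [smul_apply]
  rw [← Complex.coe_smul, smul_smul, smul_smul]
  push_cast
  congr 1
  ring

/-- Extending the kernel by zero frees the range of integration from a, as exchanging the order of
integration requires. -/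
theorem integral_causalKernel_conv (g : ℝ → X) {a t : ℝ} (ha : a ≤ t) (ht : 0 ≤ t) :
    ∫ s in (0 : ℝ)..t, causalKernel S κ τ (a - s) (g s) =
      if a < 0 then 0 else ∫ s in (0 : ℝ)..a, delayKernel S κ τ (a - s) (g s) := by
  split_ifs with h
  · rw [← intervalIntegral.integral_zero (μ := volume) (a := 0) (b := t) (E := X)]
    refine intervalIntegral.integral_congr fun s hs => ?_
    rw [uIcc_of_le ht] at hs
    rw [causalKernel_of_neg S κ (by linarith [hs.1]), zero_apply]
  · rw [← intervalIntegral.integral_indicator (f := fun s => delayKernel S κ τ (a - s) (g s))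
      ⟨not_lt.1 h, ha⟩]
    refine intervalIntegral.integral_congr fun s hs => ?_
    by_cases hsa : s ≤ a
    · rw [causalKernel_of_nonneg S κ (by linarith), indicator_of_mem (by exact hsa)]
    · rw [causalKernel_of_neg S κ (by linarith), indicator_of_notMem (by exact hsa), zero_apply]

variable [CompleteSpace X]

theorem intervalIntegrable_ext_causal (hτ : 0 < τ) (x : X) (t c a b : ℝ) :
    IntervalIntegrable (fun r => S.ext (t - r) (causalKernel S κ τ (r - c) x)) volume a b := by
  refine intervalIntegrable_conv (K := S.ext) (fun x => S.continuous_ext x) ?_ t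
  have : (fun r => causalKernel S κ τ (r - c) x) =
      (Ici c).indicator fun r => delayKernel S κ τ (r - c) x := by
    ext r
    by_cases h : c ≤ r
    · rw [causalKernel_of_nonneg S κ (by linarith), indicator_of_mem (mem_Ici.2 h)]
    · rw [causalKernel_of_neg S κ (by linarith), indicator_of_notMem (by simpa using h)]; rfl
  rw [this, intervalIntegrable_iff]
  have hc : Continuous fun r => delayKernel S κ τ (r - c) x :=
    (continuous_delayKernel S κ hτ x).comp (by fun_prop)
  exact (intervalIntegrable_iff.1 (hc.intervalIntegrable a b)).indicator measurableSet_Ici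

/-- The integral equation of the fundamental solution. -/
theorem delayKernel_eq (hτ : 0 < τ) (x : X) {t : ℝ} (ht : 0 ≤ t) :
    delayKernel S κ τ t x = S.ext t x +
      (κ : ℂ) • ∫ r in (0 : ℝ)..t, S.ext (t - r) (causalKernel S κ τ (r - τ) x) := by
  obtain ⟨N, hN⟩ := exists_nat_gt (t / τ)
  rw [div_lt_iff₀ hτ] at hN
  have h1 : ∀ r ∈ uIcc 0 t, S.ext (t - r) (causalKernel S κ τ (r - τ) x) =
      ∑ k ∈ Finset.range N, S.ext (t - r)
        ((Ici (0 : ℝ)).indicator (fun a => delayTerm S κ τ k a x) (r - τ)) := by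
    intro r hr
    rw [uIcc_of_le ht] at hr
    rw [← map_sum]
    congr 1
    by_cases h : 0 ≤ r - τ
    · rw [causalKernel_of_nonneg S κ h]
      -- For r ≤ t < Nτ the delayed argument r - τ stays below (N-1)τ, so the indices k < N suffice
      -- inside the integral; shifted by one they become the indices 1 to N outside.
      obtain ⟨M, rfl⟩ : ∃ M, N = M + 1 := ⟨N - 1, by
        have : N ≠ 0 := by
          rintro rfl
          simp at hN
          linarith
        omega⟩
      push_cast at hN
      rw [delayKernel_eq_sum S κ hτ (N := M) (by linarith [hr.2]), sum_apply]
      refine Finset.sum_congr rfl fun k _ => ?_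
      rw [indicator_of_mem (mem_Ici.2 h)]
    · rw [causalKernel_of_neg S κ (not_le.1 h), zero_apply, Finset.sum_eq_zero]
      intro k _
      exact indicator_of_notMem (by simpa using h) _
  rw [intervalIntegral.integral_congr h1, intervalIntegral.integral_finsetSum, Finset.smul_sum]
  · simp_rw [integral_delayTerm S κ hτ _ x ht]
    rw [delayKernel_eq_sum S κ hτ hN.le, sum_apply, Finset.sum_range_succ',
      add_comm]
    congr 1
    simp [delayTerm]
  · intro k _
    refine intervalIntegrable_conv (K := S.ext) (fun x => S.continuous_ext x) ?_ t
    have : (fun r => (Ici (0 : ℝ)).indicator (fun a => delayTerm S κ τ k a x) (r - τ)) =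
        (Ici τ).indicator fun r => delayTerm S κ τ k (r - τ) x := by
      ext r
      simp [indicator]
    rw [this, intervalIntegrable_iff]
    have hc : Continuous fun r => delayTerm S κ τ k (r - τ) x :=
      (continuous_delayTerm S κ k x).comp (by fun_prop)
    exact (intervalIntegrable_iff.1 (hc.intervalIntegrable 0 t)).indicator measurableSet_Ici

/-- After the substitution r ↦ r + s, the extra range [-s, 0] contributes nothing because r - τ < 0
there. -/
theorem integral_ext_causal_shift (x : X) {s t : ℝ} (hs : 0 ≤ s) (hτ : 0 < τ) :
    ∫ r in (0 : ℝ)..t, S.ext (t - r) (causalKernel S κ τ (r - τ - s) x) =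
      ∫ r in (0 : ℝ)..(t - s), S.ext (t - s - r) (causalKernel S κ τ (r - τ) x) := by
  have h1 : ∀ r, S.ext (t - r) (causalKernel S κ τ (r - τ - s) x) =
      (fun r => S.ext (t - s - r) (causalKernel S κ τ (r - τ) x)) (r - s) := fun r => by
    dsimp only
    congr 2 <;> ring_nf
  simp_rw [h1]
  rw [intervalIntegral.integral_comp_sub_right
    (fun r => S.ext (t - s - r) (causalKernel S κ τ (r - τ) x)),
    ← intervalIntegral.integral_add_adjacent_intervals (b := 0)
      (intervalIntegrable_ext_causal S κ hτ x _ _ _ _)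
      (intervalIntegrable_ext_causal S κ hτ x _ _ _ _)]
  have h0 : ∫ r in (0 - s)..(0 : ℝ), S.ext (t - s - r) (causalKernel S κ τ (r - τ) x) = 0 := by
    rw [← intervalIntegral.integral_zero (μ := volume) (a := 0 - s) (b := 0) (E := X)]
    refine intervalIntegral.integral_congr fun r hr => ?_
    rw [uIcc_of_le (by linarith)] at hr
    rw [causalKernel_of_neg S κ (by linarith [hr.2]), zero_apply, map_zero]
  rw [h0, zero_add]

theorem aestronglyMeasurable_causal (hτ : 0 < τ) {α : Type*} [MeasurableSpace α] {μ : Measure α}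
    {a : α → ℝ} {g : α → X} (ha : Measurable a) (hg : AEStronglyMeasurable g μ) :
    AEStronglyMeasurable (fun p => causalKernel S κ τ (a p) (g p)) μ := by
  have h : (fun p => causalKernel S κ τ (a p) (g p)) =
      (a ⁻¹' Ici 0).indicator fun p => delayKernel S κ τ (a p) (g p) := by
    ext p
    by_cases h : 0 ≤ a p
    · rw [causalKernel_of_nonneg S κ h, indicator_of_mem (mem_preimage.2 (mem_Ici.2 h))]
    · rw [causalKernel_of_neg S κ (not_le.1 h), indicator_of_notMem (by simpa using h)]; rfl
  rw [h]
  exact (aestronglyMeasurable_apply_of_stronglyContinuous (continuous_delayKernel S κ hτ)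
    ha.aestronglyMeasurable hg).indicator (ha measurableSet_Ici)

theorem exists_norm_causalKernel_le (hτ : 0 < τ) (T : ℝ) :
    ∃ M : ℝ, 0 ≤ M ∧ ∀ t ≤ T, ‖causalKernel S κ τ t‖ ≤ M := by
  obtain ⟨M, hM0, hM⟩ := exists_norm_le_of_stronglyContinuous (continuous_delayKernel S κ hτ) 0 T
  refine ⟨M, hM0, fun t ht => ?_⟩
  by_cases h : 0 ≤ t
  · rw [causalKernel_of_nonneg S κ h]
    exact hM t ⟨h, ht⟩
  · rw [causalKernel_of_neg S κ (not_le.1 h), norm_zero]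
    exact hM0

/-- Variation of constants with the fundamental solution. -/
theorem delayKernel_conv_eq (hτ : 0 < τ) (x : X) {g : ℝ → X} {t : ℝ} (ht : 0 ≤ t)
    (hg : IntervalIntegrable g volume 0 t) (w : ℝ → X)
    (hw : ∀ a, w a = if a < 0 then 0 else
      delayKernel S κ τ a x + ∫ s in (0 : ℝ)..a, delayKernel S κ τ (a - s) (g s)) :
    IntervalIntegrable (fun s => S.ext (t - s) (w (s - τ))) volume 0 t ∧
    w t = S.ext t x + (κ : ℂ) • (∫ s in (0 : ℝ)..t, S.ext (t - s) (w (s - τ))) +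
      ∫ s in (0 : ℝ)..t, S.ext (t - s) (g s) := by
  obtain ⟨M, hM0, hM⟩ := exists_norm_le_of_stronglyContinuous (K := S.ext)
    (fun x => S.continuous_ext x) 0 t
  obtain ⟨N, hN0, hN⟩ := exists_norm_causalKernel_le S κ hτ t
  have : IsFiniteMeasure (volume.restrict (uIoc 0 t)) := by
    rw [uIoc_of_le ht]; infer_instance
  -- Inserting the formula for w into its own delayed term gives a double integral of F. After
  -- exchanging the order, the integral over r is evaluated by the equation of the fundamental
  -- solution. Here w is zero at negative times; a nonzero history is later put into g.
  set F : ℝ → ℝ → X := fun r s => S.ext (t - r) (causalKernel S κ τ (r - τ - s) (g s)) with hF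
  have hg' : Integrable g (volume.restrict (uIoc 0 t)) := intervalIntegrable_iff.1 hg
  have hFi : Integrable F.uncurry ((volume.restrict (uIoc 0 t)).prod
      (volume.restrict (uIoc 0 t))) := by
    refine Integrable.mono' ((hg'.norm.comp_snd (volume.restrict (uIoc 0 t))).const_mul (M * N))
      ?_ ?_
    · refine aestronglyMeasurable_apply_of_stronglyContinuous (K := S.ext)
        (a := fun p : ℝ × ℝ => t - p.1) (fun x => S.continuous_ext x) (by fun_prop) ?_
      exact aestronglyMeasurable_causal S κ hτ (a := fun p : ℝ × ℝ => p.1 - τ - p.2)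
        (by fun_prop) hg'.aestronglyMeasurable.comp_snd
    · rw [Measure.prod_restrict]
      filter_upwards [ae_restrict_mem (measurableSet_uIoc.prod measurableSet_uIoc)] with p hp
      rw [uIoc_of_le ht] at hp
      have h1 := hp.1.1
      have h2 := hp.1.2
      have h3 := hp.2.1
      calc ‖S.ext (t - p.1) (causalKernel S κ τ (p.1 - τ - p.2) (g p.2))‖
          ≤ M * ‖causalKernel S κ τ (p.1 - τ - p.2) (g p.2)‖ :=
            (S.ext _).le_of_opNorm_le (hM _ ⟨by linarith, by linarith⟩) _
        _ ≤ M * (N * ‖g p.2‖) := by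
            gcongr
            exact (causalKernel S κ τ _).le_of_opNorm_le (hN _ (by linarith)) _
        _ = M * N * ‖g p.2‖ := by ring
  have hin : ∀ r ∈ uIoc 0 t, IntervalIntegrable
      (fun s => causalKernel S κ τ (r - τ - s) (g s)) volume 0 t := by
    intro r hr
    rw [uIoc_of_le ht] at hr
    rw [intervalIntegrable_iff]
    refine Integrable.mono' (hg'.norm.const_mul N)
      (aestronglyMeasurable_causal S κ hτ (by fun_prop) hg'.aestronglyMeasurable) ?_
    filter_upwards [ae_restrict_mem measurableSet_uIoc] with s hs
    rw [uIoc_of_le ht] at hs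
    exact (causalKernel S κ τ _).le_of_opNorm_le (hN _ (by linarith [hr.2, hs.1])) _
  have hwr : ∀ r ∈ uIoc 0 t, S.ext (t - r) (w (r - τ)) =
      S.ext (t - r) (causalKernel S κ τ (r - τ) x) + ∫ s in (0 : ℝ)..t, F r s := by
    intro r hr
    have hr' := hr
    rw [uIoc_of_le ht] at hr'
    rw [hF, (S.ext (t - r)).intervalIntegral_comp_comm (hin r hr), ← map_add]
    congr 1
    rw [hw, integral_causalKernel_conv S κ g (by linarith [hr'.2]) ht]
    split_ifs with h
    · rw [causalKernel_of_neg S κ h, zero_apply, add_zero]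
    · rw [causalKernel_of_nonneg S κ (not_lt.1 h)]
  have hFr : IntervalIntegrable (fun r => ∫ s in (0 : ℝ)..t, F r s) volume 0 t := by
    rw [intervalIntegrable_iff]
    refine hFi.integral_prod_left.congr (Eventually.of_forall fun r => ?_)
    simp only [uIoc_of_le ht, intervalIntegral.integral_of_le ht, Function.uncurry]
  have hKi := intervalIntegrable_ext_causal S κ hτ x t τ 0 t
  refine ⟨(hKi.add hFr).congr fun r hr => (hwr r hr).symm, ?_⟩
  have hint : ∫ s in (0 : ℝ)..t, S.ext (t - s) (w (s - τ)) =
      (∫ r in (0 : ℝ)..t, S.ext (t - r) (causalKernel S κ τ (r - τ) x)) +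
        ∫ s in (0 : ℝ)..t, ∫ r in (0 : ℝ)..t, F r s := by
    rw [intervalIntegral.integral_congr_ae (Eventually.of_forall hwr),
      intervalIntegral.integral_add hKi hFr]
    congr 1
    refine intervalIntegral_intervalIntegral_swap ?_
    rw [IntegrableOn, Measure.volume_eq_prod, ← Measure.prod_restrict]
    exact hFi
  have hinner : ∀ s ∈ uIcc 0 t, (κ : ℂ) • (∫ r in (0 : ℝ)..t, F r s) =
      delayKernel S κ τ (t - s) (g s) - S.ext (t - s) (g s) := by
    intro s hs
    rw [uIcc_of_le ht] at hs
    rw [hF, integral_ext_causal_shift S κ (g s) hs.1 hτ,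
      delayKernel_eq S κ hτ (g s) (by linarith [hs.2] : 0 ≤ t - s)]
    abel
  rw [hint, smul_add, ← intervalIntegral.integral_smul (κ : ℂ) (fun s => ∫ r in (0 : ℝ)..t, F r s),
    intervalIntegral.integral_congr hinner,
    intervalIntegral.integral_sub (intervalIntegrable_conv (continuous_delayKernel S κ hτ) hg t)
      (intervalIntegrable_conv (K := S.ext) (fun x => S.continuous_ext x) hg t), hw,
    if_neg (not_lt.2 ht), delayKernel_eq S κ hτ x ht]
  abel

end Kernel

/-! ### Histories: null sets and integrability under translation -/

theorem ae_comp_add_right {p : ℝ → Prop} (h : ∀ᵐ r, p r) (c : ℝ) : ∀ᵐ s, p (s + c) :=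
  (measurePreserving_add_right volume c).quasiMeasurePreserving.ae h

theorem ae_hist_iff {τ : ℝ} {p : ℝ → Prop} :
    (∀ᵐ θ ∂(histMeasure τ), p θ) ↔ ∀ᵐ θ, θ ∈ Ioo (-τ) 0 → p θ :=
  ae_restrict_iff' measurableSet_Ioo

section HistoryIntegrability

variable {X : Type*} [NormedAddCommGroup X] {τ : ℝ}

theorem intervalIntegrable_of_hist {z : ℝ → X} (hz : ContinuousOn z (Ici 0))
    (hφ : Integrable z (histMeasure τ)) {a b : ℝ} (ha : -τ ≤ a) (hb : -τ ≤ b) :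
    IntervalIntegrable z volume a b := by
  set c := max (max a b) 0
  have h1 : IntervalIntegrable z volume (-τ) 0 := by
    rw [intervalIntegrable_iff]
    rcases le_total (-τ) 0 with h | h
    · rw [uIoc_of_le h, integrableOn_Ioc_iff_integrableOn_Ioo]
      exact hφ
    · rw [uIoc_of_ge h]
      refine ((hz.mono ?_).integrableOn_Icc (μ := volume)).mono_set Ioc_subset_Icc_self
      exact fun s hs => hs.1
  have h2 : IntervalIntegrable z volume 0 c :=
    (hz.mono (by rw [uIcc_of_le (le_max_right _ _)]; exact fun s hs => hs.1)).intervalIntegrable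
  refine (h1.trans h2).mono_set ?_
  rw [uIcc_of_le (show -τ ≤ c from ha.trans ((le_max_left _ _).trans (le_max_left _ _)))]
  exact (convex_Icc (-τ) c).ordConnected.uIcc_subset
    ⟨ha, (le_max_left _ _).trans (le_max_left _ _)⟩
    ⟨hb, (le_max_right _ _).trans (le_max_left _ _)⟩

theorem intervalIntegrable_delayed {z : ℝ → X} (hz : ContinuousOn z (Ici 0))
    (hφ : Integrable z (histMeasure τ)) {a b : ℝ} (ha : 0 ≤ a) (hb : 0 ≤ b) :
    IntervalIntegrable (fun s => z (s - τ)) volume a b := by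
  have := (intervalIntegrable_of_hist hz hφ (a := a - τ) (b := b - τ)
    (by linarith) (by linarith)).comp_sub_right τ
  simpa using this

theorem integrable_indicator_delayed {φ : ℝ → X} (hφ : Integrable φ (histMeasure τ)) :
    Integrable fun s => (Ioo (-τ) 0).indicator φ (s - τ) :=
  ((integrable_indicator_iff measurableSet_Ioo).2 hφ).comp_sub_right τ

end HistoryIntegrability

/-! ### Mild solutions of the forced delay equation -/

section Forced

variable {X : Type*} [NormedAddCommGroup X] [NormedSpace ℂ X]

/-- `z` solves `z'(t) = A z(t) + κ z(t - τ) + f(t)`, `z(0) = x`, `z = φ` on `(-τ, 0)`, in the mild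
sense. -/
structure IsForcedSolution (S : C0Semigroup X) (κ τ : ℝ) (x : X) (φ f z : ℝ → X) : Prop where
  history : z =ᵐ[histMeasure τ] φ
  continuousOn : ContinuousOn z (Ici 0)
  duhamel : ∀ t : ℝ, 0 ≤ t →
    z t = S.ext t x + ∫ s in (0 : ℝ)..t, S.ext (t - s) ((κ : ℂ) • z (s - τ) + f s)

variable {S : C0Semigroup X} {κ τ : ℝ}

namespace IsForcedSolution

variable {x x' : X} {φ φ' f f' z z' : ℝ → X}

theorem initial (hz : IsForcedSolution S κ τ x φ f z) : z 0 = x := by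
  have := hz.duhamel 0 le_rfl
  rwa [intervalIntegral.integral_same, add_zero, S.ext_of_nonneg le_rfl, S.op_zero_apply] at this

theorem integrable_hist (hz : IsForcedSolution S κ τ x φ f z)
    (hφ : Integrable φ (histMeasure τ)) : Integrable z (histMeasure τ) :=
  hφ.congr hz.history.symm

theorem congr_hist (hz : IsForcedSolution S κ τ x φ f z) (h : φ =ᵐ[histMeasure τ] φ') :
    IsForcedSolution S κ τ x φ' f z :=
  ⟨hz.history.trans h, hz.continuousOn, hz.duhamel⟩

/-- Method of steps: up to time (n+1)τ the delayed term only sees times up to nτ, where the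
solutions already agree, or the common history. The history is known only almost everywhere, which
is enough under the integral. -/
theorem unique (hτ : 0 < τ) (hz : IsForcedSolution S κ τ x φ f z)
    (hz' : IsForcedSolution S κ τ x φ f z') {t : ℝ} (ht : 0 ≤ t) : z t = z' t := by
  have hh : ∀ᵐ s : ℝ, s + -τ ∈ Ioo (-τ) 0 → z (s + -τ) = z' (s + -τ) :=
    ae_comp_add_right (p := fun s => s ∈ Ioo (-τ) 0 → z s = z' s)
      (ae_hist_iff.1 (hz.history.trans hz'.history.symm)) (-τ)
  have key : ∀ n : ℕ, ∀ t, 0 ≤ t → t ≤ n * τ → z t = z' t := by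
    intro n
    induction n with
    | zero =>
      intro t ht0 ht1
      have : t = 0 := le_antisymm (by simpa using ht1) ht0
      rw [this, hz.initial, hz'.initial]
    | succ n ih =>
      intro t ht0 ht1
      rw [hz.duhamel t ht0, hz'.duhamel t ht0]
      congr 1
      refine intervalIntegral.integral_congr_ae ?_
      filter_upwards [hh] with s hs hst
      rw [uIoc_of_le ht0] at hst
      push_cast at ht1
      have : z (s - τ) = z' (s - τ) := by
        by_cases h : s - τ < 0
        · exact hs ⟨by linarith [hst.1], h⟩
        · exact ih _ (not_lt.1 h) (by linarith [hst.2])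
      rw [this]
  obtain ⟨n, hn⟩ := exists_nat_gt (t / τ)
  exact key n t ht ((div_lt_iff₀ hτ).1 hn).le

variable [CompleteSpace X]

theorem intervalIntegrable (hz : IsForcedSolution S κ τ x φ f z)
    (hφ : Integrable φ (histMeasure τ)) (hf : ∀ t, 0 ≤ t → IntervalIntegrable f volume 0 t)
    {a b : ℝ} (ha : 0 ≤ a) (hb : 0 ≤ b) (t : ℝ) :
    IntervalIntegrable (fun s => S.ext (t - s) ((κ : ℂ) • z (s - τ) + f s)) volume a b :=
  intervalIntegrable_conv (K := S.ext) (fun x => S.continuous_ext x)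
    (((intervalIntegrable_delayed hz.continuousOn (hz.integrable_hist hφ) ha hb).smul
      (κ : ℂ)).add ((hf a ha).symm.trans (hf b hb))) t

theorem add (hz : IsForcedSolution S κ τ x φ f z) (hz' : IsForcedSolution S κ τ x' φ' f' z')
    (hφ : Integrable φ (histMeasure τ)) (hφ' : Integrable φ' (histMeasure τ))
    (hf : ∀ t, 0 ≤ t → IntervalIntegrable f volume 0 t)
    (hf' : ∀ t, 0 ≤ t → IntervalIntegrable f' volume 0 t) :
    IsForcedSolution S κ τ (x + x') (φ + φ') (f + f') (z + z') := by
  refine ⟨hz.history.add hz'.history, hz.continuousOn.add hz'.continuousOn, fun t ht => ?_⟩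
  rw [Pi.add_apply, hz.duhamel t ht, hz'.duhamel t ht, map_add, add_add_add_comm,
    ← intervalIntegral.integral_add (hz.intervalIntegrable hφ hf le_rfl ht t)
      (hz'.intervalIntegrable hφ' hf' le_rfl ht t)]
  simp only [← map_add, Pi.add_apply, smul_add]
  congr 3
  ext s
  congr 1
  abel

/-- Needed for two operators commuting with S: a scalar multiple of the identity, for homogeneity of
the solution map, and R₀, for commutation with the delay semigroup. -/
theorem map (hz : IsForcedSolution S κ τ x φ f z) (hφ : Integrable φ (histMeasure τ))
    (hf : ∀ t, 0 ≤ t → IntervalIntegrable f volume 0 t) (C : X →L[ℂ] X)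
    (hC : ∀ t, 0 ≤ t → ∀ x, C (S.op t x) = S.op t (C x)) :
    IsForcedSolution S κ τ (C x) (fun s => C (φ s)) (fun s => C (f s)) (fun s => C (z s)) := by
  refine ⟨hz.history.fun_comp C, C.continuous.comp_continuousOn hz.continuousOn,
    fun t ht => ?_⟩
  rw [hz.duhamel t ht, map_add, ← C.intervalIntegral_comp_comm
    (hz.intervalIntegrable hφ hf le_rfl ht t)]
  simp only [C0Semigroup.ext, hC _ (le_max_right _ _), map_add, map_smul]

/-- Cut the Duhamel integral at t: by the semigroup law the part up to t, together with the initial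
term, is S(s) z(t), and the rest is the Duhamel integral of the translated problem. The semigroup
law of the delay equation rests on this. -/
theorem shift (hz : IsForcedSolution S κ τ x φ f z) (hφ : Integrable φ (histMeasure τ))
    (hf : ∀ t, 0 ≤ t → IntervalIntegrable f volume 0 t) {t : ℝ} (ht : 0 ≤ t) :
    IsForcedSolution S κ τ (z t) (fun s => z (t + s)) (fun s => f (t + s))
      (fun s => z (t + s)) := by
  refine ⟨EventuallyEq.rfl, hz.continuousOn.comp (by fun_prop) fun s hs => ?_, fun s hs => ?_⟩
  · exact add_nonneg ht hs
  · rw [hz.duhamel (t + s) (add_nonneg ht hs), hz.duhamel t ht, map_add,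
      ← intervalIntegral.integral_add_adjacent_intervals
        (hz.intervalIntegrable hφ hf le_rfl ht (t + s))
        (hz.intervalIntegrable hφ hf ht (add_nonneg ht hs) (t + s)),
      ← (S.ext s).intervalIntegral_comp_comm (hz.intervalIntegrable hφ hf le_rfl ht t),
      ← add_assoc]
    refine congrArg₂ (· + ·) (congrArg₂ (· + ·) ?_ ?_) ?_
    · rw [S.ext_of_nonneg (add_nonneg ht hs), S.ext_of_nonneg hs, S.ext_of_nonneg ht, add_comm t s,
        S.op_add_apply hs ht]
    · refine intervalIntegral.integral_congr fun r hr => ?_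
      rw [uIcc_of_le ht] at hr
      have := S.ext_sub_apply (a := t + s) (b := t) (c := r) (by linarith) hr.2
        ((κ : ℂ) • z (r - τ) + f r)
      rw [add_sub_cancel_left] at this
      exact this.symm
    · have := intervalIntegral.integral_comp_add_left (a := 0) (b := s)
        (fun r => S.ext (t + s - r) ((κ : ℂ) • z (r - τ) + f r)) t
      rw [add_zero] at this
      rw [← this]
      refine intervalIntegral.integral_congr fun r _ => ?_
      rw [add_sub_add_left_eq_sub, add_sub_assoc]

end IsForcedSolution

variable (S κ τ) in
/-- The solution of the forced delay equation. -/
def forcedFlow (x : X) (φ f : ℝ → X) (t : ℝ) : X :=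
  if t < 0 then φ t else delayKernel S κ τ t x + ∫ s in (0 : ℝ)..t,
    delayKernel S κ τ (t - s) ((κ : ℂ) • (Ioo (-τ) 0).indicator φ (s - τ) + f s)

theorem forcedFlow_of_nonneg (x : X) (φ f : ℝ → X) {t : ℝ} (ht : 0 ≤ t) :
    forcedFlow S κ τ x φ f t = delayKernel S κ τ t x + ∫ s in (0 : ℝ)..t,
      delayKernel S κ τ (t - s) ((κ : ℂ) • (Ioo (-τ) 0).indicator φ (s - τ) + f s) :=
  if_neg (not_lt.2 ht)

theorem forcedFlow_of_neg (x : X) (φ f : ℝ → X) {t : ℝ} (ht : t < 0) :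
    forcedFlow S κ τ x φ f t = φ t := if_pos ht

/-- The history acts only through κ φ(s - τ) for s < τ. Counted as an additional forcing, it reduces
the problem to one with zero history, solved by `delayKernel_conv_eq`. -/
theorem forcedFlow_isForcedSolution [CompleteSpace X] (hτ : 0 < τ) (x : X) {φ f : ℝ → X}
    (hφ : Integrable φ (histMeasure τ)) (hf : ∀ t, 0 ≤ t → IntervalIntegrable f volume 0 t) :
    IsForcedSolution S κ τ x φ f (forcedFlow S κ τ x φ f) := by
  set g : ℝ → X := fun s => (κ : ℂ) • (Ioo (-τ) 0).indicator φ (s - τ) + f s with hgdef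
  have hφi : ∀ t, IntervalIntegrable (fun s => (κ : ℂ) • (Ioo (-τ) 0).indicator φ (s - τ))
    volume 0 t := fun t =>
      ((integrable_indicator_delayed hφ).smul (κ : ℂ)).intervalIntegrable
  have hg : ∀ t, 0 ≤ t → IntervalIntegrable g volume 0 t := fun t ht => (hφi t).add (hf t ht)
  have hK := continuous_delayKernel S κ hτ
  refine ⟨?_, ?_, fun t ht => ?_⟩
  · filter_upwards [ae_restrict_mem measurableSet_Ioo] with θ hθ
    exact forcedFlow_of_neg _ _ _ hθ.2
  · refine ((hK x).continuousOn.add (continuousOn_conv hK hg)).congr fun t ht => ?_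
    exact forcedFlow_of_nonneg _ _ _ ht
  · set w : ℝ → X := fun a => if a < 0 then 0 else
      delayKernel S κ τ a x + ∫ s in (0 : ℝ)..a, delayKernel S κ τ (a - s) (g s) with hw
    obtain ⟨hi, he⟩ := delayKernel_conv_eq S κ hτ x ht (hg t ht) w fun _ => rfl
    have hwt : forcedFlow S κ τ x φ f t = w t := by
      rw [forcedFlow_of_nonneg _ _ _ ht, hw]
      exact (if_neg (not_lt.2 ht)).symm
    rw [hwt, he, add_assoc]
    congr 1
    have hi' := hi.smul (κ : ℂ)
    simp only [Pi.smul_def] at hi'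
    rw [← intervalIntegral.integral_smul, ← intervalIntegral.integral_add hi'
      (intervalIntegrable_conv (K := S.ext) (fun x => S.continuous_ext x) (hg t ht) t)]
    refine intervalIntegral.integral_congr_ae (Eventually.of_forall fun s hs => ?_)
    rw [uIoc_of_le ht] at hs
    rw [← map_smul, ← map_add, hgdef]
    congr 1
    dsimp only
    rw [← add_assoc, ← smul_add]
    congr 2
    by_cases h : s - τ < 0
    · rw [forcedFlow_of_neg _ _ _ h, indicator_of_mem (show s - τ ∈ Ioo (-τ) 0 from ⟨by linarith [hs.1], h⟩), hw]
      dsimp only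
      rw [if_pos h, zero_add]
    · rw [forcedFlow_of_nonneg _ _ _ (not_lt.1 h), indicator_of_notMem (fun hh => h hh.2), hw]
      dsimp only
      rw [if_neg h, add_zero]

/-- The history enters as a forcing, so its L¹ norm controls the solution; with a bound on the
history segment this makes the solution operators bounded. -/
theorem exists_norm_forcedFlow_le [CompleteSpace X] (hτ : 0 < τ) (T : ℝ) :
    ∃ M : ℝ, 0 ≤ M ∧ ∀ (x : X) (φ : ℝ → X), Integrable φ (histMeasure τ) → ∀ t ∈ Icc 0 T,
      ‖forcedFlow S κ τ x φ 0 t‖ ≤ M * (‖x‖ + ∫ θ, ‖φ θ‖ ∂(histMeasure τ)) := by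
  obtain ⟨M, hM0, hM⟩ := exists_norm_le_of_stronglyContinuous (continuous_delayKernel S κ hτ) 0 T
  refine ⟨M * (1 + |κ|), by positivity, fun x φ hφ t ht => ?_⟩
  have hi := integrable_indicator_delayed hφ
  have h1 : ∫ s in (0 : ℝ)..t, ‖(κ : ℂ) • (Ioo (-τ) 0).indicator φ (s - τ) + (0 : ℝ → X) s‖ ≤
      |κ| * ∫ θ, ‖φ θ‖ ∂(histMeasure τ) := by
    simp only [Pi.zero_apply, add_zero, norm_smul, Complex.norm_real, Real.norm_eq_abs]
    rw [intervalIntegral.integral_const_mul, intervalIntegral.integral_of_le ht.1]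
    gcongr
    calc ∫ s in Ioc 0 t, ‖(Ioo (-τ) 0).indicator φ (s - τ)‖
        ≤ ∫ s, ‖(Ioo (-τ) 0).indicator φ (s - τ)‖ :=
          setIntegral_le_integral hi.norm (Eventually.of_forall fun _ => norm_nonneg _)
      _ = ∫ s, ‖(Ioo (-τ) 0).indicator φ s‖ :=
          integral_sub_right_eq_self (fun s => ‖(Ioo (-τ) 0).indicator φ s‖) τ
      _ = ∫ θ, ‖φ θ‖ ∂(histMeasure τ) := by
          simp_rw [norm_indicator_eq_indicator_norm]
          exact integral_indicator measurableSet_Ioo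
  have h2 : IntervalIntegrable
      (fun s => (κ : ℂ) • (Ioo (-τ) 0).indicator φ (s - τ) + (0 : ℝ → X) s) volume 0 t := by
    simp only [Pi.zero_apply, add_zero]
    exact (hi.smul (κ : ℂ)).intervalIntegrable
  have h3 : (0 : ℝ) ≤ ∫ θ, ‖φ θ‖ ∂(histMeasure τ) := integral_nonneg fun _ => norm_nonneg _
  rw [forcedFlow_of_nonneg _ _ _ ht.1]
  calc _ ≤ ‖delayKernel S κ τ t x‖ + _ := norm_add_le _ _
    _ ≤ M * ‖x‖ + M * (|κ| * ∫ θ, ‖φ θ‖ ∂(histMeasure τ)) := by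
        gcongr
        · exact (delayKernel S κ τ t).le_of_opNorm_le (hM t ht) x
        · refine (norm_conv_le ht.1 (fun r hr => hM r ⟨hr.1, hr.2.trans ht.2⟩) h2).trans ?_
          gcongr
    _ ≤ _ := by
        have : 0 ≤ M * (|κ| * ‖x‖ + ∫ θ, ‖φ θ‖ ∂(histMeasure τ)) := by positivity
        linarith

end Forced

theorem ae_shift_of_hist {τ : ℝ} {Y : Type*} {z z' : ℝ → Y} (h : z =ᵐ[histMeasure τ] z')
    (h' : ∀ t, 0 ≤ t → z t = z' t) {t : ℝ} (ht : 0 ≤ t) :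
    ∀ᵐ θ ∂(histMeasure τ), z (t + θ) = z' (t + θ) := by
  rw [ae_hist_iff]
  filter_upwards [ae_comp_add_right (ae_hist_iff.1 h) t] with θ hθ hθ'
  rw [add_comm]
  by_cases hn : θ + t < 0
  · exact hθ ⟨by linarith [hθ'.1], hn⟩
  · exact h' _ (not_lt.1 hn)

/-! ### Truncation to square integrable functions on the line -/

section Truncation

variable {X : Type*} [NormedAddCommGroup X] {τ : ℝ}

/-- Truncation of a function on `(-τ, ∞)` to `(-τ, T]`. -/
def truncHist (τ : ℝ) (z : ℝ → X) (T : ℝ) : ℝ → X :=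
  (Ioo (-τ) 0).indicator z + (Icc 0 T).indicator z

theorem truncHist_eq {z : ℝ → X} {T r : ℝ} (h1 : -τ < r) (h2 : r ≤ T) :
    truncHist τ z T r = z r := by
  rw [truncHist, Pi.add_apply]
  by_cases h : r < 0
  · rw [indicator_of_mem (show r ∈ Ioo (-τ) 0 from ⟨h1, h⟩), indicator_of_notMem, add_zero]
    exact fun hh => not_le.2 h hh.1
  · rw [indicator_of_notMem (fun hh => h hh.2),
      indicator_of_mem (show r ∈ Icc 0 T from ⟨not_lt.1 h, h2⟩), zero_add]

/-- A solution need not be square integrable on (-τ, ∞); its truncation is, and so translation in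
L²(ℝ) can be applied to it. -/
theorem memLp_truncHist {z : ℝ → X} (hz : ContinuousOn z (Ici 0))
    (hφ : MemLp z 2 (histMeasure τ)) (T : ℝ) : MemLp (truncHist τ z T) 2 volume := by
  refine ((memLp_indicator_iff_restrict measurableSet_Ioo).2 hφ).add
    ((memLp_indicator_iff_restrict measurableSet_Icc).2 ?_)
  have hc : ContinuousOn z (Icc 0 T) := hz.mono fun s hs => hs.1
  obtain ⟨M, hM⟩ := isCompact_Icc.exists_bound_of_continuousOn hc
  refine MemLp.of_bound (hc.aestronglyMeasurable measurableSet_Icc) M ?_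
  filter_upwards [ae_restrict_mem measurableSet_Icc] with s hs using hM s hs

theorem memLp_shift {z : ℝ → X} (hz : ContinuousOn z (Ici 0))
    (hφ : MemLp z 2 (histMeasure τ)) {t : ℝ} (ht : 0 ≤ t) :
    MemLp (fun θ => z (t + θ)) 2 (histMeasure τ) := by
  have h := ((memLp_truncHist hz hφ t).comp_measurePreserving
    (measurePreserving_add_left volume t)).restrict (Ioo (-τ) 0)
  refine h.ae_eq ?_
  filter_upwards [ae_restrict_mem measurableSet_Ioo] with θ hθ
  exact truncHist_eq (by linarith [hθ.1]) (by linarith [hθ.2])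

end Truncation

/-! ### History segments as elements of L²(-τ, 0; X) -/

section HistorySegment

variable {X : Type*} [NormedAddCommGroup X] [InnerProductSpace ℂ X] {τ : ℝ}

theorem Hist.integrable (f : Hist X τ) : Integrable f (histMeasure τ) :=
  (Lp.memLp f).integrable (by norm_num)

/-- Hölder's inequality on an interval of finite length. -/
theorem exists_integral_norm_hist_le (X : Type*) [NormedAddCommGroup X] [InnerProductSpace ℂ X]
    (τ : ℝ) : ∃ C : ℝ, 0 ≤ C ∧ ∀ f : Hist X τ, ∫ θ, ‖f θ‖ ∂(histMeasure τ) ≤ C * ‖f‖ := by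
  refine ⟨((histMeasure τ) univ ^ (1 / (1 : ℝ≥0∞).toReal - 1 / (2 : ℝ≥0∞).toReal)).toReal,
    ENNReal.toReal_nonneg, fun f => ?_⟩
  have h := eLpNorm_le_eLpNorm_mul_rpow_measure_univ (μ := histMeasure τ) (f := f)
    (show (1 : ℝ≥0∞) ≤ 2 by norm_num) (Lp.memLp f).1
  rw [eLpNorm_one_eq_lintegral_enorm] at h
  rw [integral_norm_eq_lintegral_enorm (Lp.memLp f).1, Lp.norm_def, mul_comm, ← ENNReal.toReal_mul]
  refine ENNReal.toReal_mono (ENNReal.mul_ne_top (Lp.memLp f).2.ne ?_) h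
  exact ENNReal.rpow_ne_top_of_nonneg (by norm_num) (measure_ne_top _ _)

/-- Integration over a set, as a bounded operator on the history space. -/
def histIntegral (X : Type*) [NormedAddCommGroup X] [InnerProductSpace ℂ X] (τ : ℝ) (s : Set ℝ) :
    Hist X τ →L[ℂ] X :=
  LinearMap.mkContinuousOfExistsBound
    { toFun := fun f => ∫ θ in s, f θ ∂(histMeasure τ)
      map_add' := fun f g => by
        rw [← integral_add f.integrable.integrableOn g.integrable.integrableOn]
        exact integral_congr_ae (ae_restrict_of_ae (Lp.coeFn_add f g))
      map_smul' := fun c f => by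
        rw [RingHom.id_apply, ← integral_smul]
        exact integral_congr_ae (ae_restrict_of_ae (Lp.coeFn_smul c f)) } (by
    obtain ⟨C, _, hC⟩ := exists_integral_norm_hist_le X τ
    refine ⟨C, fun f => (norm_integral_le_integral_norm _).trans (le_trans ?_ (hC f))⟩
    exact setIntegral_le_integral f.integrable.norm (Eventually.of_forall fun _ => norm_nonneg _))

theorem histIntegral_apply (s : Set ℝ) (f : Hist X τ) :
    histIntegral X τ s f = ∫ θ in s, f θ ∂(histMeasure τ) := rfl

/-- The history `θ ↦ z(t + θ)` as an element of `L²(-τ,0;X)`. -/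
def histSeg (τ : ℝ) (z : ℝ → X) (t : ℝ) : Hist X τ :=
  -- The default 0 makes the segment total; by `memLp_shift` it does not occur for t ≥ 0 when z is
  -- continuous on [0, ∞) with square integrable history.
  open Classical in
  if h : MemLp (fun θ => z (t + θ)) 2 (histMeasure τ) then h.toLp _ else 0

theorem coeFn_histSeg {z : ℝ → X} {t : ℝ}
    (h : MemLp (fun θ => z (t + θ)) 2 (histMeasure τ)) :
    histSeg τ z t =ᵐ[histMeasure τ] fun θ => z (t + θ) := by
  rw [histSeg, dif_pos h]
  exact h.coeFn_toLp

theorem histSeg_shift (z : ℝ → X) (s t : ℝ) :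
    histSeg τ (fun r => z (t + r)) s = histSeg τ z (s + t) := by
  have e : ∀ θ, t + (s + θ) = s + t + θ := fun θ => by ring
  have e' : (fun θ => z (t + (s + θ))) = fun θ => z (s + t + θ) := funext fun θ => by rw [e]
  unfold histSeg
  split_ifs with h h' h'
  · exact MemLp.toLp_congr _ _ (Eventually.of_forall fun θ => congrFun e' θ)
  · exact absurd (e' ▸ h) h'
  · exact absurd (e' ▸ h') h
  · rfl

/-- Translation is continuous in L²(ℝ). Near t₀ the segments of z are those of its truncation at t₀
+ 1, translated and restricted to (-τ, 0). -/
theorem continuousOn_histSeg {z : ℝ → X} (hz : ContinuousOn z (Ici 0))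
    (hφ : MemLp z 2 (histMeasure τ)) : ContinuousOn (histSeg τ z) (Ici 0) := by
  intro t₀ ht₀
  set Z := (memLp_truncHist hz hφ (t₀ + 1)).toLp _ with hZ
  have hg : Continuous fun t : ℝ => (⟨fun s => t + s, by fun_prop⟩ : C(ℝ, ℝ)) :=
    (ContinuousMap.mk (fun a : ℝ × ℝ => a.1 + a.2) (by fun_prop)).curry.continuous
  have hc : Continuous fun t : ℝ => Lp.compMeasurePreserving
      (⟨fun s => t + s, by fun_prop⟩ : C(ℝ, ℝ)) (measurePreserving_add_left volume t) Z :=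
    continuous_const.compMeasurePreservingLp hg _ (by norm_num)
  have hc2 := (LpToLpRestrictCLM ℝ X ℂ volume 2 (Ioo (-τ) 0)).continuous.comp hc
  have heq : ∀ t, 0 ≤ t → t ≤ t₀ + 1 →
      histSeg τ z t = LpToLpRestrictCLM ℝ X ℂ volume 2 (Ioo (-τ) 0) (Lp.compMeasurePreserving
      (⟨fun s => t + s, by fun_prop⟩ : C(ℝ, ℝ)) (measurePreserving_add_left volume t) Z) := by
    intro t ht0 ht1
    refine Lp.ext ((coeFn_histSeg (memLp_shift hz hφ ht0)).trans ?_)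
    refine EventuallyEq.trans ?_ (LpToLpRestrictCLM_coeFn ℂ (Ioo (-τ) 0) _).symm
    refine EventuallyEq.trans ?_ (ae_restrict_of_ae (Lp.coeFn_compMeasurePreserving Z
      (measurePreserving_add_left volume t)).symm)
    have h1 : (Z ∘ fun s => t + s) =ᵐ[volume.restrict (Ioo (-τ) 0)]
        (truncHist τ z (t₀ + 1)) ∘ fun s => t + s :=
      ae_restrict_of_ae ((measurePreserving_add_left volume t).quasiMeasurePreserving.ae_eq_comp
        (MemLp.coeFn_toLp _))
    refine EventuallyEq.trans ?_ h1.symm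
    filter_upwards [ae_restrict_mem measurableSet_Ioo] with θ hθ
    exact (truncHist_eq (by linarith [hθ.1]) (by linarith [hθ.2])).symm
  refine hc2.continuousWithinAt.congr_of_eventuallyEq ?_ (heq t₀ ht₀ (by linarith))
  filter_upwards [self_mem_nhdsWithin, mem_nhdsWithin_of_mem_nhds
    (Iic_mem_nhds (show t₀ < t₀ + 1 by linarith))] with t h1 h2 using heq t h1 h2

theorem histSeg_congr {z z' : ℝ → X} (hz : ContinuousOn z (Ici 0))
    (hφ : MemLp z 2 (histMeasure τ)) (h : z =ᵐ[histMeasure τ] z')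
    (h' : ∀ t, 0 ≤ t → z t = z' t) {t : ℝ} (ht : 0 ≤ t) : histSeg τ z t = histSeg τ z' t := by
  have hz' : ContinuousOn z' (Ici 0) := hz.congr fun t ht => (h' t ht).symm
  refine Lp.ext ((coeFn_histSeg (memLp_shift hz hφ ht)).trans ?_)
  refine EventuallyEq.trans ?_ (coeFn_histSeg (memLp_shift hz' (hφ.ae_eq h) ht)).symm
  exact ae_shift_of_hist h h' ht

/-- The segment splits into the part still coming from φ, whose norm is at most ‖φ‖ by translation
invariance, and the part coming from [0, t], whose norm is at most the supremum bound times the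
square root of the length of the interval. -/
theorem exists_norm_histSeg_le (X : Type*) [NormedAddCommGroup X] [InnerProductSpace ℂ X] (τ : ℝ) :
    ∃ C : ℝ, 0 ≤ C ∧ ∀ (z : ℝ → X) (φ : Hist X τ) (t M : ℝ), 0 ≤ t → ContinuousOn z (Ici 0) →
      z =ᵐ[histMeasure τ] φ → (∀ r ∈ Icc 0 t, ‖z r‖ ≤ M) →
      ‖histSeg τ z t‖ ≤ ‖φ‖ + C * M := by
  refine ⟨measureUnivNNReal (histMeasure τ) ^ (2 : ℝ≥0∞).toReal⁻¹, by positivity,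
    fun z φ t M ht hz hφ hM => ?_⟩
  have hM0 : 0 ≤ M := (norm_nonneg _).trans (hM 0 ⟨le_rfl, ht⟩)
  have hφ2 : MemLp z 2 (histMeasure τ) := (Lp.memLp φ).ae_eq hφ.symm
  have hAv : MemLp ((Ioo (-τ) 0).indicator z) 2 volume :=
    (memLp_indicator_iff_restrict measurableSet_Ioo).2 hφ2
  have hA := (hAv.comp_measurePreserving (measurePreserving_add_left volume t)).restrict
    (Ioo (-τ) 0)
  have hB : MemLp (fun θ => (Icc 0 t).indicator z (t + θ)) 2 (histMeasure τ) := by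
    have := (memLp_shift hz hφ2 ht).sub hA
    refine this.ae_eq ?_
    filter_upwards [ae_restrict_mem measurableSet_Ioo] with θ hθ
    have h1 := truncHist_eq (z := z) (T := t) (τ := τ) (r := t + θ) (by linarith [hθ.1])
      (by linarith [hθ.2])
    simp only [Pi.sub_apply, Function.comp_apply]
    rw [← h1, truncHist, Pi.add_apply, add_sub_cancel_left]
  have hsum : histSeg τ z t = hA.toLp _ + hB.toLp _ := by
    refine Lp.ext ((coeFn_histSeg (memLp_shift hz hφ2 ht)).trans ?_)
    refine EventuallyEq.trans ?_ (Lp.coeFn_add _ _).symm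
    filter_upwards [ae_restrict_mem measurableSet_Ioo, hA.coeFn_toLp, hB.coeFn_toLp]
      with θ hθ h1 h2
    rw [Pi.add_apply, h1, h2]
    exact (truncHist_eq (by linarith [hθ.1]) (by linarith [hθ.2])).symm
  rw [hsum]
  refine (norm_add_le _ _).trans (add_le_add ?_ ?_)
  · rw [Lp.norm_toLp, Lp.norm_def]
    refine ENNReal.toReal_mono (Lp.memLp φ).2.ne ?_
    refine (eLpNorm_mono_measure _ Measure.restrict_le_self).trans ?_
    rw [eLpNorm_comp_measurePreserving hAv.1 (measurePreserving_add_left volume t),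
      eLpNorm_indicator_eq_eLpNorm_restrict measurableSet_Ioo]
    exact (eLpNorm_congr_ae hφ).le
  · refine Lp.norm_le_of_ae_bound hM0 ?_
    filter_upwards [hB.coeFn_toLp] with θ h1
    rw [h1]
    by_cases h : t + θ ∈ Icc 0 t
    · rw [indicator_of_mem h]
      exact hM _ h
    · rw [indicator_of_notMem h, norm_zero]
      exact hM0

end HistorySegment

/-! ### The delay semigroup -/

section DelaySemigroup

variable {X : Type*} [NormedAddCommGroup X] [InnerProductSpace ℂ X]

theorem norm_toLp_prod_le {τ : ℝ} (a : X) (b : Hist X τ) :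
    ‖(WithLp.toLp 2 (a, b) : StateSpace X τ)‖ ≤ ‖a‖ + ‖b‖ := by
  have : (WithLp.toLp 2 (a, b) : StateSpace X τ) = WithLp.toLp 2 (a, 0) + WithLp.toLp 2 (0, b) := by
    rw [← WithLp.toLp_add]; simp
  rw [this]
  refine (norm_add_le _ _).trans (le_of_eq ?_)
  rw [WithLp.norm_toLp_fst, WithLp.norm_toLp_snd]

theorem StateSpace.ext {τ : ℝ} {p q : StateSpace X τ} (h1 : p.fst = q.fst) (h2 : p.snd = q.snd) :
    p = q := WithLp.ofLp_injective 2 (Prod.ext h1 h2)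

variable {τ : ℝ}

theorem IsForcedSolution.memLp {S : C0Semigroup X} {κ : ℝ} {x : X} {φ f z : ℝ → X}
    (hz : IsForcedSolution S κ τ x φ f z) (hφ : MemLp φ 2 (histMeasure τ)) :
    MemLp z 2 (histMeasure τ) := hφ.ae_eq hz.history.symm

/-- The state `(z(t), z_t)` of a function on `(-τ, ∞)`. -/
def stateOf (τ : ℝ) (z : ℝ → X) (t : ℝ) : StateSpace X τ := WithLp.toLp 2 (z t, histSeg τ z t)

theorem continuousOn_stateOf {z : ℝ → X} (hz : ContinuousOn z (Ici 0))
    (hφ : MemLp z 2 (histMeasure τ)) : ContinuousOn (stateOf τ z) (Ici 0) :=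
  (WithLp.prod_continuous_toLp 2 X (Hist X τ)).comp_continuousOn
    (hz.prodMk (continuousOn_histSeg hz hφ))

theorem stateOf_congr {z z' : ℝ → X} (hz : ContinuousOn z (Ici 0))
    (hφ : MemLp z 2 (histMeasure τ)) (h : z =ᵐ[histMeasure τ] z')
    (h' : ∀ t, 0 ≤ t → z t = z' t) {t : ℝ} (ht : 0 ≤ t) : stateOf τ z t = stateOf τ z' t := by
  rw [stateOf, stateOf, histSeg_congr hz hφ h h' ht, h' t ht]

theorem stateOf_unique {S : C0Semigroup X} {κ : ℝ} (hτ : 0 < τ) {x : X} {φ f z z' : ℝ → X}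
    (hφ : MemLp φ 2 (histMeasure τ)) (hz : IsForcedSolution S κ τ x φ f z)
    (hz' : IsForcedSolution S κ τ x φ f z') {t : ℝ} (ht : 0 ≤ t) :
    stateOf τ z t = stateOf τ z' t :=
  stateOf_congr hz.continuousOn (hz.memLp hφ) (hz.history.trans hz'.history.symm)
    (fun _ ht => hz.unique hτ hz' ht) ht

theorem stateOf_add {z z' : ℝ → X} {t : ℝ}
    (h : MemLp (fun θ => z (t + θ)) 2 (histMeasure τ))
    (h' : MemLp (fun θ => z' (t + θ)) 2 (histMeasure τ)) :
    stateOf τ (z + z') t = stateOf τ z t + stateOf τ z' t := by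
  refine StateSpace.ext rfl ?_
  refine Lp.ext ((coeFn_histSeg (h.add h')).trans ?_)
  refine EventuallyEq.trans ?_ (Lp.coeFn_add _ _).symm
  filter_upwards [coeFn_histSeg h, coeFn_histSeg h'] with θ h1 h2
  rw [Pi.add_apply]
  exact (congrArg₂ (· + ·) h1 h2).symm

/-- Componentwise application of a bounded operator of `X` to the state. -/
def stateMap (τ : ℝ) (C : X →L[ℂ] X) : StateSpace X τ →L[ℂ] StateSpace X τ :=
  (WithLp.prodContinuousLinearEquiv 2 ℂ X (Hist X τ)).symm.toContinuousLinearMap.comp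
    (((C.comp (WithLp.fstL 2 ℂ X (Hist X τ)))).prod
      ((C.compLpL 2 (histMeasure τ)).comp (WithLp.sndL 2 ℂ X (Hist X τ))))

theorem stateMap_fst (C : X →L[ℂ] X) (p : StateSpace X τ) : (stateMap τ C p).fst = C p.fst := rfl

theorem stateMap_snd (C : X →L[ℂ] X) (p : StateSpace X τ) :
    (stateMap τ C p).snd =ᵐ[histMeasure τ] fun θ => C (p.snd θ) :=
  ContinuousLinearMap.coeFn_compLp C p.snd

theorem stateMap_stateOf (C : X →L[ℂ] X) {z : ℝ → X} {t : ℝ}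
    (h : MemLp (fun θ => z (t + θ)) 2 (histMeasure τ)) :
    stateMap τ C (stateOf τ z t) = stateOf τ (fun s => C (z s)) t := by
  refine StateSpace.ext rfl ?_
  refine Lp.ext ((stateMap_snd C _).trans ?_)
  have hC : MemLp (fun θ => C (z (t + θ))) 2 (histMeasure τ) := C.comp_memLp' h
  refine EventuallyEq.trans ?_ (coeFn_histSeg (z := fun s => C (z s)) hC).symm
  exact (coeFn_histSeg h).fun_comp C

theorem stateOf_zero {S : C0Semigroup X} {κ : ℝ} {p : StateSpace X τ} {f z : ℝ → X}
    (hz : IsForcedSolution S κ τ p.fst p.snd f z) : stateOf τ z 0 = p := by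
  refine StateSpace.ext hz.initial ?_
  have hm := memLp_shift hz.continuousOn (hz.memLp (Lp.memLp _)) le_rfl
  refine Lp.ext ((coeFn_histSeg hm).trans ?_)
  filter_upwards [hz.history] with θ h
  rw [zero_add, h]

variable [CompleteSpace X] (S : C0Semigroup X) (κ : ℝ)

/-- The solution of the unforced delay equation with given initial state. -/
def delayFlow (τ : ℝ) (p : StateSpace X τ) : ℝ → X := forcedFlow S κ τ p.fst p.snd 0

theorem delayFlow_isForcedSolution (hτ : 0 < τ) (p : StateSpace X τ) :
    IsForcedSolution S κ τ p.fst p.snd 0 (delayFlow S κ τ p) :=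
  forcedFlow_isForcedSolution hτ _ p.snd.integrable fun _ _ => intervalIntegrable_const

theorem delayFlow_add (hτ : 0 < τ) (p q : StateSpace X τ) {t : ℝ} (ht : 0 ≤ t) :
    stateOf τ (delayFlow S κ τ (p + q)) t =
      stateOf τ (delayFlow S κ τ p) t + stateOf τ (delayFlow S κ τ q) t := by
  have hp := delayFlow_isForcedSolution S κ hτ p
  have hq := delayFlow_isForcedSolution S κ hτ q
  have h := (hp.add hq p.snd.integrable q.snd.integrable (fun _ _ => intervalIntegrable_const)
    (fun _ _ => intervalIntegrable_const)).congr_hist (Lp.coeFn_add p.snd q.snd).symm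
  rw [add_zero] at h
  rw [← stateOf_add (memLp_shift hp.continuousOn (hp.memLp (Lp.memLp _)) ht)
    (memLp_shift hq.continuousOn (hq.memLp (Lp.memLp _)) ht)]
  exact stateOf_unique hτ (Lp.memLp _) (delayFlow_isForcedSolution S κ hτ (p + q)) h ht

/-- Both sides are states of solutions with the same initial data, so uniqueness identifies them. -/
theorem delayFlow_map (hτ : 0 < τ) (C : X →L[ℂ] X)
    (hC : ∀ t, 0 ≤ t → ∀ x, C (S.op t x) = S.op t (C x)) (p : StateSpace X τ) {t : ℝ}
    (ht : 0 ≤ t) :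
    stateOf τ (delayFlow S κ τ (stateMap τ C p)) t =
      stateMap τ C (stateOf τ (delayFlow S κ τ p) t) := by
  have hp := delayFlow_isForcedSolution S κ hτ p
  have h0 : (fun s => C ((0 : ℝ → X) s)) = 0 := by
    ext s
    exact map_zero C
  have h : IsForcedSolution S κ τ (stateMap τ C p).fst (stateMap τ C p).snd 0
      fun s => C (delayFlow S κ τ p s) := by
    rw [← h0]
    exact (hp.map p.snd.integrable (fun _ _ => intervalIntegrable_const) C hC).congr_hist
      (stateMap_snd C p).symm
  rw [stateMap_stateOf C (memLp_shift hp.continuousOn (hp.memLp (Lp.memLp _)) ht)]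
  exact stateOf_unique hτ (Lp.memLp _)
    (delayFlow_isForcedSolution S κ hτ (stateMap τ C p)) h ht

theorem exists_norm_stateOf_delayFlow_le (hτ : 0 < τ) {t : ℝ} (ht : 0 ≤ t) :
    ∃ M : ℝ, ∀ p : StateSpace X τ, ‖stateOf τ (delayFlow S κ τ p) t‖ ≤ M * ‖p‖ := by
  obtain ⟨M, hM0, hM⟩ := exists_norm_forcedFlow_le (S := S) (κ := κ) hτ t
  obtain ⟨C, hC0, hC⟩ := exists_norm_histSeg_le X τ
  obtain ⟨D, hD0, hD⟩ := exists_integral_norm_hist_le X τ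
  refine ⟨M * (1 + D) + (1 + C * (M * (1 + D))), fun p => ?_⟩
  have h1 : ∀ r ∈ Icc 0 t, ‖delayFlow S κ τ p r‖ ≤ M * (1 + D) * ‖p‖ := fun r hr => by
    refine (hM p.fst p.snd p.snd.integrable r hr).trans ?_
    rw [mul_assoc]
    gcongr
    have h3 := WithLp.norm_fst_le X p
    have h4 := WithLp.norm_snd_le X p
    calc _ ≤ ‖p‖ + D * ‖p.snd‖ := add_le_add h3 (hD _)
      _ ≤ ‖p‖ + D * ‖p‖ := by gcongr
      _ = _ := by ring
  have hp := delayFlow_isForcedSolution S κ hτ p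
  have h2 := hC _ p.snd t _ ht hp.continuousOn hp.history h1
  calc _ ≤ _ := norm_toLp_prod_le _ _
    _ ≤ M * (1 + D) * ‖p‖ + (‖p‖ + C * (M * (1 + D) * ‖p‖)) :=
        add_le_add (h1 t ⟨ht, le_rfl⟩)
          (h2.trans (add_le_add (WithLp.norm_snd_le X p) le_rfl))
    _ = _ := by ring

/-- The operators of the delay semigroup. -/
def delayOp (hτ : 0 < τ) (t : ℝ) : StateSpace X τ →L[ℂ] StateSpace X τ :=
  LinearMap.mkContinuousOfExistsBound
    -- Linearity rests on uniqueness of solutions for t ≥ 0; `max t 0` makes the operator bounded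
    -- and linear at negative times as well.
    { toFun := fun p => stateOf τ (delayFlow S κ τ p) (max t 0)
      map_add' := fun p q => delayFlow_add S κ hτ p q (le_max_right _ _)
      map_smul' := fun c p => by
        -- Homogeneity is the commutation with the operator c · id.
        have h := delayFlow_map S κ hτ (c • ContinuousLinearMap.id ℂ X) (fun t _ x => by simp) p
          (le_max_right t 0)
        have e : ∀ q : StateSpace X τ, stateMap τ (c • ContinuousLinearMap.id ℂ X) q = c • q := by
          intro q
          refine StateSpace.ext rfl (Lp.ext ((stateMap_snd _ _).trans ?_))
          exact (Lp.coeFn_smul c q.snd).symm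
        rw [e, e] at h
        exact h } (exists_norm_stateOf_delayFlow_le S κ hτ (le_max_right t 0))

theorem delayOp_apply (hτ : 0 < τ) {t : ℝ} (ht : 0 ≤ t) (p : StateSpace X τ) :
    delayOp S κ hτ t p = stateOf τ (delayFlow S κ τ p) t := by
  change stateOf τ (delayFlow S κ τ p) (max t 0) = _
  rw [max_eq_left ht]

/-- The semigroup `(x, φ) ↦ (y(t), y_t)` of the delay equation. -/
def delaySemigroup (hτ : 0 < τ) : C0Semigroup (StateSpace X τ) where
  op := delayOp S κ hτ
  op_zero := by
    ext1 p
    rw [delayOp_apply S κ hτ le_rfl, stateOf_zero (delayFlow_isForcedSolution S κ hτ p)]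
    rfl
  op_add := fun s t hs ht => by
    ext1 p
    rw [ContinuousLinearMap.comp_apply, delayOp_apply S κ hτ (add_nonneg hs ht),
      delayOp_apply S κ hτ ht, delayOp_apply S κ hτ hs]
    have hp := delayFlow_isForcedSolution S κ hτ p
    have hm := memLp_shift hp.continuousOn (hp.memLp (Lp.memLp _)) ht
    -- The solution translated by t solves the equation with the state at time t as initial data;
    -- uniqueness turns this into the semigroup law.
    have h := (hp.shift p.snd.integrable (fun _ _ => intervalIntegrable_const) ht).congr_hist
      (coeFn_histSeg hm).symm
    rw [← stateOf_unique hτ (Lp.memLp _) h (delayFlow_isForcedSolution S κ hτ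
      (stateOf τ (delayFlow S κ τ p) t)) hs]
    rw [stateOf, stateOf, histSeg_shift, add_comm t s]
  strongly_continuous := fun p => by
    have hp := delayFlow_isForcedSolution S κ hτ p
    exact (continuousOn_stateOf hp.continuousOn (hp.memLp (Lp.memLp _))).congr
      fun t ht => delayOp_apply S κ hτ ht p

theorem delaySemigroup_op (hτ : 0 < τ) {t : ℝ} (ht : 0 ≤ t) (p : StateSpace X τ) :
    (delaySemigroup S κ hτ).op t p = stateOf τ (delayFlow S κ τ p) t := delayOp_apply S κ hτ ht p

theorem stateMap_delaySemigroup (hτ : 0 < τ) (C : X →L[ℂ] X)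
    (hC : ∀ t, 0 ≤ t → ∀ x, C (S.op t x) = S.op t (C x)) {t : ℝ} (ht : 0 ≤ t)
    (p : StateSpace X τ) :
    stateMap τ C ((delaySemigroup S κ hτ).op t p) = (delaySemigroup S κ hτ).op t (stateMap τ C p) := by
  rw [delaySemigroup_op S κ hτ ht, delaySemigroup_op S κ hτ ht, delayFlow_map S κ hτ C hC p ht]

end DelaySemigroup

/-! ### Variation of constants for the delay semigroup -/

section VariationOfConstants

variable {X : Type*} [NormedAddCommGroup X] [InnerProductSpace ℂ X] {τ : ℝ}

/-- The embedding `x ↦ (x, 0)`. -/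
def stateInl (X : Type*) [NormedAddCommGroup X] [InnerProductSpace ℂ X] (τ : ℝ) :
    X →L[ℂ] StateSpace X τ :=
  (WithLp.prodContinuousLinearEquiv 2 ℂ X (Hist X τ)).symm.toContinuousLinearMap.comp
    (ContinuousLinearMap.inl ℂ X (Hist X τ))

variable (S : C0Semigroup X) (κ : ℝ)

/-- Starting from (x, 0), the zero history is exactly the extension of the fundamental solution by
zero; this identifies the orbits of states (x, 0). -/
theorem forcedFlow_inl (x : X) :
    forcedFlow S κ τ x 0 0 = fun a => causalKernel S κ τ a x := by
  ext a
  by_cases h : a < 0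
  · rw [forcedFlow_of_neg _ _ _ h, causalKernel_of_neg S κ h]
    rfl
  · rw [forcedFlow_of_nonneg _ _ _ (not_lt.1 h), causalKernel_of_nonneg S κ (not_lt.1 h)]
    simp

theorem forcedFlow_zero_zero (f : ℝ → X) {a t : ℝ} (ha : a ≤ t) (ht : 0 ≤ t) :
    forcedFlow S κ τ 0 0 f a = ∫ s in (0 : ℝ)..t, causalKernel S κ τ (a - s) (f s) := by
  rw [integral_causalKernel_conv S κ f ha ht]
  split_ifs with h
  · rw [forcedFlow_of_neg _ _ _ h]
    rfl
  · rw [forcedFlow_of_nonneg _ _ _ (not_lt.1 h), map_zero, zero_add]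
    simp

variable [CompleteSpace X]

/-- A Bochner integral in `L²(-τ,0;X)` is computed pointwise. -/
theorem coeFn_integral_hist {μ : Measure ℝ} [SFinite μ] {G : ℝ → Hist X τ} {g : ℝ → ℝ → X}
    (hG : Integrable G μ) (hg : Integrable g.uncurry (μ.prod (histMeasure τ)))
    (h : ∀ᵐ s ∂μ, G s =ᵐ[histMeasure τ] g s) :
    (∫ s, G s ∂μ : Hist X τ) =ᵐ[histMeasure τ] fun θ => ∫ s, g s θ ∂μ := by
  refine Integrable.ae_eq_of_forall_setIntegral_eq _ _ (Hist.integrable _)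
    hg.integral_prod_right fun E hE _ => ?_
  -- Both sides are tested by integration over a set E. This is a bounded operator on the history
  -- space, so it passes under the Bochner integral, and Fubini finishes.
  rw [← histIntegral_apply, ← (histIntegral X τ E).integral_comp_comm hG]
  have hE' : Integrable g.uncurry (μ.prod ((histMeasure τ).restrict E)) := by
    have := hg.restrict (s := univ ×ˢ E)
    rwa [← Measure.prod_restrict, Measure.restrict_univ] at this
  rw [← integral_integral_swap hE']
  refine integral_congr_ae ?_
  filter_upwards [h] with s hs
  rw [histIntegral_apply]
  exact integral_congr_ae (ae_restrict_of_ae hs)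

theorem causal_isForcedSolution (hτ : 0 < τ) (x : X) :
    IsForcedSolution S κ τ x 0 0 fun a => causalKernel S κ τ a x := by
  rw [← forcedFlow_inl]
  exact forcedFlow_isForcedSolution hτ x (integrable_zero _ _ _)
    fun _ _ => intervalIntegrable_const

theorem delaySemigroup_op_inl (hτ : 0 < τ) (x : X) {t : ℝ} (ht : 0 ≤ t) :
    (delaySemigroup S κ hτ).op t (stateInl X τ x) =
      stateOf τ (fun a => causalKernel S κ τ a x) t := by
  rw [delaySemigroup_op S κ hτ ht]
  refine stateOf_unique hτ (f := 0) (Lp.memLp _) (delayFlow_isForcedSolution S κ hτ _) ?_ ht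
  exact (causal_isForcedSolution S κ hτ x).congr_hist (Lp.coeFn_zero X 2 (histMeasure τ)).symm

/-- The semigroup convolution of a forcing of the first component is the state of the forced
delay equation with zero initial data. -/
theorem stateOf_forcedFlow_zero (hτ : 0 < τ) {f : ℝ → X}
    (hf : ∀ t, 0 ≤ t → IntervalIntegrable f volume 0 t) {t : ℝ} (ht : 0 ≤ t) :
    stateOf τ (forcedFlow S κ τ 0 0 f) t =
      ∫ s in (0 : ℝ)..t, (delaySemigroup S κ hτ).ext (t - s) (stateInl X τ (f s)) := by
  set T := delaySemigroup S κ hτ with hT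
  have hft := hf t ht
  have hinl : IntervalIntegrable (fun s => stateInl X τ (f s)) volume 0 t := by
    rw [intervalIntegrable_iff] at hft ⊢
    exact (stateInl X τ).integrable_comp hft
  have hG := intervalIntegrable_conv (K := T.ext) (fun x => T.continuous_ext x) hinl t
  have hGs : ∀ s ∈ Ioc 0 t, T.ext (t - s) (stateInl X τ (f s)) =
      stateOf τ (fun a => causalKernel S κ τ a (f s)) (t - s) := fun s hs => by
    rw [T.ext_of_nonneg (by linarith [hs.2]), hT,
      delaySemigroup_op_inl S κ hτ _ (by linarith [hs.2])]
  refine StateSpace.ext ?_ ?_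
  · have h1 := (WithLp.fstL 2 ℂ X (Hist X τ)).intervalIntegral_comp_comm hG
    refine Eq.trans ?_ h1
    change forcedFlow S κ τ 0 0 f t = _
    rw [forcedFlow_zero_zero S κ f le_rfl ht]
    refine intervalIntegral.integral_congr_ae (Eventually.of_forall fun s hs => ?_)
    rw [uIoc_of_le ht] at hs
    rw [hGs s hs]
    rfl
  · have h1 := (WithLp.sndL 2 ℂ X (Hist X τ)).intervalIntegral_comp_comm hG
    refine Eq.trans ?_ h1
    have hw := forcedFlow_isForcedSolution (S := S) (κ := κ) hτ 0
      (integrable_zero ℝ X (histMeasure τ)) hf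
    have hm := memLp_shift hw.continuousOn (hw.memLp (MemLp.zero)) ht
    refine Lp.ext ((coeFn_histSeg hm).trans ?_)
    rw [intervalIntegral.integral_of_le ht]
    have hfi : Integrable f (volume.restrict (Ioc 0 t)) :=
      (intervalIntegrable_iff_integrableOn_Ioc_of_le ht).1 hft
    obtain ⟨N, hN0, hN⟩ := exists_norm_causalKernel_le S κ hτ t
    have hg : Integrable (Function.uncurry fun s θ => causalKernel S κ τ (t - s + θ) (f s))
        ((volume.restrict (Ioc 0 t)).prod (histMeasure τ)) := by
      refine Integrable.mono' ((hfi.norm.comp_fst (histMeasure τ)).const_mul N) ?_ ?_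
      · exact aestronglyMeasurable_causal S κ hτ (a := fun p : ℝ × ℝ => t - p.1 + p.2)
          (by fun_prop) hfi.aestronglyMeasurable.comp_fst
      · rw [histMeasure, Measure.prod_restrict]
        filter_upwards [ae_restrict_mem (measurableSet_Ioc.prod measurableSet_Ioo)] with p hp
        have h1 := hp.1.1
        have h2 := hp.2.2
        exact (causalKernel S κ τ _).le_of_opNorm_le (hN _ (by linarith)) _
    -- The history component of the semigroup convolution is evaluated pointwise in θ, where it is
    -- the convolution with the causal kernel at time t + θ; for t + θ < 0 both vanish.
    have key := coeFn_integral_hist (τ := τ)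
      (G := fun s => (WithLp.sndL 2 ℂ X (Hist X τ)) (T.ext (t - s) (stateInl X τ (f s))))
      ((WithLp.sndL 2 ℂ X (Hist X τ)).integrable_comp
        ((intervalIntegrable_iff_integrableOn_Ioc_of_le ht).1 hG)) hg (by
        filter_upwards [ae_restrict_mem measurableSet_Ioc] with s hs
        have hc := causal_isForcedSolution S κ hτ (f s)
        have e : (WithLp.sndL 2 ℂ X (Hist X τ)) (T.ext (t - s) (stateInl X τ (f s))) =
            histSeg τ (fun a => causalKernel S κ τ a (f s)) (t - s) := by
          rw [hGs s hs]
          rfl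
        rw [e]
        exact coeFn_histSeg (memLp_shift hc.continuousOn (hc.memLp MemLp.zero)
          (by linarith [hs.2])))
    refine EventuallyEq.trans ?_ key.symm
    filter_upwards [ae_restrict_mem measurableSet_Ioo] with θ hθ
    rw [forcedFlow_zero_zero S κ f (t := t) (by linarith [hθ.2]) ht,
      intervalIntegral.integral_of_le ht]
    refine integral_congr_ae (Eventually.of_forall fun s => ?_)
    dsimp only
    rw [add_sub_right_comm]

/-- The variation of constants formula: the state of a solution of the forced delay equation is
given by the delay semigroup. -/
theorem stateOf_eq_duhamel (hτ : 0 < τ) {p : StateSpace X τ} {f z : ℝ → X}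
    (hz : IsForcedSolution S κ τ p.fst p.snd f z)
    (hf : ∀ t, 0 ≤ t → IntervalIntegrable f volume 0 t) {t : ℝ} (ht : 0 ≤ t) :
    stateOf τ z t = (delaySemigroup S κ hτ).op t p +
      ∫ s in (0 : ℝ)..t, (delaySemigroup S κ hτ).op (t - s) (stateInl X τ (f s)) := by
  have hp := delayFlow_isForcedSolution S κ hτ p
  have hw := forcedFlow_isForcedSolution (S := S) (κ := κ) hτ 0
    (integrable_zero ℝ X (histMeasure τ)) hf
  have h := hp.add hw p.snd.integrable (integrable_zero _ _ _)
    (fun _ _ => intervalIntegrable_const) hf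
  rw [add_zero, zero_add] at h
  -- Superposition: the unforced solution starting from p plus the forced solution starting from
  -- zero.
  have h' : IsForcedSolution S κ τ p.fst p.snd f
      (delayFlow S κ τ p + forcedFlow S κ τ 0 0 f) :=
    h.congr_hist (Eventually.of_forall fun θ => add_zero (p.snd θ))
  rw [stateOf_unique hτ (Lp.memLp _) hz h' ht,
    stateOf_add (memLp_shift hp.continuousOn (hp.memLp (Lp.memLp _)) ht)
      (memLp_shift hw.continuousOn (hw.memLp MemLp.zero) ht),
    delaySemigroup_op S κ hτ ht, stateOf_forcedFlow_zero S κ hτ hf ht]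
  congr 1
  refine intervalIntegral.integral_congr fun s hs => ?_
  rw [uIcc_of_le ht] at hs
  rw [C0Semigroup.ext_of_nonneg _ (by linarith [hs.2])]

end VariationOfConstants

/-! ### Weak derivatives on the history interval -/

section WeakDerivative

variable {X : Type*} [NormedAddCommGroup X] [InnerProductSpace ℂ X] {τ : ℝ}

theorem integrable_test_smul {f : ℝ → X} (hf : Integrable f (histMeasure τ)) {η : ℝ → ℝ}
    (h : Continuous η) (hc : HasCompactSupport η) :
    Integrable (fun θ => η θ • f θ) (histMeasure τ) := by
  obtain ⟨C, hC⟩ := hc.exists_bound_of_continuous h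
  exact Integrable.bdd_smul (𝕜 := ℝ) (φ := η) (f := f) hf C h.aestronglyMeasurable
    (Eventually.of_forall hC)

theorem setIntegral_deriv_test {η : ℝ → ℝ} (h1 : ContDiff ℝ ∞ η) (h3 : tsupport η ⊆ Ioo (-τ) 0)
    {s : ℝ} (hs : -τ ≤ s) : ∫ θ in Ioo (-τ) s, deriv η θ = η s := by
  have h0 : η (-τ) = 0 := image_eq_zero_of_notMem_tsupport fun hh => lt_irrefl _ (h3 hh).1
  have hd : Continuous (deriv η) := h1.continuous_deriv (by simp)
  rw [← integral_Ioc_eq_integral_Ioo, ← intervalIntegral.integral_of_le hs,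
    intervalIntegral.integral_deriv_eq_sub
      (fun x _ => (h1.differentiable (by simp)).differentiableAt) (hd.intervalIntegrable _ _),
    h0, sub_zero]

theorem integral_deriv_test (hτ : 0 < τ) {η : ℝ → ℝ} (h1 : ContDiff ℝ ∞ η)
    (h3 : tsupport η ⊆ Ioo (-τ) 0) : ∫ θ, deriv η θ ∂(histMeasure τ) = 0 := by
  rw [histMeasure, setIntegral_deriv_test h1 h3 (by linarith)]
  exact image_eq_zero_of_notMem_tsupport fun hh => lt_irrefl _ (h3 hh).2

theorem continuous_primitive_indicator {b : ℝ → X} (hb : Integrable b (histMeasure τ)) :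
    Continuous fun θ => ∫ s in θ..0, (Ioo (-τ) 0).indicator b s := by
  have hi : Integrable ((Ioo (-τ) 0).indicator b) := (integrable_indicator_iff measurableSet_Ioo).2 hb
  simp_rw [fun θ => intervalIntegral.integral_symm (μ := volume) (f := (Ioo (-τ) 0).indicator b) 0 θ]
  exact (intervalIntegral.continuous_primitive (fun a b => hi.intervalIntegrable) 0).neg

/-- A smooth function supported in `(-τ,0)` with integral zero is the derivative of a test
function. -/
theorem exists_test_primitive {g : ℝ → ℝ} (h1 : ContDiff ℝ ∞ g) (h2 : HasCompactSupport g)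
    (h3 : tsupport g ⊆ Ioo (-τ) 0) (h4 : ∫ θ, g θ = 0) :
    ∃ η : ℝ → ℝ, ContDiff ℝ ∞ η ∧ HasCompactSupport η ∧ tsupport η ⊆ Ioo (-τ) 0 ∧
      deriv η = g := by
  rcases (tsupport g).eq_empty_or_nonempty with he | hne
  · have hg : g = 0 := tsupport_eq_empty_iff.1 he
    refine ⟨0, contDiff_const, HasCompactSupport.zero, ?_, ?_⟩
    · rw [tsupport_eq_empty_iff.2 rfl]
      exact empty_subset _
    · rw [hg]
      ext x
      simp
  -- The primitive vanishes to the left of a because g does, and to the right of b because g has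
  -- total integral zero. Its support therefore lies in [a, b], a compact subinterval of (-τ, 0).
  set a := sInf (tsupport g)
  set b := sSup (tsupport g)
  have ha : a ∈ tsupport g := h2.sInf_mem hne
  have hb : b ∈ tsupport g := h2.sSup_mem hne
  have hout : ∀ x, x ∉ Icc a b → g x = 0 := fun x hx =>
    image_eq_zero_of_notMem_tsupport fun hh =>
      hx ⟨csInf_le h2.isBounded.bddBelow hh, le_csSup h2.isBounded.bddAbove hh⟩
  have hgc := h1.continuous
  have hderiv : ∀ x, HasDerivAt (fun x => ∫ t in (-τ)..x, g t) (g x) x := fun x =>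
    intervalIntegral.integral_hasDerivAt_right (hgc.intervalIntegrable _ _)
      (hgc.stronglyMeasurableAtFilter _ _) hgc.continuousAt
  have hde : deriv (fun x => ∫ t in (-τ)..x, g t) = g := funext fun x => (hderiv x).deriv
  have hsupp : Function.support (fun x => ∫ t in (-τ)..x, g t) ⊆ Icc a b := by
    intro x hx
    by_contra hxab
    apply hx
    rw [mem_Icc, not_and_or, not_le, not_le] at hxab
    dsimp only
    rcases hxab with hxa | hxb
    · rw [← intervalIntegral.integral_zero (μ := volume) (a := -τ) (b := x)]
      refine intervalIntegral.integral_congr fun t ht => hout t fun hh => ?_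
      have h5 : t ≤ max (-τ) x := ht.2
      rcases le_max_iff.1 h5 with h6 | h6
      · linarith [(h3 ha).1, hh.1]
      · linarith [hh.1]
    · rw [← h4, intervalIntegral.integral_of_le (by linarith [(h3 hb).1])]
      refine setIntegral_eq_integral_of_forall_compl_eq_zero fun t ht => hout t fun hh => ht ?_
      exact ⟨by linarith [(h3 ha).1, hh.1], by linarith [hh.2]⟩
  have hts : tsupport (fun x => ∫ t in (-τ)..x, g t) ⊆ Icc a b :=
    closure_minimal hsupp isClosed_Icc
  refine ⟨_, ?_, HasCompactSupport.of_support_subset_isCompact isCompact_Icc hsupp,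
    hts.trans (Icc_subset_Ioo (h3 ha).1 (h3 hb).2), hde⟩
  rw [contDiff_infty_iff_deriv, hde]
  exact ⟨fun x => (hderiv x).differentiableAt, h1⟩

variable [CompleteSpace X]

/-- Integration by parts against a test function. -/
theorem integral_deriv_smul_primitive {b : ℝ → X} (hb : Integrable b (histMeasure τ)) {η : ℝ → ℝ}
    (h1 : ContDiff ℝ ∞ η) (h2 : HasCompactSupport η) (h3 : tsupport η ⊆ Ioo (-τ) 0) :
    ∫ θ, deriv η θ • (∫ s in θ..0, (Ioo (-τ) 0).indicator b s) ∂(histMeasure τ) =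
      ∫ s, η s • b s ∂(histMeasure τ) := by
  have hd : Continuous (deriv η) := h1.continuous_deriv (by simp)
  -- Fubini on the triangle θ < s: integrating η' over (-τ, s) leaves η(s).
  set k : ℝ → ℝ → X := fun θ s => {p : ℝ × ℝ | p.1 < p.2}.indicator
    (fun p => deriv η p.1 • b p.2) (θ, s) with hk
  have hki : Integrable k.uncurry ((histMeasure τ).prod (histMeasure τ)) := by
    refine Integrable.indicator (Integrable.smul_prod ?_ hb)
      (measurableSet_lt measurable_fst measurable_snd)
    exact (hd.integrable_of_hasCompactSupport h2.deriv).integrableOn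
  have e1 : ∀ θ ∈ Ioo (-τ) 0, deriv η θ • (∫ s in θ..0, (Ioo (-τ) 0).indicator b s) =
      ∫ s, k θ s ∂(histMeasure τ) := by
    intro θ hθ
    have : ∀ s, k θ s = deriv η θ • (Ioi θ).indicator b s := fun s => by
      by_cases hs : θ < s
      · rw [hk, indicator_of_mem (mem_Ioi.2 hs)]
        exact indicator_of_mem (s := {p : ℝ × ℝ | p.1 < p.2}) (a := (θ, s)) hs _
      · rw [hk, indicator_of_notMem (by simpa using hs), smul_zero]
        exact indicator_of_notMem (s := {p : ℝ × ℝ | p.1 < p.2}) (a := (θ, s)) hs _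
    simp_rw [this]
    rw [integral_smul, intervalIntegral.integral_of_le hθ.2.le,
      setIntegral_indicator measurableSet_Ioo, setIntegral_indicator measurableSet_Ioi]
    congr 3
    ext s
    simp only [mem_inter_iff, mem_Ioc, mem_Ioo, mem_Ioi]
    constructor
    · rintro ⟨⟨h1, _⟩, h2, h3⟩
      exact ⟨⟨h2, h3⟩, h1⟩
    · rintro ⟨⟨h1, h2⟩, h3⟩
      exact ⟨⟨h3, h2.le⟩, h1, h2⟩
  have e2 : ∀ s ∈ Ioo (-τ) 0, ∫ θ, k θ s ∂(histMeasure τ) = η s • b s := by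
    intro s hs
    have : ∀ θ, k θ s = (Iio s).indicator (deriv η) θ • b s := fun θ => by
      by_cases hθ : θ < s
      · rw [hk, indicator_of_mem (mem_Iio.2 hθ)]
        exact indicator_of_mem (s := {p : ℝ × ℝ | p.1 < p.2}) (a := (θ, s)) hθ _
      · rw [hk, indicator_of_notMem (by simpa using hθ), zero_smul]
        exact indicator_of_notMem (s := {p : ℝ × ℝ | p.1 < p.2}) (a := (θ, s)) hθ _
    simp_rw [this]
    rw [integral_smul_const, setIntegral_indicator measurableSet_Iio, Ioo_inter_Iio,
      min_eq_right hs.2.le, setIntegral_deriv_test h1 h3 hs.1.le]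
  rw [setIntegral_congr_fun measurableSet_Ioo e1, integral_integral_swap hki,
    setIntegral_congr_fun measurableSet_Ioo e2]

/-- The constant drops out because η' has integral zero; the rest is integration by parts. -/
theorem isWeakDeriv_of_eq_primitive (hτ : 0 < τ) {f b : ℝ → X} {c : X}
    (hb : Integrable b (histMeasure τ))
    (hf : ∀ᵐ θ ∂(histMeasure τ), f θ = c - ∫ s in θ..0, (Ioo (-τ) 0).indicator b s) :
    IsWeakDeriv τ f b := by
  intro η h1 h2 h3
  have hd : Continuous (deriv η) := h1.continuous_deriv (by simp)
  have hdi : Integrable (deriv η) (histMeasure τ) :=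
    (hd.integrable_of_hasCompactSupport h2.deriv).integrableOn
  have hP : Integrable (fun θ => ∫ s in θ..0, (Ioo (-τ) 0).indicator b s) (histMeasure τ) :=
    ((continuous_primitive_indicator hb).integrableOn_Icc (a := -τ) (b := 0)).mono_set
      Ioo_subset_Icc_self
  rw [integral_congr_ae (g := fun θ => deriv η θ • c -
    deriv η θ • ∫ s in θ..0, (Ioo (-τ) 0).indicator b s)]
  · rw [integral_sub (hdi.smul_const c) (integrable_test_smul hP hd h2.deriv), integral_smul_const,
      integral_deriv_test hτ h1 h3, zero_smul, zero_sub, integral_deriv_smul_primitive hb h1 h2 h3]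
  · filter_upwards [hf] with θ hθ
    rw [hθ, smul_sub]

/-- The lemma of du Bois-Reymond: a function with zero weak derivative is constant. -/
theorem ae_eq_const_of_weakDeriv_zero (hτ : 0 < τ) {f : ℝ → X}
    (hf : Integrable f (histMeasure τ))
    (h : ∀ η : ℝ → ℝ, ContDiff ℝ ∞ η → HasCompactSupport η → tsupport η ⊆ Ioo (-τ) 0 →
      ∫ θ, deriv η θ • f θ ∂(histMeasure τ) = 0) :
    ∃ c, ∀ᵐ θ ∂(histMeasure τ), f θ = c := by
  -- A bump at the midpoint whose outer radius τ/4 keeps it inside (-τ, 0). Normalised to integral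
  -- one, it defines the constant c as a weighted mean of f.
  let β : ContDiffBump (-τ / 2 : ℝ) := ⟨τ / 8, τ / 4, by linarith, by linarith⟩
  set ζ₀ : ℝ → ℝ := β.normed volume with hζ₀
  have z1 : ContDiff ℝ ∞ ζ₀ := β.contDiff_normed
  have z2 : HasCompactSupport ζ₀ := β.hasCompactSupport_normed
  have z3 : tsupport ζ₀ ⊆ Ioo (-τ) 0 := by
    rw [hζ₀, β.tsupport_normed_eq, Real.closedBall_eq_Icc]
    refine Icc_subset_Ioo ?_ ?_ <;> change _ < (_ : ℝ) <;> simp only [β] <;> linarith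
  have z4 : ∫ θ, ζ₀ θ = 1 := β.integral_normed
  refine ⟨∫ θ, ζ₀ θ • f θ ∂(histMeasure τ), ?_⟩
  set c := ∫ θ, ζ₀ θ • f θ ∂(histMeasure τ)
  have hfc : Integrable (fun θ => f θ - c) (histMeasure τ) := hf.sub (integrable_const c)
  have := isOpen_Ioo.ae_eq_zero_of_integral_contDiff_smul_eq_zero (μ := volume)
    (U := Ioo (-τ) 0) (f := fun θ => f θ - c) (IntegrableOn.locallyIntegrableOn hfc) (by
    intro ζ h1 h2 h3
    have hζi : Integrable ζ := h1.continuous.integrable_of_hasCompactSupport h2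
    have hζ₀i : Integrable ζ₀ := z1.continuous.integrable_of_hasCompactSupport z2
    set m := ∫ θ, ζ θ with hm
    have hmc : HasCompactSupport fun θ => m * ζ₀ θ := z2.mul_left
    have hms : tsupport (fun θ => m * ζ₀ θ) ⊆ Ioo (-τ) 0 :=
      (tsupport_mul_subset_right (f := fun _ => m) (g := ζ₀)).trans z3
    -- Subtracting m ζ₀, with m the integral of ζ, makes the integral zero, so ζ - m ζ₀ is the
    -- derivative of a test function. The hypothesis then says that ζ does not see f - c.
    obtain ⟨η, e1, e2, e3, e4⟩ := exists_test_primitive (τ := τ) (g := fun θ => ζ θ - m * ζ₀ θ)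
      (h1.sub (contDiff_const.mul z1)) (h2.sub hmc)
      ((tsupport_sub ζ fun θ => m * ζ₀ θ).trans (union_subset h3 hms)) (by
        rw [integral_sub hζi (hζ₀i.const_mul m), integral_const_mul, z4, mul_one, sub_self])
    have h5 := h η e1 e2 e3
    rw [e4] at h5
    have h6 : ∫ θ, ζ θ • (f θ - c) ∂(histMeasure τ) = 0 := by
      have hz : ∫ θ, ζ θ ∂(histMeasure τ) = m := by
        refine setIntegral_eq_integral_of_forall_compl_eq_zero fun t ht => ?_
        exact image_eq_zero_of_notMem_tsupport fun hh => ht (h3 hh)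
      simp_rw [smul_sub]
      rw [integral_sub (integrable_test_smul hf h1.continuous h2) (hζi.integrableOn.smul_const c),
        integral_smul_const, hz]
      simp_rw [sub_smul, mul_smul] at h5
      have hmi : Integrable (fun θ => m • ζ₀ θ • f θ) (histMeasure τ) :=
        (integrable_test_smul hf z1.continuous z2).smul m
      rw [integral_sub (integrable_test_smul hf h1.continuous h2) hmi, integral_smul] at h5
      exact h5
    rw [← h6]
    refine (setIntegral_eq_integral_of_forall_compl_eq_zero fun θ hθ => ?_).symm
    rw [image_eq_zero_of_notMem_tsupport (fun hh => hθ (h3 hh)), zero_smul])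
  rw [ae_hist_iff]
  filter_upwards [this] with θ h1 h2
  exact sub_eq_zero.1 (h1 h2)

end WeakDerivative

/-! ### Identification of the generator -/

section DelayGenerator

/-- The integrand may depend on the length h of the interval, as S(h - s) κ F(s - τ) does in the
difference quotient of a delay orbit; joint continuity at (0, 0) is enough. -/
theorem tendsto_average_param {X : Type*} [NormedAddCommGroup X] [NormedSpace ℝ X]
    [CompleteSpace X]
    {k : ℝ → ℝ → X} (hk : Continuous fun p : ℝ × ℝ => k p.1 p.2) :
    Tendsto (fun h : ℝ => h⁻¹ • ∫ s in (0 : ℝ)..h, k h s) (𝓝[>] 0) (𝓝 (k 0 0)) := by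
  have hc : ∀ h, Continuous (k h) := fun h =>
    hk.comp (f := fun s => (h, s)) (by fun_prop)
  rw [Metric.tendsto_nhdsWithin_nhds]
  intro ε hε
  obtain ⟨δ, hδ, h⟩ := Metric.continuousAt_iff.1 (hk.continuousAt (x := ((0 : ℝ), (0 : ℝ))))
    (ε / 2) (by linarith)
  refine ⟨δ, hδ, fun {h'} h0 h1 => ?_⟩
  have h0' : 0 < h' := h0
  rw [Real.dist_0_eq_abs, abs_of_pos h0'] at h1
  have e : h'⁻¹ • (∫ s in (0 : ℝ)..h', k h' s) - k 0 0 =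
      h'⁻¹ • ∫ s in (0 : ℝ)..h', (k h' s - k 0 0) := by
    rw [intervalIntegral.integral_sub ((hc h').intervalIntegrable _ _) intervalIntegrable_const,
      intervalIntegral.integral_const, sub_zero, smul_sub, smul_smul, inv_mul_cancel₀ h0'.ne',
      one_smul]
  rw [dist_eq_norm, e, norm_smul, norm_inv, Real.norm_eq_abs, abs_of_pos h0',
    inv_mul_lt_iff₀ h0']
  have hb := intervalIntegral.norm_integral_le_of_norm_le_const (a := 0) (b := h')
    (f := fun s => k h' s - k 0 0) (C := ε / 2) (fun s hs => by
      rw [uIoc_of_le h0'.le] at hs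
      have := h (x := (h', s)) (by
        rw [Prod.dist_eq, Real.dist_0_eq_abs, Real.dist_0_eq_abs, abs_of_pos h0', abs_of_pos hs.1]
        exact max_lt h1 (hs.2.trans_lt h1))
      rw [dist_eq_norm] at this
      exact this.le)
  rw [sub_zero, abs_of_pos h0'] at hb
  nlinarith

variable {X : Type*} [NormedAddCommGroup X] [InnerProductSpace ℂ X] {τ : ℝ}

/-- Integrated over (a, 0), translation of the history only moves the end points of an integral.
Difference quotients in t are then those of a primitive of z, and z itself need not be
differentiable. -/
theorem histIntegral_Ioo_histSeg {z : ℝ → X} (hz : ContinuousOn z (Ici 0))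
    (hφ : MemLp z 2 (histMeasure τ)) {a t : ℝ} (ha : a ∈ Ioo (-τ) 0) (ht : 0 ≤ t) :
    histIntegral X τ (Ioo a 0) (histSeg τ z t) = ∫ s in (a + t)..t, z s := by
  rw [histIntegral_apply,
    integral_congr_ae (ae_restrict_of_ae (coeFn_histSeg (memLp_shift hz hφ ht))), histMeasure,
    Measure.restrict_restrict measurableSet_Ioo, Ioo_inter_Ioo, max_eq_left ha.1.le, min_self,
    ← integral_Ioc_eq_integral_Ioo, ← intervalIntegral.integral_of_le ha.2.le,
    intervalIntegral.integral_comp_add_left, add_zero, add_comm]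

theorem histIntegral_Ioo (b : Hist X τ) {a : ℝ} (ha : a ∈ Ioo (-τ) 0) :
    histIntegral X τ (Ioo a 0) b = ∫ s in a..0, (Ioo (-τ) 0).indicator b s := by
  change ∫ θ in Ioo a 0, b θ ∂(volume.restrict (Ioo (-τ) 0)) = _
  rw [Measure.restrict_restrict measurableSet_Ioo, Ioo_inter_Ioo, max_eq_left ha.1.le, min_self,
    ← integral_Ioc_eq_integral_Ioo, intervalIntegral.integral_of_le ha.2.le,
    integral_Ioc_eq_integral_Ioo, integral_Ioc_eq_integral_Ioo]
  refine setIntegral_congr_fun measurableSet_Ioo fun s hs => ?_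
  exact (indicator_of_mem (show s ∈ Ioo (-τ) 0 from ⟨ha.1.trans hs.1, hs.2⟩) _).symm

theorem tendsto_slope_of_hasDerivAt {X : Type*} [NormedAddCommGroup X] [NormedSpace ℝ X]
    {g : ℝ → X} {y : X} {x : ℝ} (hg : HasDerivAt g y x) :
    Tendsto (fun h : ℝ => h⁻¹ • (g (x + h) - g x)) (𝓝[>] 0) (𝓝 y) :=
  (hasDerivAt_iff_tendsto_slope_zero.1 hg).mono_left
    (nhdsWithin_mono _ fun t (ht : 0 < t) => ne_of_gt ht)

variable [CompleteSpace X] (S : C0Semigroup X) (κ : ℝ)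

/-- The history component of the domain of the generator consists of primitives. -/
theorem ae_eq_primitive_of_genRel (hτ : 0 < τ) {p q : StateSpace X τ}
    (h : (delaySemigroup S κ hτ).GenRel p q) :
    ∀ᵐ θ ∂(histMeasure τ),
      p.snd θ = p.fst - ∫ s in θ..0, (Ioo (-τ) 0).indicator q.snd s := by
  obtain ⟨y, hydef⟩ : ∃ y, y = delayFlow S κ τ p := ⟨_, rfl⟩
  have hy := delayFlow_isForcedSolution S κ hτ p
  rw [← hydef] at hy
  have hym := hy.memLp (Lp.memLp p.snd)
  have hyi := hy.integrable_hist p.snd.integrable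
  have hint : ∀ {a b : ℝ}, -τ ≤ a → -τ ≤ b → IntervalIntegrable y volume a b := fun ha hb =>
    intervalIntegrable_of_hist hy.continuousOn hyi ha hb
  -- By Lebesgue differentiation, for almost every a the averages of y over (a, a + h) tend to y(a).
  have hleb := (hint (a := -τ) (b := 0) le_rfl (by linarith)).ae_hasDerivAt_integral
  have hhist := hy.history
  rw [Filter.EventuallyEq, ae_hist_iff] at hhist
  rw [ae_hist_iff]
  filter_upwards [hleb, hhist] with a h1 h2 ha
  rw [← h2 ha]
  have hd := h1 (by rw [uIcc_of_le (by linarith)]; exact Ioo_subset_Icc_self ha) 0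
    (by rw [uIcc_of_le (by linarith)]; exact ⟨by linarith, le_rfl⟩)
  have hl1 := tendsto_slope_of_hasDerivAt hd
  have hl2 : Tendsto (fun h : ℝ => h⁻¹ • ∫ s in (0 : ℝ)..h, y s) (𝓝[>] 0) (𝓝 p.fst) := by
    have hyc : Continuous fun t => y (max t 0) :=
      hy.continuousOn.comp_continuous (by fun_prop) fun t => mem_Ici.2 (le_max_right _ _)
    have := tendsto_average_param (k := fun _ s => y (max s 0)) (hyc.comp continuous_snd)
    rw [max_self, hy.initial] at this
    refine this.congr' ?_
    filter_upwards [self_mem_nhdsWithin] with h' hh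
    have hh' : (0 : ℝ) < h' := hh
    congr 1
    refine intervalIntegral.integral_congr fun s hs => ?_
    rw [uIcc_of_le hh'.le] at hs
    rw [max_eq_left hs.1]
  have hl3 : Tendsto (fun h' : ℝ => histIntegral X τ (Ioo a 0) ((WithLp.sndL 2 ℂ X (Hist X τ))
      (((h'⁻¹ : ℝ) : ℂ) • ((delaySemigroup S κ hτ).op h' p - p)))) (𝓝[>] 0)
      (𝓝 (histIntegral X τ (Ioo a 0) ((WithLp.sndL 2 ℂ X (Hist X τ)) q))) :=
    (((histIntegral X τ (Ioo a 0)).comp (WithLp.sndL 2 ℂ X (Hist X τ))).continuous.tendsto q).comp h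
  -- The same integrated difference quotient equals the average of y over (0, h) minus its average
  -- over (a, a + h), so it tends to p.fst - y(a); comparison with the limit in `hl3` gives the
  -- primitive formula at a.
  have hl4 : Tendsto (fun h' : ℝ => histIntegral X τ (Ioo a 0) ((WithLp.sndL 2 ℂ X (Hist X τ))
      (((h'⁻¹ : ℝ) : ℂ) • ((delaySemigroup S κ hτ).op h' p - p)))) (𝓝[>] 0)
      (𝓝 (p.fst - y a)) := by
    refine (hl2.sub hl1).congr' ?_
    filter_upwards [self_mem_nhdsWithin] with h' hh
    have hh' : (0 : ℝ) < h' := hh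
    have e0 : p.snd = histSeg τ y 0 := (congrArg WithLp.snd (stateOf_zero hy)).symm
    have e1 : (WithLp.sndL 2 ℂ X (Hist X τ))
        (((h'⁻¹ : ℝ) : ℂ) • ((delaySemigroup S κ hτ).op h' p - p)) =
        ((h'⁻¹ : ℝ) : ℂ) • (histSeg τ y h' - histSeg τ y 0) := by
      rw [map_smul, map_sub, delaySemigroup_op S κ hτ hh'.le, ← e0, ← hydef]
      rfl
    rw [e1, map_smul, map_sub, histIntegral_Ioo_histSeg hy.continuousOn hym ha hh'.le,
      histIntegral_Ioo_histSeg hy.continuousOn hym ha le_rfl, add_zero, Complex.coe_smul,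
      ← smul_sub]
    congr 1
    have i1 := intervalIntegral.integral_add_adjacent_intervals
      (hint (a := 0) (b := a + h') (by linarith) (by linarith [ha.1]))
      (hint (a := a + h') (b := h') (by linarith [ha.1]) (by linarith))
    rw [intervalIntegral.integral_symm a 0, ← i1]
    abel
  have := tendsto_nhds_unique hl3 hl4
  rw [← histIntegral_Ioo q.snd ha]
  have e : histIntegral X τ (Ioo a 0) q.snd = p.fst - y a := this
  rw [e, sub_sub_cancel]

/-- The easier inclusion, of the generator in 𝒜. The history is almost everywhere a continuous
primitive F. For 0 < h < τ the delayed term sees only F, and h⁻¹ ∫₀ʰ S(h-s) κ F(s-τ) ds tends to κ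
F(-τ). What remains of the first difference quotient is that of S at p.fst, so p.fst ∈ D(A). -/
theorem genRel_mem_delayGraph {A : X →ₗ.[ℂ] X} (hA : S.IsGenerator A) (hτ : 0 < τ)
    {p q : StateSpace X τ} (h : (delaySemigroup S κ hτ).GenRel p q) :
    (p, q) ∈ delayGraph A κ τ := by
  have hprim := ae_eq_primitive_of_genRel S κ hτ h
  set F : ℝ → X := fun θ => p.fst - ∫ s in θ..0, (Ioo (-τ) 0).indicator q.snd s with hF
  have hFc : Continuous F := continuous_const.sub (continuous_primitive_indicator q.snd.integrable)
  obtain ⟨y, hydef⟩ : ∃ y, y = delayFlow S κ τ p := ⟨_, rfl⟩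
  have hy := delayFlow_isForcedSolution S κ hτ p
  rw [← hydef] at hy
  have hyF : ∀ᵐ θ, θ ∈ Ioo (-τ) 0 → y θ = F θ := by
    rw [← ae_hist_iff]
    exact hy.history.trans hprim
  have hfst : Tendsto (fun h' : ℝ => ((h'⁻¹ : ℝ) : ℂ) • (y h' - p.fst)) (𝓝[>] 0) (𝓝 q.fst) := by
    refine (((WithLp.fstL 2 ℂ X (Hist X τ)).continuous.tendsto q).comp h).congr' ?_
    filter_upwards [self_mem_nhdsWithin] with h' hh
    simp only [Function.comp_apply, map_smul, map_sub]
    rw [delaySemigroup_op S κ hτ (le_of_lt hh), ← hydef]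
    rfl
  have hker := tendsto_average_param (k := fun h' s => S.ext (h' - s) ((κ : ℂ) • F (s - τ))) (by
    refine (continuous_uncurry_of_stronglyContinuous (K := S.ext)
      fun x => S.continuous_ext x).comp (f := fun p : ℝ × ℝ => (p.1 - p.2, (κ : ℂ) • F (p.2 - τ))) ?_
    fun_prop)
  rw [sub_zero, zero_sub, S.ext_of_nonneg le_rfl, S.op_zero_apply] at hker
  have hS : S.GenRel p.fst (q.fst - (κ : ℂ) • F (-τ)) := by
    refine (hfst.sub hker).congr' ?_
    filter_upwards [self_mem_nhdsWithin, mem_nhdsWithin_of_mem_nhds (Iio_mem_nhds hτ)] with h' h0 h1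
    have h0' : (0 : ℝ) < h' := h0
    have h1' : h' < τ := h1
    have e : ∫ s in (0 : ℝ)..h', S.ext (h' - s) ((κ : ℂ) • y (s - τ) + (0 : ℝ → X) s) =
        ∫ s in (0 : ℝ)..h', S.ext (h' - s) ((κ : ℂ) • F (s - τ)) := by
      refine intervalIntegral.integral_congr_ae ?_
      filter_upwards [ae_comp_add_right hyF (-τ)] with s hs hs'
      rw [uIoc_of_le h0'.le] at hs'
      rw [Pi.zero_apply, add_zero, sub_eq_add_neg s τ,
        hs ⟨by linarith [hs'.1], by linarith [hs'.2]⟩]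
    rw [hy.duhamel h' h0'.le, e, S.ext_of_nonneg h0'.le, Complex.coe_smul, Complex.coe_smul,
      ← smul_sub]
    congr 1
    abel
  have hg := (hA _ _).2 hS
  rw [LinearPMap.mem_graph_iff] at hg
  obtain ⟨w, hw1, hw2⟩ := hg
  dsimp only at hw1 hw2
  refine ⟨hw1 ▸ w.2, F, isWeakDeriv_of_eq_primitive hτ q.snd.integrable hprim,
    ⟨hFc.continuousOn, hprim⟩, ?_, ?_⟩
  · simp [hF]
  · have : (⟨p.fst, hw1 ▸ w.2⟩ : A.domain) = w := Subtype.ext hw1.symm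
    change q.fst = A ⟨p.fst, _⟩ + _
    rw [this, hw2, sub_add_cancel]

/-- Integrating factor: testing against e^{-ρθ} η shows that e^{-ρθ} f has zero weak derivative,
hence is constant. -/
theorem ae_eq_exp_of_weakDeriv (hτ : 0 < τ) (ρ : ℝ) {f g : ℝ → X}
    (hf : Integrable f (histMeasure τ)) (hg : g =ᵐ[histMeasure τ] fun θ => ρ • f θ)
    (h : IsWeakDeriv τ f g) : ∃ c, ∀ᵐ θ ∂(histMeasure τ), f θ = Real.exp (ρ * θ) • c := by
  have hψ : Integrable (fun θ => Real.exp (-(ρ * θ)) • f θ) (histMeasure τ) := by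
    obtain ⟨M, hM⟩ := (isCompact_Icc (a := -τ) (b := 0)).exists_bound_of_continuousOn
      (f := fun θ : ℝ => Real.exp (-(ρ * θ))) (by fun_prop)
    refine Integrable.bdd_smul (𝕜 := ℝ) hf M (by fun_prop) ?_
    filter_upwards [ae_restrict_mem measurableSet_Ioo] with θ hθ
    exact hM θ (Ioo_subset_Icc_self hθ)
  obtain ⟨c, hc⟩ := ae_eq_const_of_weakDeriv_zero hτ hψ (by
    intro η h1 h2 h3
    have hη1 : ContDiff ℝ ∞ fun θ => Real.exp (-(ρ * θ)) * η θ := by fun_prop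
    have hη2 : HasCompactSupport fun θ => Real.exp (-(ρ * θ)) * η θ := h2.mul_left
    have hη3 : tsupport (fun θ => Real.exp (-(ρ * θ)) * η θ) ⊆ Ioo (-τ) 0 :=
      (tsupport_mul_subset_right (f := fun θ => Real.exp (-(ρ * θ))) (g := η)).trans h3
    have key := h _ hη1 hη2 hη3
    have hd : ∀ θ, deriv (fun θ => Real.exp (-(ρ * θ)) * η θ) θ =
        Real.exp (-(ρ * θ)) * deriv η θ - ρ * (Real.exp (-(ρ * θ)) * η θ) := fun θ => by
      have d1 : HasDerivAt (fun θ => Real.exp (-(ρ * θ))) (Real.exp (-(ρ * θ)) * -(ρ * 1)) θ :=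
        (((hasDerivAt_id θ).const_mul ρ).neg).exp
      have d2 := ((h1.differentiable (by simp)).differentiableAt (x := θ)).hasDerivAt
      rw [(d1.fun_mul d2).deriv]
      ring
    have hint1 : Integrable (fun θ => (Real.exp (-(ρ * θ)) * deriv η θ) • f θ) (histMeasure τ) :=
      integrable_test_smul hf ((by fun_prop : Continuous fun θ : ℝ => Real.exp (-(ρ * θ))).mul
        (h1.continuous_deriv (by simp))) h2.deriv.mul_left
    have hint2 : Integrable (fun θ => ρ • (Real.exp (-(ρ * θ)) * η θ) • f θ) (histMeasure τ) :=
      (integrable_test_smul hf hη1.continuous hη2).smul ρ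
    have e1 : ∫ θ, (Real.exp (-(ρ * θ)) * η θ) • g θ ∂(histMeasure τ) =
        ∫ θ, ρ • (Real.exp (-(ρ * θ)) * η θ) • f θ ∂(histMeasure τ) := by
      refine integral_congr_ae ?_
      filter_upwards [hg] with θ hθ
      rw [hθ, smul_comm]
    simp_rw [hd, sub_smul, mul_smul ρ] at key
    rw [integral_sub hint1 hint2, e1] at key
    have key2 : ∫ θ, (Real.exp (-(ρ * θ)) * deriv η θ) • f θ ∂(histMeasure τ) = 0 := by
      have := congrArg (· + ∫ θ, ρ • (Real.exp (-(ρ * θ)) * η θ) • f θ ∂(histMeasure τ)) key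
      simpa using this
    rw [← key2]
    refine integral_congr_ae (Eventually.of_forall fun θ => ?_)
    dsimp only
    rw [smul_smul, mul_comm])
  refine ⟨c, ?_⟩
  filter_upwards [hc] with θ hθ
  rw [← hθ, smul_smul, ← Real.exp_add, add_neg_cancel, Real.exp_zero, one_smul]

/-- Injectivity of `ρ - 𝒜` when `ρ - κ e^{-ρτ} - A` is injective. -/
theorem eq_zero_of_mem_delayGraph {A : X →ₗ.[ℂ] X} (hτ : 0 < τ) {ρ : ℝ}
    (hinj : ∀ x : A.domain, A x = ((ρ - κ * Real.exp (-(ρ * τ)) : ℝ) : ℂ) • (x : X) → (x : X) = 0)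
    {p : StateSpace X τ} (h : (p, (ρ : ℂ) • p) ∈ delayGraph A κ τ) : p = 0 := by
  obtain ⟨hd, F, hw, hF, h0, hA⟩ := h
  dsimp only at hd hw hF h0 hA
  obtain ⟨c, hc⟩ := ae_eq_exp_of_weakDeriv hτ ρ p.snd.integrable
    (g := ((ρ : ℂ) • p).snd) (by
      filter_upwards [Lp.coeFn_smul (ρ : ℂ) p.snd] with θ hθ
      rw [WithLp.smul_snd, hθ, Pi.smul_apply, Complex.coe_smul]) hw
  have hFe : EqOn F (fun θ => Real.exp (ρ * θ) • c) (Icc (-τ) 0) := by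
    have h1 : F =ᵐ[volume.restrict (Icc (-τ) 0)] fun θ => Real.exp (ρ * θ) • c := by
      have : F =ᵐ[histMeasure τ] fun θ => Real.exp (ρ * θ) • c := hF.2.symm.trans hc
      rwa [histMeasure, restrict_Ioo_eq_restrict_Icc] at this
    exact Measure.eqOn_Icc_of_ae_eq _ (by linarith) h1 hF.1 (by fun_prop)
  have hc0 : c = p.fst := by
    rw [← h0, hFe ⟨by linarith, le_rfl⟩]
    simp
  -- The history is e^{ρθ} p.fst, so F(-τ) = e^{-ρτ} p.fst and the first component reads A x = (ρ -
  -- κ e^{-ρτ}) x.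
  have hx := hinj ⟨p.fst, hd⟩ (by
    rw [WithLp.smul_fst, hFe ⟨le_rfl, by linarith⟩, hc0] at hA
    rw [← sub_eq_iff_eq_add] at hA
    dsimp only at hA ⊢
    rw [← hA, mul_neg, ← Complex.coe_smul, smul_smul, ← sub_smul]
    push_cast
    rfl)
  dsimp only at hx
  refine StateSpace.ext hx (Lp.ext ?_)
  filter_upwards [hc, Lp.coeFn_zero X 2 (histMeasure τ)] with θ h1 h2
  rw [h1, hc0, hx, smul_zero]
  exact h2.symm

/-- The delay operator generates the delay semigroup. -/
theorem delaySemigroup_isGenerator {A : X →ₗ.[ℂ] X} (hA : S.IsGenerator A) (hτ : 0 < τ) :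
    (delaySemigroup S κ hτ).IsGenerator (delayOperator A κ τ) := by
  intro p q
  rw [delayOperator_graph A κ hτ]
  refine ⟨fun h => ?_, fun h => genRel_mem_delayGraph S κ hA hτ h⟩
  obtain ⟨γ₁, hγ₁, hR₁⟩ := S.exists_resolvent
  obtain ⟨γ₂, hγ₂, hR₂⟩ := (delaySemigroup S κ hτ).exists_resolvent
  -- Since ρ > 0 gives κ e^{-ρτ} ≤ |κ|, both ρ > γ₂ and ρ - κ e^{-ρτ} > γ₁ hold: ρ minus the
  -- generator of the delay semigroup is onto, and ρ - 𝒜 is injective.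
  set ρ := max γ₁ γ₂ + |κ| + 1 with hρ
  have hρ0 : 0 < ρ := by positivity
  have hκ : κ * Real.exp (-(ρ * τ)) ≤ |κ| := by
    calc κ * Real.exp (-(ρ * τ)) ≤ |κ| * 1 := by
          gcongr
          · exact le_abs_self κ
          · rw [Real.exp_le_one_iff]
            have := mul_pos hρ0 hτ
            linarith
      _ = |κ| := mul_one _
  obtain ⟨R₁, -, hR₁⟩ := hR₁ (ρ - κ * Real.exp (-(ρ * τ))) (by
    linarith [le_max_left γ₁ γ₂])
  obtain ⟨R₂, hR₂, -⟩ := hR₂ ρ (by linarith [le_max_right γ₁ γ₂, abs_nonneg κ])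
  -- Solve (ρ - generator) p' = ρ p - q. As the generator is contained in 𝒜, the difference p - p'
  -- lies in the kernel of ρ - 𝒜, so p = p' is in the domain of the generator.
  have h2 := hR₂ ((ρ : ℂ) • p - q)
  set p' := R₂ ((ρ : ℂ) • p - q)
  have h3 := (delayGraph A κ τ).sub_mem h (genRel_mem_delayGraph S κ hA hτ h2)
  have h4 : p - p' = 0 := by
    refine eq_zero_of_mem_delayGraph κ hτ (A := A) (ρ := ρ) (fun x hx => ?_) ?_
    · rw [← hR₁ x (A x) ((hA _ _).1 (A.mem_graph x)), hx, sub_self, map_zero]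
    · convert h3 using 1
      rw [Prod.mk_sub_mk, smul_sub]
      congr 1
      abel
  have h5 : p = p' := sub_eq_zero.1 h4
  rw [← h5] at h2
  rw [sub_sub_cancel] at h2
  exact h2

end DelayGenerator

/-! ### Reduction of both formulations to the forced equation -/

section Equivalence

variable {X : Type*} [NormedAddCommGroup X] [InnerProductSpace ℂ X] {τ : ℝ}

theorem IsForcedSolution.congr {S : C0Semigroup X} {κ : ℝ} {x : X} {φ f z z' : ℝ → X}
    (hz : IsForcedSolution S κ τ x φ f z) (h : z =ᵐ[histMeasure τ] z')
    (h' : ∀ t, 0 ≤ t → z t = z' t) : IsForcedSolution S κ τ x φ f z' := by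
  refine ⟨h.symm.trans hz.history, hz.continuousOn.congr fun t ht => (h' t ht).symm,
    fun t ht => ?_⟩
  rw [← h' t ht, hz.duhamel t ht]
  congr 1
  refine intervalIntegral.integral_congr_ae ?_
  filter_upwards [ae_comp_add_right (ae_hist_iff.1 h) (-τ)] with s hs hst
  rw [uIoc_of_le ht] at hst
  have : z (s - τ) = z' (s - τ) := by
    by_cases hn : s - τ < 0
    · exact hs ⟨by linarith [hst.1], hn⟩
    · exact h' _ (not_lt.1 hn)
  rw [this]

theorem stateMap_injective {C : X →L[ℂ] X} (hC : Function.Injective C) :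
    Function.Injective (stateMap τ C) := by
  intro p q h
  refine StateSpace.ext (hC ?_) (Lp.ext ?_)
  · rw [← stateMap_fst, ← stateMap_fst, h]
  · filter_upwards [stateMap_snd C p, stateMap_snd C q] with θ h1 h2
    rw [h, h2] at h1
    exact hC h1.symm

theorem stateMap_stateInl (C : X →L[ℂ] X) (x : X) :
    stateMap τ C (stateInl X τ x) = stateInl X τ (C x) := by
  refine StateSpace.ext rfl ?_
  exact map_zero (C.compLpL 2 (histMeasure τ))

/-- The embedding of `X` as states with constant history. -/
def stateConst (X : Type*) [NormedAddCommGroup X] [InnerProductSpace ℂ X] (τ : ℝ) :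
    X →L[ℂ] StateSpace X τ :=
  (WithLp.prodContinuousLinearEquiv 2 ℂ X (Hist X τ)).symm.toContinuousLinearMap.comp
    ((ContinuousLinearMap.id ℂ X).prod (Lp.constL 2 (histMeasure τ) ℂ))

theorem stateConst_snd (x : X) : (stateConst X τ x).snd =ᵐ[histMeasure τ] fun _ => x :=
  Lp.coeFn_const 2 (histMeasure τ) x

theorem stateMap_stateConst (C : X →L[ℂ] X) (x : X) :
    stateMap τ C (stateConst X τ x) = stateConst X τ (C x) := by
  refine StateSpace.ext rfl (Lp.ext ((stateMap_snd C _).trans ?_))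
  filter_upwards [stateConst_snd (τ := τ) x, stateConst_snd (τ := τ) (C x)] with θ h1 h2
  rw [h1, h2]

/-- The operator `f ↦ (ρ₁ - 𝒜)⁻¹ ((ρ₀ - A) f, 0)`, in a form bounded on `X`. -/
def liftResolvent (τ κ ρ₀ ρ₁ : ℝ) (R₁ : StateSpace X τ →L[ℂ] StateSpace X τ) :
    X →L[ℂ] StateSpace X τ :=
  stateConst X τ - R₁.comp ((ρ₁ : ℂ) • stateConst X τ - ((ρ₀ + κ : ℝ) : ℂ) • stateInl X τ)

theorem stateMap_liftResolvent {κ ρ₀ ρ₁ : ℝ} {C : X →L[ℂ] X}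
    {R₁ : StateSpace X τ →L[ℂ] StateSpace X τ}
    (hC : ∀ p, R₁ (stateMap τ C p) = stateMap τ C (R₁ p)) (x : X) :
    stateMap τ C (liftResolvent τ κ ρ₀ ρ₁ R₁ x) = liftResolvent τ κ ρ₀ ρ₁ R₁ (C x) := by
  simp only [liftResolvent, sub_apply, ContinuousLinearMap.comp_apply, smul_apply]
  rw [map_sub, ← hC, map_sub, map_smul, map_smul, stateMap_stateConst, stateMap_stateInl]

variable {U : Type*} [NormedAddCommGroup U] [InnerProductSpace ℂ U]

theorem intervalIntegrable_control {u : ℝ → U} (hu : L2Loc u) (b : U →L[ℂ] X) {t : ℝ}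
    (ht : 0 ≤ t) : IntervalIntegrable (fun s => b (u s)) volume 0 t := by
  rcases ht.eq_or_lt with rfl | h
  · exact IntervalIntegrable.refl
  · rw [intervalIntegrable_iff_integrableOn_Ioo_of_le ht]
    exact b.integrable_comp ((hu t h).integrable (by norm_num))

variable [CompleteSpace X]

theorem stateConst_mem_delayGraph (hτ : 0 < τ) (κ : ℝ) {A : X →ₗ.[ℂ] X} {x y : X}
    (h : (x, y) ∈ A.graph) :
    (stateConst X τ x, stateInl X τ (y + (κ : ℂ) • x)) ∈ delayGraph A κ τ := by
  rw [LinearPMap.mem_graph_iff] at h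
  obtain ⟨w, rfl, rfl⟩ := h
  refine ⟨w.2, fun _ => w, fun η h1 h2 h3 => ?_, ⟨continuousOn_const, stateConst_snd _⟩, rfl, rfl⟩
  have e1 : ∫ θ, deriv η θ • (stateConst X τ (w : X)).snd θ ∂(histMeasure τ) = 0 := by
    rw [integral_congr_ae (g := fun θ => deriv η θ • (w : X)), integral_smul_const,
      integral_deriv_test hτ h1 h3, zero_smul]
    filter_upwards [stateConst_snd (τ := τ) (w : X)] with θ hθ
    rw [hθ]
  have e2 : ∫ θ, η θ • ((0 : Hist X τ) : ℝ → X) θ ∂(histMeasure τ) = 0 := by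
    refine integral_eq_zero_of_ae ?_
    filter_upwards [Lp.coeFn_zero X 2 (histMeasure τ)] with θ hθ
    rw [hθ]
    exact smul_zero _
  exact e1.trans (by rw [← neg_zero, ← e2]; rfl)

/-- For f = R₀ x the state (f, f) with constant history is in D(𝒜), and 𝒜 (f, f) = (A f + κ f, 0)
with A f = ρ₀ f - x. Applying R₁ to (ρ₁ - 𝒜)(f, f) and solving for R₁ (x, 0) leaves an expression in
f alone that is bounded in f. Hence the -1 norm of (x, 0) is controlled by that of x. -/
theorem liftResolvent_apply_resolvent (hτ : 0 < τ) {κ ρ₀ ρ₁ : ℝ} {A : X →ₗ.[ℂ] X}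
    {R₀ : X →L[ℂ] X} (hR₀ : IsResolvent A ρ₀ R₀) {R₁ : StateSpace X τ →L[ℂ] StateSpace X τ}
    (hR₁ : IsResolvent (delayOperator A κ τ) ρ₁ R₁) (x : X) :
    liftResolvent τ κ ρ₀ ρ₁ R₁ (R₀ x) = R₁ (stateInl X τ x) := by
  have h := stateConst_mem_delayGraph hτ κ (hR₀.mem_graph x)
  rw [← delayOperator_graph A κ hτ] at h
  have h1 := hR₁.apply_of_graph h
  have e : (ρ₁ : ℂ) • stateConst X τ (R₀ x) - ((ρ₀ + κ : ℝ) : ℂ) • stateInl X τ (R₀ x) =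
      ((ρ₁ : ℂ) • stateConst X τ (R₀ x) -
        stateInl X τ ((ρ₀ : ℂ) • R₀ x - x + (κ : ℂ) • R₀ x)) - stateInl X τ x := by
    rw [map_add, map_sub, map_smul, map_smul]
    push_cast
    rw [add_smul]
    abel
  rw [liftResolvent, sub_apply, ContinuousLinearMap.comp_apply, sub_apply, smul_apply, smul_apply,
    e, map_sub R₁, h1, sub_sub_cancel]

/-- Applying the resolvent to the delayed control system gives a forced delay equation in `X`. -/
theorem isDelaySolution_iff {S : C0Semigroup X} {κ : ℝ} {A : X →ₗ.[ℂ] X} (hA : S.IsGenerator A)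
    {ρ₀ : ℂ} {R₀ : X →L[ℂ] X} (hR₀ : IsResolvent A ρ₀ R₀) (B : U →L[ℂ] Extrap R₀)
    {y₀ : X} {φ : Hist X τ} {u : ℝ → U} (hu : L2Loc u) {y : ℝ → X} :
    IsDelaySolution S R₀ B κ τ y₀ φ u y ↔
      y =ᵐ[histMeasure τ] φ ∧ y 0 = y₀ ∧ ContinuousOn y (Ici 0) ∧
        IsForcedSolution S κ τ (R₀ y₀) (fun θ => R₀ (φ θ))
          (fun s => resolventExt R₀ (B (u s))) fun s => R₀ (y s) := by
  -- History and continuity serve to make the delayed term integrable, so that R₀ may be taken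
  -- inside its integral and the two integrals merged.
  have key : y =ᵐ[histMeasure τ] φ → ContinuousOn y (Ici 0) → ∀ t : ℝ, 0 ≤ t →
      (toExtrap R₀ (y t) =
        toExtrap R₀ (S.op t y₀ + ∫ s in (0 : ℝ)..t, S.op (t - s) ((κ : ℂ) • y (s - τ))) +
          ∫ s in (0 : ℝ)..t, extrapMap R₀ (S.op (t - s)) (B (u s)) ↔
      R₀ (y t) = S.ext t (R₀ y₀) + ∫ s in (0 : ℝ)..t, S.ext (t - s)
        ((κ : ℂ) • R₀ (y (s - τ)) + resolventExt R₀ (B (u s)))) := by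
    intro hh hc t ht
    have hyd := intervalIntegrable_delayed hc (φ.integrable.congr hh.symm) le_rfl ht
    have hSi : ∀ x, Continuous fun t => S.ext t x := S.continuous_ext
    have i1 : IntervalIntegrable (fun s => S.ext (t - s) ((κ : ℂ) • y (s - τ))) volume 0 t :=
      intervalIntegrable_conv (K := S.ext) hSi (hyd.smul (κ : ℂ)) t
    have i2 : IntervalIntegrable (fun s => S.ext (t - s) (R₀ ((κ : ℂ) • y (s - τ)))) volume 0 t := by
      have : IntervalIntegrable (fun s => R₀ ((κ : ℂ) • y (s - τ))) volume 0 t := by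
        rw [intervalIntegrable_iff]
        exact R₀.integrable_comp (intervalIntegrable_iff.1 (hyd.smul (κ : ℂ)))
      exact intervalIntegrable_conv (K := S.ext) hSi this t
    have i3 : IntervalIntegrable (fun s => S.ext (t - s) (resolventExt R₀ (B (u s)))) volume 0 t :=
      intervalIntegrable_conv (K := S.ext) hSi
      (intervalIntegrable_control hu ((resolventExt R₀).comp B) ht) t
    have e0 : ∀ g : ℝ → X, ∫ s in (0 : ℝ)..t, S.op (t - s) (g s) =
        ∫ s in (0 : ℝ)..t, S.ext (t - s) (g s) := fun g =>
      intervalIntegral.integral_congr fun s hs => by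
        rw [uIcc_of_le ht] at hs
        rw [S.ext_of_nonneg (by linarith [hs.2])]
    rw [toExtrap_eq_add_integral_iff hA hR₀ _ _ _ ht, e0, e0, map_add,
      ← R₀.intervalIntegral_comp_comm i1, hA.commute hR₀ ht, S.ext_of_nonneg ht, add_assoc]
    have e1 : ∀ s, R₀ (S.ext (t - s) ((κ : ℂ) • y (s - τ))) =
        S.ext (t - s) (R₀ ((κ : ℂ) • y (s - τ))) := fun s =>
      hA.commute hR₀ (le_max_right _ _) _
    simp_rw [e1]
    rw [← intervalIntegral.integral_add i2 i3]
    simp only [map_smul, map_add]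
  constructor
  · intro h
    exact ⟨h.history, h.initial, h.continuousOn, h.history.fun_comp R₀,
      R₀.continuous.comp_continuousOn h.continuousOn,
      fun t ht => (key h.history h.continuousOn t ht).1 (h.duhamel t ht)⟩
  · rintro ⟨h1, h2, h3, h4⟩
    exact ⟨h1, h2, h3, fun t ht => (key h1 h3 t ht).2 (h4.duhamel t ht)⟩

/-- Applying `R₀` componentwise to the mild formulation of the abstract control problem gives an
identity in the state space. -/
theorem mild_iff_stateMap {S : C0Semigroup X} {κ : ℝ} {A : X →ₗ.[ℂ] X} (hA : S.IsGenerator A)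
    (hτ : 0 < τ) {ρ₀ ρ₁ : ℝ} {R₀ : X →L[ℂ] X} (hR₀ : IsResolvent A ρ₀ R₀)
    {R₁ : StateSpace X τ →L[ℂ] StateSpace X τ} (hR₁ : IsResolvent (delayOperator A κ τ) ρ₁ R₁)
    (w : ℝ → Extrap R₁) {v : ℝ → X} (hv : ∀ t, 0 ≤ t → IntervalIntegrable v volume 0 t)
    (hw : ∀ s, resolventExt R₁ (w s) = liftResolvent τ κ ρ₀ ρ₁ R₁ (v s))
    (Y Y₀ : StateSpace X τ) {t : ℝ} (ht : 0 ≤ t) :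
    toExtrap R₁ Y = toExtrap R₁ ((delaySemigroup S κ hτ).op t Y₀) +
        ∫ s in (0 : ℝ)..t, extrapMap R₁ ((delaySemigroup S κ hτ).op (t - s)) (w s) ↔
      stateMap τ R₀ Y = (delaySemigroup S κ hτ).op t (stateMap τ R₀ Y₀) +
        ∫ s in (0 : ℝ)..t, (delaySemigroup S κ hτ).op (t - s) (stateInl X τ (v s)) := by
  set T := delaySemigroup S κ hτ with hT
  have hgen : T.IsGenerator (delayOperator A κ τ) := delaySemigroup_isGenerator S κ hA hτ
  have hcomm : ∀ t, 0 ≤ t → ∀ p, stateMap τ R₀ (T.op t p) = T.op t (stateMap τ R₀ p) :=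
    fun t ht p => stateMap_delaySemigroup S κ hτ R₀ (fun t ht x => hA.commute hR₀ ht x) ht p
  have hRR : ∀ p, R₁ (stateMap τ R₀ p) = stateMap τ R₀ (R₁ p) :=
    hgen.resolvent_comm hR₁ _ hcomm
  set L := liftResolvent τ κ ρ₀ ρ₁ R₁
  have hint : ∀ C : X →L[ℂ] StateSpace X τ,
      IntervalIntegrable (fun s => T.ext (t - s) (C (v s))) volume 0 t := fun C => by
    have : IntervalIntegrable (fun s => C (v s)) volume 0 t := by
      rw [intervalIntegrable_iff]
      exact C.integrable_comp (intervalIntegrable_iff.1 (hv t ht))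
    exact intervalIntegrable_conv (K := T.ext) (fun x => T.continuous_ext x) this t
  have e0 : ∀ C : X →L[ℂ] StateSpace X τ, ∫ s in (0 : ℝ)..t, T.op (t - s) (C (v s)) =
      ∫ s in (0 : ℝ)..t, T.ext (t - s) (C (v s)) := fun C =>
    intervalIntegral.integral_congr fun s hs => by
      rw [uIcc_of_le ht] at hs
      rw [T.ext_of_nonneg (by linarith [hs.2])]
  -- Componentwise R₀ passes through the semigroup and L, and L R₀ = R₁ (·, 0): the integrand
  -- becomes R₁ applied to an honest convolution in the state space.
  have e1 : ∀ s, stateMap τ R₀ (T.ext (t - s) (L (v s))) =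
      R₁ (T.ext (t - s) (stateInl X τ (v s))) := fun s => by
    rw [C0Semigroup.ext, hcomm _ (le_max_right _ _), stateMap_liftResolvent hRR,
      liftResolvent_apply_resolvent hτ hR₀ hR₁, hgen.commute hR₁ (le_max_right _ _)]
  have e2 : ∫ s in (0 : ℝ)..t, T.op (t - s) (resolventExt R₁ (w s)) =
      ∫ s in (0 : ℝ)..t, T.ext (t - s) (L (v s)) := by
    simp_rw [hw]
    exact e0 L
  refine (toExtrap_eq_add_integral_iff hgen hR₁ _ _ _ ht).trans ?_
  change R₁ Y = R₁ (T.op t Y₀) + ∫ s in (0 : ℝ)..t, T.op (t - s) (resolventExt R₁ (w s)) ↔ _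
  -- The equivalence uses two injective maps: `stateMap τ R₀` is applied to both sides, then R₁, now
  -- in front of every term, is cancelled.
  rw [e2, e0 (stateInl X τ), ← (stateMap_injective (τ := τ) hR₀.injective).eq_iff, map_add,
    ← (stateMap τ R₀).intervalIntegral_comp_comm (hint L)]
  simp_rw [e1]
  rw [R₁.intervalIntegral_comp_comm (hint (stateInl X τ)), ← hRR, ← hRR, ← map_add,
    hR₁.injective.eq_iff, hcomm t ht]

end Equivalence

end DelaySystem
end

open DelaySystem in
theorem proposition2p1
    {X : Type*} [NormedAddCommGroup X] [InnerProductSpace ℂ X] [CompleteSpace X]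
    [TopologicalSpace.SeparableSpace X]
    {U : Type*} [NormedAddCommGroup U] [InnerProductSpace ℂ U] [CompleteSpace U]
    [TopologicalSpace.SeparableSpace U]
    (τ : ℝ) (hτ : 0 < τ) (κ : ℝ)
    (A : X →ₗ.[ℂ] X) (S : C0Semigroup X) (hA : S.IsGenerator A) (hS : S.ImmediatelyCompact)
    (ρ₀ : ℝ) (R₀ : X →L[ℂ] X) (hR₀ : IsResolvent A (ρ₀ : ℂ) R₀)
    (B : U →L[ℂ] Extrap R₀) (hB : IsAdmissible S A ρ₀ R₀ B) :
    -- the operator `𝒜` generates a semigroup `𝒮`, and has large `ρ₁` in its resolvent set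
    ∃ 𝒮 : C0Semigroup (StateSpace X τ), 𝒮.IsGenerator (delayOperator A κ τ) ∧
      (∃ γ : ℝ, 0 < γ ∧ ∀ ρ₁ : ℝ, γ < ρ₁ → ∃ R₁, IsResolvent (delayOperator A κ τ) (ρ₁ : ℂ) R₁) ∧
      ∀ (ρ₁ : ℝ) (R₁ : StateSpace X τ →L[ℂ] StateSpace X τ),
        IsResolvent (delayOperator A κ τ) (ρ₁ : ℂ) R₁ →
        -- the inclusion `J` of `X₋₁ × {0}` in `𝒳₋₁`, so that `ℬ = (B, 0) = J ∘ B`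
        ∃ J : Extrap R₀ →L[ℂ] Extrap R₁,
          (∀ x : X, J (toExtrap R₀ x) = toExtrap R₁ (WithLp.toLp 2 (x, 0))) ∧
          ∀ (y₀ : X) (φ : Hist X τ) (u : ℝ → U), L2Loc u →
            -- (i)
            (∀ y : ℝ → X, IsDelaySolution S R₀ B κ τ y₀ φ u y →
              ∃ Y : ℝ → StateSpace X τ,
                (∀ t : ℝ, 0 ≤ t → (Y t).fst = y t ∧
                  (Y t).snd =ᵐ[histMeasure τ] fun θ => y (t + θ)) ∧
                IsMildSolution 𝒮 R₁ (J.comp B) (WithLp.toLp 2 (y₀, φ)) u Y ∧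
                ∀ Y', IsMildSolution 𝒮 R₁ (J.comp B) (WithLp.toLp 2 (y₀, φ)) u Y' →
                  ∀ t : ℝ, 0 ≤ t → Y' t = Y t) ∧
            -- (ii)
            (∀ Y : ℝ → StateSpace X τ,
              IsMildSolution 𝒮 R₁ (J.comp B) (WithLp.toLp 2 (y₀, φ)) u Y →
              ∀ y : ℝ → X, (∀ t : ℝ, 0 ≤ t → y t = (Y t).fst) →
                (∀ t : ℝ, t ∈ Ioo (-τ) 0 → y t = φ t) →
                IsDelaySolution S R₀ B κ τ y₀ φ u y ∧
                (∀ y', IsDelaySolution S R₀ B κ τ y₀ φ u y' → ∀ t : ℝ, 0 ≤ t → y' t = y t) ∧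
                ∀ t : ℝ, 0 ≤ t → (Y t).snd =ᵐ[histMeasure τ] fun θ => y (t + θ)) := by
  have hgen := delaySemigroup_isGenerator S κ hA hτ
  refine ⟨delaySemigroup S κ hτ, hgen, ?_, fun ρ₁ R₁ hR₁ => ?_⟩
  · obtain ⟨γ, hγ, h⟩ := (delaySemigroup S κ hτ).exists_resolvent
    refine ⟨γ, hγ, fun ρ₁ hρ₁ => ?_⟩
    obtain ⟨R, h1, h2⟩ := h ρ₁ hρ₁
    exact ⟨R, isResolvent_of_graph (fun f => (hgen _ _).2 (h1 f))
      fun x y hxy => h2 x y ((hgen _ _).1 hxy)⟩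
  obtain ⟨J, hJ, hJ'⟩ := exists_extrap_map (stateInl X τ) (liftResolvent τ κ ρ₀ ρ₁ R₁)
    (liftResolvent_apply_resolvent hτ hR₀ hR₁)
  refine ⟨J, hJ, fun y₀ φ u hu => ?_⟩
  set p : StateSpace X τ := WithLp.toLp 2 (y₀, φ) with hp
  set v : ℝ → X := fun s => resolventExt R₀ (B (u s)) with hv_def
  have hv : ∀ t, 0 ≤ t → IntervalIntegrable v volume 0 t := fun t ht =>
    intervalIntegrable_control hu ((resolventExt R₀).comp B) ht
  have hpsnd : (stateMap τ R₀ p).snd =ᵐ[histMeasure τ] fun θ => R₀ (φ θ) := stateMap_snd R₀ p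
  have hmild := fun (Y : StateSpace X τ) (t : ℝ) (ht : 0 ≤ t) =>
    mild_iff_stateMap hA hτ hR₀ hR₁ (fun s => (J.comp B) (u s)) hv (fun s => hJ' (B (u s))) Y p ht
  have hinj₀ := hR₀.injective
  -- The right-hand side of the Duhamel formula does not involve Y, and 𝒳 embeds injectively in 𝒳₋₁.
  have huniq : ∀ Y Y', IsMildSolution (delaySemigroup S κ hτ) R₁ (J.comp B) p u Y →
      IsMildSolution (delaySemigroup S κ hτ) R₁ (J.comp B) p u Y' →
      ∀ t : ℝ, 0 ≤ t → Y' t = Y t := fun Y Y' hY hY' t ht =>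
    toExtrap_injective hR₁.injective ((hY'.duhamel t ht).trans (hY.duhamel t ht).symm)
  refine ⟨fun y hy => ?_, fun Y hY y hy1 hy2 => ?_⟩
  · obtain ⟨h1, h2, h3, h4⟩ := (isDelaySolution_iff hA hR₀ B hu).1 hy
    have hm : MemLp y 2 (histMeasure τ) := (Lp.memLp φ).ae_eq h1.symm
    have hY : IsMildSolution (delaySemigroup S κ hτ) R₁ (J.comp B) p u (stateOf τ y) := by
      refine ⟨continuousOn_stateOf h3 hm, fun t ht => (hmild _ t ht).2 ?_⟩
      rw [stateMap_stateOf R₀ (memLp_shift h3 hm ht)]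
      exact stateOf_eq_duhamel S κ hτ (p := stateMap τ R₀ p) (h4.congr_hist hpsnd.symm) hv ht
    exact ⟨stateOf τ y, fun t ht => ⟨rfl, coeFn_histSeg (memLp_shift h3 hm ht)⟩, hY,
      fun Y' hY' => huniq _ _ hY hY'⟩
  -- The candidate for R₀ y is built independently of Y, as the solution z of the forced equation
  -- with data R₀ y₀, R₀ φ and forcing v. Variation of constants shows that its state is the
  -- componentwise R₀ image of Y.
  · have hz := forcedFlow_isForcedSolution (S := S) (κ := κ) hτ (stateMap τ R₀ p).fst
      (stateMap τ R₀ p).snd.integrable hv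
    set z := forcedFlow S κ τ (stateMap τ R₀ p).fst (stateMap τ R₀ p).snd v
    have hYz : ∀ t, 0 ≤ t → stateMap τ R₀ (Y t) = stateOf τ z t := fun t ht => by
      rw [stateOf_eq_duhamel S κ hτ hz hv ht]
      exact (hmild _ t ht).1 (hY.duhamel t ht)
    have hzy : ∀ t, 0 ≤ t → z t = R₀ (y t) := fun t ht => by
      rw [hy1 t ht]
      exact (congrArg WithLp.fst (hYz t ht)).symm
    have hyφ : y =ᵐ[histMeasure τ] φ := by
      filter_upwards [ae_restrict_mem measurableSet_Ioo] with θ hθ using hy2 θ hθ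
    have hzh : z =ᵐ[histMeasure τ] fun s => R₀ (y s) :=
      (hz.history.trans hpsnd).trans (hyφ.symm.fun_comp R₀)
    have hY0 : Y 0 = p := by
      refine toExtrap_injective hR₁.injective ?_
      rw [hY.duhamel 0 le_rfl, intervalIntegral.integral_same, add_zero,
        C0Semigroup.op_zero_apply]
    have hyc : ContinuousOn y (Ici 0) :=
      ((WithLp.fstL 2 ℂ X (Hist X τ)).continuous.comp_continuousOn hY.continuousOn).congr
        fun t ht => hy1 t ht
    have hRy : IsForcedSolution S κ τ (R₀ y₀) (fun θ => R₀ (φ θ)) v fun s => R₀ (y s) :=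
      (hz.congr hzh hzy).congr_hist hpsnd
    refine ⟨(isDelaySolution_iff hA hR₀ B hu).2 ⟨hyφ, ?_, hyc, hRy⟩, fun y' hy' t ht => ?_,
      fun t ht => ?_⟩
    · rw [hy1 0 le_rfl, hY0]
      rfl
    · exact hinj₀ (((isDelaySolution_iff hA hR₀ B hu).1 hy').2.2.2.unique hτ hRy ht)
    -- Both histories agree after applying R₀, for almost every θ; injectivity of R₀ removes it.
    · have h1 := stateMap_snd R₀ (Y t)
      rw [hYz t ht] at h1
      have h2 := coeFn_histSeg (memLp_shift hz.continuousOn (hz.memLp (Lp.memLp _)) ht)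
      filter_upwards [h1, h2, ae_shift_of_hist hzh hzy ht] with θ k1 k2 k3
      exact hinj₀ (k1.symm.trans (k2.trans k3))
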